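/- **Definitions.** A linear threshold (LTF) gate on bits $y_1,\dots,y_r$ outputs $1$ iff $\sum_i w_i y_i\ge t$, for real weights $w_i$ and a real threshold $t$; its wires are the sources with nonzero weight. A $\mathsf{MAJ}\circ\mathsf{LTF}\circ\mathsf{LTF}$ circuit has bottom LTF gates reading input bits, middle LTF gates reading input bits and bottom gates, and an output gate that is an unweighted majority ($1$ iff at least half of its inputs are $1$) of middle gates (bottom gates and input bits are also allowed as inputs of the majority). Its numbers of gates and wires count all gates (including the output gate) and all wires. For $n\in\mathbb N$ let $k=16\lceil\log_2 n\rceil$ (with $k=0$ if $n=0$) and $m=2^k$. Call $A\in\mathbb F_2^{m\times n}$ *$K$-balanced* if its rows form a small-biased set in the following sense: for every nonzero $v\in\mathbb F_2^n$, the fraction of rows $r$ of $A$ with $\langle r,v\rangle\neq 0$ differs from $\frac12$ by at most $K n/\sqrt m$. (Equivalently, for all $x\ne y$ the vectors $Ax$ and $Ay$ agree on a fraction of positions within $Kn/\sqrt m$ of $\frac12$.) For such a matrix let $B_n=B_n^A:\{0,1\}^n\times\{0,1\}^n\to\{0,1\}$ be the function on $2n$ bits $$B_n(x,a)=(Ax)_{z},\qquad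 z=(z_1,\dots,z_k),\quad z_i=\sum_{j=(i-1)b+1}^{ib}a_j \bmod 2,\quad b=\lfloor n/k\rfloor,$$ where $(Ax)_z$ is the bit of $Ax$ at the position whose binary representation is $z$ (for $k=0$ there is only one position). When $n$ is a power of two and $k\mid n$, this is $k=16\log_2 n$ and a division of all of $a$ into $k$ equal blocks. **Theorem.** (1) There are a constant $K$ and $K$-balanced matrices $A_n\in\mathbb F_2^{m\times n}$, $n\in\mathbb N$, such that the function $B_n=B_n^{A_n}$ is computable in polynomial time: a single multi-tape Turing machine, running in time polynomial in its input length, outputs $B_n(x,a)$ on input $(x,a)$ for all $n$ and all $x,a\in\{0,1\}^n$. (2) For every choice of $K$-balanced matrices with $K$ constant, no $\mathsf{MAJ}\circ\mathsf{LTF}\circ\mathsf{LTF}$ circuit with $o(n^{3/2}/\log^3 n)$ gates or with $o(n^{5/2}/\log^{7/2}n)$ wires computes $B_n$. Precisely: there is a $c>0$ such that for every $K$ there is an $N$ such that for all $n\ge N$ and every $K$-balanced $A\in\mathbb F_2^{m\times n}$, every $\mathsf{MAJ}\circ\mathsf{LTF}\circ\mathsf{LTF}$ circuit computing $B_n^A$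 has at least $c\,n^{3/2}/\log^3 n$ gates and at least $c\,n^{5/2}/\log^{7/2} n$ wires. -/

import Mathlib

/-! ### Threshold circuits -/

/-- A linear threshold gate reading the bits `x i`, `i : κ`. -/
structure LTFGate (κ : Type) where
  weight : κ → ℝ
  threshold : ℝ

namespace LTFGate

variable {κ : Type} [Fintype κ]

/-- The gate outputs `1` iff `∑ i, weight i * x i ≥ threshold`. -/
noncomputable def eval (g : LTFGate κ) (x : κ → Bool) : Bool :=
  decide (g.threshold ≤ ∑ i, g.weight i * (if x i then 1 else 0))

/-- The number of wires entering the gate: sources of weight `0` are not wired to it. -/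
noncomputable def wires (g : LTFGate κ) : ℕ :=
  (Finset.univ.filter fun i => g.weight i ≠ 0).card

end LTFGate

/-- The (unweighted) majority of the bits `x i`, `i ∈ T`: it is `1` iff at least half of them
are `1`. -/
def majority {κ : Type} (T : Finset κ) (x : κ → Bool) : Bool :=
  decide (T.card ≤ 2 * (T.filter fun i => x i = true).card)

/-- A `MAJ ∘ LTF ∘ LTF` circuit on input bits indexed by `ι`.  Bottom gates read input bits;
middle gates read input bits and bottom gates; the output gate takes the majority of a set
of middle gates, where bottom gates and input bits are allowed as well (they are special
cases of depth-two threshold circuits). -/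
structure MajLtfLtf (ι : Type) where
  numBottom : ℕ
  numMiddle : ℕ
  bottom : Fin numBottom → LTFGate ι
  middle : Fin numMiddle → LTFGate (ι ⊕ Fin numBottom)
  top : Finset ((ι ⊕ Fin numBottom) ⊕ Fin numMiddle)

namespace MajLtfLtf

variable {ι : Type} [Fintype ι]

/-- Values of the sources of the middle gates. -/
noncomputable def bottomVal (C : MajLtfLtf ι) (x : ι → Bool) : ι ⊕ Fin C.numBottom → Bool :=
  Sum.elim x fun i => (C.bottom i).eval x

/-- Values of the sources of the output gate. -/
noncomputable def middleVal (C : MajLtfLtf ι) (x : ι → Bool) :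
    (ι ⊕ Fin C.numBottom) ⊕ Fin C.numMiddle → Bool :=
  Sum.elim (C.bottomVal x) fun i => (C.middle i).eval (C.bottomVal x)

/-- The output of the circuit. -/
noncomputable def eval (C : MajLtfLtf ι) (x : ι → Bool) : Bool :=
  majority C.top (C.middleVal x)

/-- The number of gates, the output gate included. -/
def gates (C : MajLtfLtf ι) : ℕ := C.numBottom + C.numMiddle + 1

/-- The number of wires. -/
noncomputable def wires (C : MajLtfLtf ι) : ℕ :=
  ∑ i, (C.bottom i).wires + ∑ i, (C.middle i).wires + C.top.card

end MajLtfLtf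

/-! ### The hard function -/

/-- A bit as an element of `𝔽₂`. -/
def bitF2 (b : Bool) : ZMod 2 := if b then 1 else 0

/-- The rows of `A` form a small-biased set, with deviation at most `δ`: for every nonzero `v`,
the fraction of rows `r` of `A` with `⟨r, v⟩ ≠ 0` differs from `1/2` by at most `δ`.
Equivalently, for all `x ≠ y`, the vectors `A x` and `A y` agree on a fraction of the positions
that differs from `1/2` by at most `δ`. -/
def SmallBiased {m t : ℕ} (A : Matrix (Fin m) (Fin t) (ZMod 2)) (δ : ℝ) : Prop :=
  ∀ v : Fin t → ZMod 2, v ≠ 0 →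
    |((Finset.univ.filter fun r => A.mulVec v r ≠ 0).card : ℝ) / (m : ℝ) - 1 / 2| ≤ δ

/-- The `k`-bit multiplexer: the entry of `y` at the position with binary representation `z`. -/
def multiplexer {k : ℕ} (y : Fin (2 ^ k) → ZMod 2) (z : Fin k → Bool) : ZMod 2 :=
  y (finFunctionFinEquiv fun i => if z i then 1 else 0)

/-- The parity of the `i`-th block (counted from `0`) of `b` consecutive bits of `a`. -/
def blockParity {n : ℕ} (b : ℕ) (a : Fin n → Bool) (i : ℕ) : Bool :=
  decide (∑ j ∈ Finset.univ.filter (fun j : Fin n => b * i ≤ (j : ℕ) ∧ (j : ℕ) < b * (i + 1)),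
    bitF2 (a j) = 1)

/-- `F(z, x)`: the bit of `A x` at position `z`. -/
def hardF {n k : ℕ} (A : Matrix (Fin (2 ^ k)) (Fin n) (ZMod 2)) (z : Fin k → Bool)
    (x : Fin n → Bool) : ZMod 2 :=
  multiplexer (A.mulVec fun j => bitF2 (x j)) z

/-- `B_{n,k}(x, a) = F(z, x)`, where `z i` is the parity of the `i`-th of `k` blocks of
`⌊n / k⌋` bits of `a`. -/
def hardB {n k : ℕ} (A : Matrix (Fin (2 ^ k)) (Fin n) (ZMod 2)) (x a : Fin n → Bool) : Bool :=
  decide (hardF A (fun i : Fin k => blockParity (n / k) a i) x = 1)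

/-- `k = 16 ⌈log₂ n⌉`, the number of blocks in `B_n`. -/
def blockCount (n : ℕ) : ℕ := 16 * Nat.clog 2 n

/-- The circuit `C`, on the `2 n` input bits `(x, a)`, computes `B_n` (with the matrix `A`). -/
def ComputesB {n : ℕ} (A : Matrix (Fin (2 ^ blockCount n)) (Fin n) (ZMod 2))
    (C : MajLtfLtf (Fin n ⊕ Fin n)) : Prop :=
  ∀ x a : Fin n → Bool, C.eval (Sum.elim x a) = hardB A x a

/-- The polynomially small deviation `K n / √m`, with `m = 2 ^ blockCount n` rows. -/
noncomputable def biasBound (K : ℝ) (n : ℕ) : ℝ := K * n / √((2 : ℝ) ^ blockCount n)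

/-- The Boolean function `f` on strings is computable by a multi-tape (multi-stack) Turing
machine in polynomial time. -/
def PolyTime (f : List Bool → Bool) : Prop :=
  Nonempty (Turing.TM2ComputableInPolyTime (fun s : List Bool => s) Computability.encodeBool f)

/-! Lower bound. Fix `x`, choose a random position in each of the `k` blocks of `a`, and fix the
remaining bits of `a` at random. Each block parity is then a free planted bit up to a fixed flip, so
the restricted circuit computes the codeword `A x` as a function of `k` address bits `z`. A bottom
gate that becomes constant, or that reads at most one planted bit, is affine in `z` and dissolves
into the linear forms of the middle gates. Only the `Bad` gates survive: those reading at least two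
planted bits and still not constant.

How often is a gate bad? A threshold gate is unate, so it is nonconstant exactly when its values at
the two extreme settings of the planted bits (`corner`) differ. Planting a corner amounts to
reweighting a uniform string, and averaging over the independent positions turns the weight into a
product `tilt` over blocks (`expect_ind_corner`, `expect_prod_eq_tilt`). With `w` wires into blocks
of length `b`, the block means have total variance `w / b ^ 2`, and Cauchy–Schwarz bounds the
probability by `O(√w / b)`. Removing the contribution of exactly one live block cancels the linear
term of the difference of tilts, which leaves `O(w / b ^ (3/2))`. This second bound is linear in `w`
and therefore sums to the number of wires.

A circuit that is too small would thus have at most `n / (96 k ^ 2)` bad gates on average. By Markov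
a single restriction leaves at most `t = O(n / k ^ 2)` bad gates for half of all `x`, and each of
these codewords is a majority of at most `M = n ^ 3` threshold functions of `z` and of `t` threshold
functions of `z`. By Sauer–Shelah there are only `2 ^ O(k ^ 2 t)`, in fact at most `2 ^ (n / 4)`,
such functions (`card_isDepthTwo`). Every nonzero codeword computed in this way correlates with one
of them to at least `1 / (4 M)` (`exists_correlated`), while the small bias makes codewords almost
orthogonal, so one function correlates with at most `32 M ^ 2` of them (`card_mul_sq_le_two`). Hence
`2 ^ (n - 1)` is at most `2 ^ (n / 4)` times a polynomial, which is absurd for large `n`.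

Polynomial time. The matrices come from the powering construction: with `d = k / 2`, a row is a pair
of `β` and `α` with `d` bits each, and its product with `x` is the inner product of `β` with the
coordinates of a fixed nonzero multiple of `∑ x j * α ^ j` in a domain with `2 ^ d` elements. For `x
≠ 0` at most `n` values of `α` are roots, and for every other `α` exactly half of the `β` give one,
so the deviation from one half is at most `n / 2 ^ d`. As `2 ^ d` is polynomial in `n`, a modulus
without zero divisors is found by exhaustive search. The algorithm is written as a loop program,
whose compilation to a stack machine is proved correct with a polynomial bound on the steps. -/

/-! ### Loop programs and their compilation to Turing machines -/

/-- Programs over list-valued variables.  `loop v c` runs `c b` for each entry `b` of (the initial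
content of) the variable `v`. -/
inductive LoopProg (V : Type)
  | skip : LoopProg V
  | push (v : V) (b : Bool) : LoopProg V
  | pop (v : V) : LoopProg V
  | seq (c d : LoopProg V) : LoopProg V
  | ite (v : V) (cnone : LoopProg V) (cfalse : LoopProg V) (ctrue : LoopProg V) : LoopProg V
  | loop (v : V) (c : Bool → LoopProg V) : LoopProg V

namespace LoopProg

variable {V : Type}

/-- The result of running a program; `none` if some loop iterates more than `B` times. -/
def run [DecidableEq V] (B : ℕ) : LoopProg V → (V → List Bool) → Option (V → List Bool)
  | skip, S => some S
  | push v b, S => some (Function.update S v (b :: S v))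
  | pop v, S => some (Function.update S v (S v).tail)
  | seq c d, S => (run B c S).bind (run B d)
  | ite v cn cf ct, S =>
    match (S v).head? with
    | none => run B cn S
    | some false => run B cf S
    | some true => run B ct S
  | loop v c, S =>
    if (S v).length ≤ B then (S v).foldlM (fun S b => run B (c b) S) S else none

/-- A bound on the number of steps of the compiled program, as a polynomial in the bound on the
number of iterations of each loop. -/
noncomputable def cost : LoopProg V → Polynomial ℕ
  | skip => 0
  | push _ _ => 0
  | pop _ => 0
  | seq c d => cost c + cost d
  | ite _ cn cf ct => cost cn + cost cf + cost ct
  | loop _ c => 3 * (Polynomial.X + 1) + Polynomial.X * (cost (c false) + cost (c true))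

/-- The loops occurring in a program. -/
def Loops : LoopProg V → Type
  | skip => Empty
  | push _ _ => Empty
  | pop _ => Empty
  | seq c d => Loops c ⊕ Loops d
  | ite _ cn cf ct => Loops cn ⊕ Loops cf ⊕ Loops ct
  | loop _ c => Option (Loops (c false) ⊕ Loops (c true))

theorem finite_loops (c : LoopProg V) : Finite (Loops c) := by
  induction c with
  | skip => exact inferInstanceAs (Finite Empty)
  | push v b => exact inferInstanceAs (Finite Empty)
  | pop v => exact inferInstanceAs (Finite Empty)
  | seq c d hc hd => exact inferInstanceAs (Finite (Loops c ⊕ Loops d))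
  | ite v cn cf ct hn hf ht => exact inferInstanceAs (Finite (Loops cn ⊕ Loops cf ⊕ Loops ct))
  | loop v c hc =>
    have := hc false
    have := hc true
    exact inferInstanceAs (Finite (Option (Loops (c false) ⊕ Loops (c true))))

/-- Statements of the machine with a stack for each variable, a stack for each loop, and an
auxiliary stack. -/
abbrev MStmt (V Λ : Type) : Type :=
  Turing.TM2.Stmt (fun _ : V ⊕ Option Λ => Bool) (Option (Λ × Fin 3)) (Option Bool)

variable {Λ : Type}

/-- The statement jumping to a label. -/
def jump (l : Λ) (i : Fin 3) : MStmt V Λ := .goto fun _ => some (l, i)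

/-- The statement executing a program and continuing with `κ`. -/
def comp : (c : LoopProg V) → (Loops c → Λ) → MStmt V Λ → MStmt V Λ
  | skip, _, κ => κ
  | push v b, _, κ => .push (.inl v) (fun _ => b) κ
  | pop v, _, κ => .pop (.inl v) (fun s _ => s) κ
  | seq c d, e, κ => comp c (fun j => e (.inl j)) (comp d (fun j => e (.inr j)) κ)
  | ite v cn cf ct, e, κ =>
    .peek (.inl v) (fun _ o => o) <|
      .branch Option.isNone (comp cn (fun j => e (.inl j)) κ) <|
        .branch (fun s => s = some false) (comp cf (fun j => e (.inr (.inl j))) κ)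
          (comp ct (fun j => e (.inr (.inr j))) κ)
  | loop _ _, e, _ => jump (e none) 0

/-- The statements at the labels belonging to the loops of a program. -/
def code : (c : LoopProg V) → (e : Loops c → Λ) → MStmt V Λ → Loops c → Fin 3 → MStmt V Λ
  | skip, _, _, j => nomatch j
  | push _ _, _, _, j => nomatch j
  | pop _, _, _, j => nomatch j
  | seq c d, e, κ, .inl j => code c (fun j => e (.inl j)) (comp d (fun j => e (.inr j)) κ) j
  | seq _ d, e, κ, .inr j => code d (fun j => e (.inr j)) κ j
  | ite _ cn _ _, e, κ, .inl j => code cn (fun j => e (.inl j)) κ j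
  | ite _ _ cf _, e, κ, .inr (.inl j) => code cf (fun j => e (.inr (.inl j))) κ j
  | ite _ _ _ ct, e, κ, .inr (.inr j) => code ct (fun j => e (.inr (.inr j))) κ j
  | loop v c, e, κ, none => fun i => match i with
    -- The loop must iterate over the initial content although the body may change `v`. So `v` is
    -- emptied onto the auxiliary stack and then poured back while a copy goes to the stack of the
    -- loop; the two reversals cancel, and only the copy is consumed by the iteration.
    | 0 => .pop (.inl v) (fun _ o => o) <|
        .branch Option.isSome (.push (.inr none) (fun s => s.getD false) (jump (e none) 0))
          (jump (e none) 1)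
    | 1 => .pop (.inr none) (fun _ o => o) <|
        .branch Option.isSome
          (.push (.inl v) (fun s => s.getD false) <|
            .push (.inr (some (e none))) (fun s => s.getD false) (jump (e none) 1))
          (jump (e none) 2)
    | 2 => .pop (.inr (some (e none))) (fun _ o => o) <|
        .branch Option.isNone κ <|
          .branch (fun s => s = some false)
            (comp (c false) (fun j => e (some (.inl j))) (jump (e none) 2))
            (comp (c true) (fun j => e (some (.inr j))) (jump (e none) 2))
  | loop _ c, e, _, some (.inl j) => code (c false) (fun j => e (some (.inl j))) (jump (e none) 2) j
  | loop _ c, e, _, some (.inr j) => code (c true) (fun j => e (some (.inr j))) (jump (e none) 2) j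

end LoopProg

/-! ### Correctness and step count of the compiled machine -/

namespace LoopProg

variable {V Λ : Type}

attribute [-simp] Sum.elim_update_left Sum.elim_update_right

/-- The machine reaches the configuration `b` from `a` in at most `n` steps. -/
def ReachesIn [DecidableEq V] [DecidableEq Λ] (M : Option (Λ × Fin 3) → MStmt V Λ) (n : ℕ)
    (a b : Turing.TM2.Cfg (fun _ : V ⊕ Option Λ => Bool) (Option (Λ × Fin 3)) (Option Bool)) :
    Prop :=
  ∃ m ≤ n, (flip bind (Turing.TM2.step M))^[m] (some a) = some b

variable [DecidableEq V] [DecidableEq Λ] {M : Option (Λ × Fin 3) → MStmt V Λ}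

theorem ReachesIn.refl {n : ℕ}
    (a : Turing.TM2.Cfg (fun _ : V ⊕ Option Λ => Bool) (Option (Λ × Fin 3)) (Option Bool)) :
    ReachesIn M n a a := ⟨0, Nat.zero_le _, rfl⟩

theorem ReachesIn.trans {m n : ℕ}
    {a b c : Turing.TM2.Cfg (fun _ : V ⊕ Option Λ => Bool) (Option (Λ × Fin 3)) (Option Bool)}
    (hab : ReachesIn M m a b) (hbc : ReachesIn M n b c) : ReachesIn M (m + n) a c := by
  obtain ⟨i, hi, h₁⟩ := hab
  obtain ⟨j, hj, h₂⟩ := hbc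
  exact ⟨j + i, by omega, by rw [Function.iterate_add_apply, h₁, h₂]⟩

theorem ReachesIn.mono {m n : ℕ} (h : m ≤ n)
    {a b : Turing.TM2.Cfg (fun _ : V ⊕ Option Λ => Bool) (Option (Λ × Fin 3)) (Option Bool)}
    (hab : ReachesIn M m a b) : ReachesIn M n a b := by
  obtain ⟨i, hi, h₁⟩ := hab
  exact ⟨i, hi.trans h, h₁⟩

theorem reachesIn_jump {q : MStmt V Λ} {l : Λ} {i : Fin 3} (hM : M (some (l, i)) = q)
    (σ : Option Bool) (S : V ⊕ Option Λ → List Bool) :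
    ReachesIn M 1 (Turing.TM2.stepAux (jump l i) σ S) (Turing.TM2.stepAux q σ S) :=
  ⟨1, le_rfl, by subst hM; rfl⟩

omit [DecidableEq V] in
theorem foldlM_cons_eq_some {α β : Type} {f : β → α → Option β} {a : α} {l : List α} {s t : β}
    (h : (a :: l).foldlM f s = some t) : ∃ u, f s a = some u ∧ l.foldlM f u = some t := by
  rw [List.foldlM_cons] at h
  exact Option.bind_eq_some_iff.1 h

/-- The first phase of a loop moves the content of its variable to the auxiliary stack. -/
theorem reachesIn_unload {v : V} {c : Bool → LoopProg V} {e : Loops (loop v c) → Λ} {κ : MStmt V Λ}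
    (hM : ∀ j i, M (some (e j, i)) = code (loop v c) e κ j i) (L : Option Λ → List Bool) :
    ∀ (l : List Bool) (S : V → List Bool) (T : List Bool), S v = l → ∀ σ,
      ReachesIn M (l.length + 1)
        (Turing.TM2.stepAux (jump (e none) 0) σ (Sum.elim S (Function.update L none T)))
        (Turing.TM2.stepAux (jump (e none) 1) none
          (Sum.elim (Function.update S v []) (Function.update L none (l.reverse ++ T)))) := by
  intro l
  induction l with
  | nil =>
    intro S T hS σ
    refine (reachesIn_jump (hM none 0) σ _).trans (n := 0) ?_
    have : Function.update S v [] = S := by rw [← hS]; simp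
    simp [code, hS, this, ReachesIn.refl]
  | cons b l ih =>
    intro S T hS σ
    have h := ih (Function.update S v l) (b :: T) (by simp) (some b)
    have := (reachesIn_jump (hM none 0) σ (Sum.elim S (Function.update L none T))).trans
      (n := l.length + 1) (c := _) (by simpa [code, hS] using h)
    refine ReachesIn.mono (m := 1 + (l.length + 1)) (by simp; omega) (by simpa using this)

/-- The second phase of a loop restores its variable and fills the stack of the loop. -/
theorem reachesIn_reload {v : V} {c : Bool → LoopProg V} {e : Loops (loop v c) → Λ} {κ : MStmt V Λ}
    (hM : ∀ j i, M (some (e j, i)) = code (loop v c) e κ j i) :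
    ∀ (l : List Bool) (S : V → List Bool) (L : Option Λ → List Bool), L none = l → ∀ σ,
      ReachesIn M (l.length + 1)
        (Turing.TM2.stepAux (jump (e none) 1) σ (Sum.elim S L))
        (Turing.TM2.stepAux (jump (e none) 2) none
          (Sum.elim (Function.update S v (l.reverse ++ S v))
            (Function.update (Function.update L none []) (some (e none))
              (l.reverse ++ L (some (e none)))))) := by
  intro l
  induction l with
  | nil =>
    intro S L hS σ
    refine (reachesIn_jump (hM none 1) σ _).trans (n := 0) ?_
    have : Function.update L none [] = L := by rw [← hS]; simp
    simp [code, hS, this, ReachesIn.refl]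
  | cons b l ih =>
    intro S L hS σ
    have h := ih (Function.update S v (b :: S v))
      (Function.update (Function.update L none l) (some (e none)) (b :: L (some (e none))))
      (by simp) (some b)
    have h2 : Function.update (Function.update (Function.update (Function.update L none l)
        (some (e none)) (b :: L (some (e none)))) none []) (some (e none))
          (l.reverse ++ b :: L (some (e none))) = Function.update (Function.update L none [])
            (some (e none)) (l.reverse ++ b :: L (some (e none))) := by
      funext x
      rcases x with _ | x
      · simp
      · by_cases hx : x = e none <;> simp [Function.update, hx]
    have := (reachesIn_jump (hM none 1) σ (Sum.elim S L)).trans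
      (n := l.length + 1) (c := _) (by simpa [code, hS, h2] using h)
    refine ReachesIn.mono (m := 1 + (l.length + 1)) (by simp; omega) (by simpa using this)

/-- The compiled program simulates the program. -/
theorem reachesIn_comp (B : ℕ) (c : LoopProg V) : ∀ (e : Loops c → Λ) (κ : MStmt V Λ),
    Function.Injective e → (∀ j i, M (some (e j, i)) = code c e κ j i) →
    ∀ (S S' : V → List Bool), run B c S = some S' →
    ∀ L : Option Λ → List Bool, L none = [] → (∀ j, L (some (e j)) = []) → ∀ σ, ∃ σ',
      ReachesIn M ((cost c).eval B) (Turing.TM2.stepAux (comp c e κ) σ (Sum.elim S L))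
        (Turing.TM2.stepAux κ σ' (Sum.elim S' L)) := by
  induction c with
  | skip =>
    intro e κ he hM S S' hr L hT hL σ
    obtain rfl : _ = S' := Option.some.inj hr
    exact ⟨σ, by simpa [comp] using ReachesIn.refl _⟩
  | push v b =>
    intro e κ he hM S S' hr L hT hL σ
    obtain rfl : _ = S' := Option.some.inj hr
    exact ⟨σ, by simpa [comp] using ReachesIn.refl _⟩
  | pop v =>
    intro e κ he hM S S' hr L hT hL σ
    obtain rfl : _ = S' := Option.some.inj hr
    exact ⟨σ, by simpa [comp] using ReachesIn.refl _⟩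
  | seq c d hc hd =>
    intro e κ he hM S S' hr L hT hL σ
    obtain ⟨S₁, h₁, h₂⟩ := Option.bind_eq_some_iff.1 hr
    obtain ⟨σ₁, r₁⟩ := hc (fun j => e (.inl j)) (comp d (fun j => e (.inr j)) κ)
      (he.comp Sum.inl_injective) (fun j i => hM (.inl j) i) S S₁ h₁ L hT (fun j => hL (.inl j)) σ
    obtain ⟨σ₂, r₂⟩ := hd (fun j => e (.inr j)) κ
      (he.comp Sum.inr_injective) (fun j i => hM (.inr j) i) S₁ S' h₂ L hT (fun j => hL (.inr j)) σ₁
    exact ⟨σ₂, by simpa [cost, comp] using r₁.trans r₂⟩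
  | ite v cn cf ct hn hf ht =>
    intro e κ he hM S S' hr L hT hL σ
    simp only [cost, Polynomial.eval_add]
    rcases hv : (S v).head? with _ | _ | _ <;> simp only [run, hv] at hr
    · obtain ⟨σ₁, r₁⟩ := hn (fun j => e (.inl j)) κ (he.comp Sum.inl_injective)
        (fun j i => hM (.inl j) i) S S' hr L hT (fun j => hL (.inl j)) none
      exact ⟨σ₁, by simpa [comp, hv] using r₁.mono (by omega)⟩
    · obtain ⟨σ₁, r₁⟩ := hf (fun j => e (.inr (.inl j))) κ
        (he.comp (Sum.inr_injective.comp Sum.inl_injective))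
        (fun j i => hM (.inr (.inl j)) i) S S' hr L hT (fun j => hL (.inr (.inl j))) (some false)
      exact ⟨σ₁, by simpa [comp, hv] using r₁.mono (by omega)⟩
    · obtain ⟨σ₁, r₁⟩ := ht (fun j => e (.inr (.inr j))) κ
        (he.comp (Sum.inr_injective.comp Sum.inr_injective))
        (fun j i => hM (.inr (.inr j)) i) S S' hr L hT (fun j => hL (.inr (.inr j))) (some true)
      exact ⟨σ₁, by simpa [comp, hv] using r₁.mono (by omega)⟩
  | loop v c hc =>
    intro e κ he hM S S' hr L hT hL σ
    simp only [run] at hr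
    split_ifs at hr with hB
    -- The iterations proper: induction on what is left of the copy on the stack of the loop.
    have key : ∀ (l : List Bool) (S S' : V → List Bool),
        l.foldlM (fun S b => run B (c b) S) S = some S' → ∀ σ, ∃ σ',
        ReachesIn M (l.length + 1 + l.length * ((cost (c false)).eval B + (cost (c true)).eval B))
          (Turing.TM2.stepAux (jump (e none) 2) σ
            (Sum.elim S (Function.update L (some (e none)) l)))
          (Turing.TM2.stepAux κ σ' (Sum.elim S' L)) := by
      intro l
      induction l with
      | nil =>
        intro S S' hr σ
        obtain rfl : _ = S' := Option.some.inj hr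
        refine ⟨none, ?_⟩
        refine ReachesIn.mono (by simp) ((reachesIn_jump (hM none 2) σ _).trans (n := 0) ?_)
        have : Function.update L (some (e none)) [] = L := by rw [← hL none]; simp
        simp [code, this, hL none, ReachesIn.refl]
      | cons b l ih =>
        intro S S' hr σ
        obtain ⟨S₁, h₁, h₂⟩ := foldlM_cons_eq_some hr
        -- Injectivity of `e` keeps the stacks of inner loops apart from the stack of this loop, so
        -- they are still empty when the body starts.
        have hLb : ∀ j, (Function.update L (some (e none)) l) (some (e (some j))) = [] := by
          intro j
          rw [Function.update_of_ne, hL (some j)]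
          intro h
          simpa using he (Option.some.inj h)
        have hT' : (Function.update L (some (e none)) l) none = [] := by simp [hT]
        have body : ∃ σ₁, ReachesIn M ((cost (c b)).eval B)
            (Turing.TM2.stepAux (code (loop v c) e κ none 2) σ
              (Sum.elim S (Function.update L (some (e none)) (b :: l))))
            (Turing.TM2.stepAux (jump (e none) 2) σ₁
              (Sum.elim S₁ (Function.update L (some (e none)) l))) := by
          cases b
          · obtain ⟨σ₁, r₁⟩ := hc false (fun j => e (some (.inl j))) (jump (e none) 2)
              (he.comp ((Option.some_injective _).comp Sum.inl_injective))
              (fun j i => hM (some (.inl j)) i) S S₁ h₁ (Function.update L (some (e none)) l) hT'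
              (fun j => hLb _) (some false)
            exact ⟨σ₁, by simpa [code] using r₁⟩
          · obtain ⟨σ₁, r₁⟩ := hc true (fun j => e (some (.inr j))) (jump (e none) 2)
              (he.comp ((Option.some_injective _).comp Sum.inr_injective))
              (fun j i => hM (some (.inr j)) i) S S₁ h₁ (Function.update L (some (e none)) l) hT'
              (fun j => hLb _) (some true)
            exact ⟨σ₁, by simpa [code] using r₁⟩
        obtain ⟨σ₁, r₁⟩ := body
        obtain ⟨σ₂, r₂⟩ := ih S₁ S' h₂ σ₁
        refine ⟨σ₂, (((reachesIn_jump (hM none 2) σ _).trans r₁).trans r₂).mono ?_⟩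
        simp only [List.length_cons]
        cases b <;> ring_nf <;> omega
    have h₀ := reachesIn_unload hM L (S v) S [] rfl σ
    have h₁ := reachesIn_reload hM (S v).reverse (Function.update S v [])
      (Function.update L none (S v).reverse) (by simp) none
    obtain ⟨σ₂, h₂⟩ := key (S v) S S' hr none
    have e₁ : Function.update L none [] = L := by rw [← hT]; simp
    rw [e₁] at h₀
    refine ⟨σ₂, ReachesIn.mono ?_ ((h₀.trans (n := (S v).reverse.length + 1) ?_).trans h₂)⟩
    -- Unloading, reloading and iterating each take one jump per entry and a final one, hence `3 *
    -- (B + 1)`; each body is charged the costs for both bit values.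
    · simp only [cost, Polynomial.eval_add, Polynomial.eval_mul, Polynomial.eval_X,
        Polynomial.eval_one, Polynomial.eval_ofNat, List.length_reverse]
      nlinarith [Nat.mul_le_mul_right ((cost (c false)).eval B + (cost (c true)).eval B) hB]
    · simpa [e₁, hL none] using h₁

/-- The machine running a program with input variable `i` and output variable `o`. -/
noncomputable def machine [Fintype V] (i o : V) (c : LoopProg V) : Turing.FinTM2 :=
  letI : Fintype (Loops c) := @Fintype.ofFinite _ (finite_loops c)
  letI : DecidableEq (Loops c) := Classical.decEq _
  { K := V ⊕ Option (Loops c)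
    k₀ := .inl i
    k₁ := .inl o
    Γ := fun _ => Bool
    Λ := Option (Loops c × Fin 3)
    main := none
    σ := Option Bool
    initialState := none
    Γk₀Fin := inferInstanceAs (Fintype Bool)
    m := fun l => match l with
      | none => comp c id (.load (fun _ => none) .halt)
      | some (j, n) => code c id (.load (fun _ => none) .halt) j n }

/-- A Boolean function computed by a loop program with polynomially bounded loops is computable in
polynomial time. -/
theorem polyTime_of_run [Fintype V] (i o : V) (c : LoopProg V) (B : Polynomial ℕ)
    (f : List Bool → Bool)
    (h : ∀ s, run (B.eval s.length) c (Function.update (fun _ => []) i s) =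
      some (Function.update (fun _ => []) o [f s])) : PolyTime f := by
  let eqv : Bool ≃ Bool := Equiv.refl _
  let : Fintype (Loops c) := @Fintype.ofFinite _ (finite_loops c)
  let : DecidableEq (Loops c) := Classical.decEq _
  have hcfg : ∀ (v : V) (s : List Bool),
      (fun k : V ⊕ Option (Loops c) => @dite (List Bool) (k = .inl v) ((machine i o c).kDecidableEq
        k (.inl v)) (fun _ => s.map eqv.invFun) fun _ => []) =
          Sum.elim (Function.update (fun _ => []) v s) (fun _ => []) := by
    intro v s
    funext k
    rcases k with u | j
    · by_cases hu : u = v <;> simp [hu, eqv]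
    · simp
  have hex : ∀ s, ∃ m ≤ ((cost c).comp B + 1).eval s.length,
      (flip bind (machine i o c).step)^[m] (some (Turing.initList (machine i o c)
        (List.map eqv.invFun s))) = some (Turing.haltList (machine i o c)
          (List.map eqv.invFun (Computability.encodeBool (f s)))) := by
    intro s
    obtain ⟨σ, m, hm, hm'⟩ := reachesIn_comp (M := (machine i o c).m) (B.eval s.length) c id
      (.load (fun _ => none) .halt) Function.injective_id (fun j n => rfl) _ _ (h s) (fun _ => [])
      rfl (fun _ => rfl) none
    have h₀ : Turing.initList (machine i o c) (List.map eqv.invFun s) =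
        ⟨some none, none, Sum.elim (Function.update (fun _ => []) i s) (fun _ => [])⟩ := by
      rw [← hcfg]
      rfl
    have h₁ : Turing.haltList (machine i o c)
        (List.map eqv.invFun (Computability.encodeBool (f s))) =
          ⟨none, none, Sum.elim (Function.update (fun _ => []) o [f s]) (fun _ => [])⟩ := by
      rw [← hcfg]
      rfl
    -- The additional step is the one that leaves the entry label.
    refine ⟨m + 1, by simpa using hm, ?_⟩
    rw [h₀, h₁, Function.iterate_succ_apply]
    exact hm'
  exact ⟨{ tm := machine i o c, inputAlphabet := eqv, outputAlphabet := eqv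
           time := (cost c).comp B + 1
           outputsFun := fun s =>
            ⟨⟨(hex s).choose, (hex s).choose_spec.2⟩, (hex s).choose_spec.1⟩ }⟩

end LoopProg

/-! ### Elementary list subroutines -/

namespace LoopProg

variable {V : Type} [DecidableEq V] {B : ℕ}

open Function

/-- Run a list of programs one after the other. -/
def block : List (LoopProg V) → LoopProg V
  | [] => skip
  | c :: cs => seq c (block cs)

@[simp] theorem run_skip (S : V → List Bool) : run B skip S = some S := rfl

@[simp] theorem run_push (v : V) (b : Bool) (S : V → List Bool) :
    run B (push v b) S = some (update S v (b :: S v)) := rfl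

@[simp] theorem run_pop (v : V) (S : V → List Bool) :
    run B (pop v) S = some (update S v (S v).tail) := rfl

@[simp] theorem run_block_nil (S : V → List Bool) : run B (block []) S = some S := rfl

@[simp] theorem run_block_cons (c : LoopProg V) (cs : List (LoopProg V)) (S : V → List Bool) :
    run B (block (c :: cs)) S = (run B c S).bind (run B (block cs)) := rfl

theorem run_ite_nil {v : V} {S : V → List Bool} (h : S v = []) (cn cf ct : LoopProg V) :
    run B (ite v cn cf ct) S = run B cn S := by simp [run, h]

theorem run_ite_false {v : V} {S : V → List Bool} {l : List Bool} (h : S v = false :: l)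
    (cn cf ct : LoopProg V) : run B (ite v cn cf ct) S = run B cf S := by simp [run, h]

theorem run_ite_true {v : V} {S : V → List Bool} {l : List Bool} (h : S v = true :: l)
    (cn cf ct : LoopProg V) : run B (ite v cn cf ct) S = run B ct S := by simp [run, h]

theorem run_loop {v : V} {S : V → List Bool} (h : (S v).length ≤ B) (c : Bool → LoopProg V) :
    run B (loop v c) S = (S v).foldlM (fun S b => run B (c b) S) S := by simp [run, h]

/-- Reasoning about a loop by an invariant: the state after a prefix of the list is processed. -/
theorem run_loop_of_invariant {v : V} {c : Bool → LoopProg V} {S S' : V → List Bool}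
    (I : List Bool → V → List Bool) (h : (S v).length ≤ B) (h₀ : I [] = S) (h₁ : I (S v) = S')
    (hs : ∀ l b t, S v = l ++ b :: t → run B (c b) (I l) = some (I (l ++ [b]))) :
    run B (loop v c) S = some S' := by
  have key : ∀ t l, S v = l ++ t → t.foldlM (fun S b => run B (c b) S) (I l) = some (I (S v)) := by
    intro t
    induction t with
    | nil => intro l hl; simp [hl]
    | cons b t ih =>
      intro l hl
      rw [List.foldlM_cons, hs l b t hl]
      exact ih _ (by simp [hl])
  rw [run_loop h, ← h₁, ← key _ [] rfl, h₀]

/-- Test whether a variable is nonempty. -/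
def ifSome (v : V) (ct cf : LoopProg V) : LoopProg V := ite v cf ct ct

theorem run_ifSome (v : V) (ct cf : LoopProg V) (S : V → List Bool) :
    run B (ifSome v ct cf) S = if S v = [] then run B cf S else run B ct S := by
  rcases h : S v with _ | ⟨_ | _, l⟩ <;> simp [ifSome, run, h]

theorem run_ifSome_of_nil {v : V} {S : V → List Bool} (h : S v = []) (ct cf : LoopProg V) :
    run B (ifSome v ct cf) S = run B cf S := by rw [run_ifSome, if_pos h]

theorem run_ifSome_of_ne {v : V} {S : V → List Bool} (h : S v ≠ []) (ct cf : LoopProg V) :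
    run B (ifSome v ct cf) S = run B ct S := by rw [run_ifSome, if_neg h]

/-- A flag: the empty list or `[true]`. -/
def flag (b : Bool) : List Bool := if b then [true] else []

@[simp] theorem flag_false : flag false = [] := rfl
@[simp] theorem flag_true : flag true = [true] := rfl
@[simp] theorem flag_eq_nil (b : Bool) : flag b = [] ↔ b = false := by cases b <;> simp

/-- Empty a variable. -/
def clear (v : V) : LoopProg V := loop v fun _ => pop v

theorem run_clear {v : V} {S : V → List Bool} (h : (S v).length ≤ B) :
    run B (clear v) S = some (update S v []) := by
  refine run_loop_of_invariant (fun l => update S v ((S v).drop l.length)) h (by simp) (by simp) ?_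
  intro l b t hl
  simp [hl]

/-- Push the reversal of a variable onto another one. -/
def rcopy (v w : V) : LoopProg V := loop v fun b => push w b

theorem run_rcopy {v w : V} {S : V → List Bool} (h : (S v).length ≤ B) :
    run B (rcopy v w) S = some (update S w ((S v).reverse ++ S w)) := by
  refine run_loop_of_invariant (fun l => update S w (l.reverse ++ S w)) h (by simp) rfl ?_
  intro l b t hl
  simp

/-- Replace a variable by its reversed copy, emptying the source. -/
def rmove (v w : V) : LoopProg V := block [clear w, rcopy v w, clear v]

theorem run_rmove {v w : V} {S : V → List Bool} (hv : (S v).length ≤ B) (hw : (S w).length ≤ B)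
    (hvw : v ≠ w) :
    run B (rmove v w) S = some (update (update S w (S v).reverse) v []) := by
  simp [rmove, run_clear hw, run_rcopy, run_clear, hvw, hv]

/-- Negate a flag. -/
def toggle (q : V) : LoopProg V := ifSome q (pop q) (push q true)

theorem run_toggle {q : V} {S : V → List Bool} {b : Bool} (h : S q = flag b) :
    run B (toggle q) S = some (update S q (flag !b)) := by
  rw [toggle, run_ifSome, h]
  cases b <;> simp [h]

theorem length_flag_le (b : Bool) : (flag b).length ≤ 1 := by cases b <;> simp

/-- Push, in unary, half of the length of `v` onto `w`, with an auxiliary flag. -/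
def half (v w q : V) : LoopProg V :=
  block [loop v fun _ => ifSome q (block [pop q, push w true]) (push q true), clear q]

theorem run_half {v w q : V} {S : V → List Bool} (hB : 1 ≤ B) (h : (S v).length ≤ B)
    (hwq : w ≠ q) (hq : S q = []) (hw : S w = []) :
    run B (half v w q) S =
      some (update S w (List.replicate ((S v).length / 2) true)) := by
  have h₁ : run B (loop v fun _ => ifSome q (block [pop q, push w true]) (push q true)) S =
      some (update (update S w (List.replicate ((S v).length / 2) true)) q
        (flag ((S v).length % 2 = 1))) := by
    refine run_loop_of_invariant (fun l => update (update S w (List.replicate (l.length / 2) true)) q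
      (flag (l.length % 2 = 1))) h ?_ rfl ?_
    · funext k
      simp only [update_apply]
      split_ifs <;> simp_all
    · intro l b t hl
      rw [run_ifSome]
      rcases Nat.mod_two_eq_zero_or_one l.length with hi | hi
      · have e₁ : (l.length + 1) / 2 = l.length / 2 := by omega
        have e₂ : (l.length + 1) % 2 = 1 := by omega
        simp [hi, e₁, e₂]
      · have e₁ : (l.length + 1) / 2 = l.length / 2 + 1 := by omega
        have e₂ : (l.length + 1) % 2 = 0 := by omega
        simp only [hi, e₁, e₂, List.length_append, List.length_cons, List.length_nil]
        simp only [update_self, decide_true, flag_true, run_block_cons, run_pop, reduceCtorEq,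
          if_false, Option.bind_some, run_push, run_block_nil, Option.some.injEq]
        funext k
        simp only [update_apply]
        split_ifs <;> simp_all [List.replicate_succ]
  rw [half, run_block_cons, h₁]
  simp only [Option.bind_some, run_block_cons]
  rw [run_clear (by simpa using (length_flag_le _).trans hB)]
  simp [hwq.symm, ← hq]

end LoopProg

/-! ### Splitting, binary counting and linear combinations over 𝔽₂ -/

namespace LoopProg

variable {V : Type} [DecidableEq V] {B : ℕ}

open Function

/-- Split `v` after as many entries as `C` has, pushing the parts onto `x` and `y`. -/
def split (v C x y : V) : LoopProg V :=
  block [loop v fun b => ifSome C (block [pop C, push x b]) (push y b), clear C]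

theorem run_split {v C x y : V} {S : V → List Bool} (hv : (S v).length ≤ B)
    (hC : (S C).length ≤ B) (hCx : C ≠ x) (hCy : C ≠ y) (hxy : x ≠ y) (hx : S x = [])
    (hy : S y = []) :
    run B (split v C x y) S =
      some (update (update (update S C []) x ((S v).take (S C).length).reverse) y
        ((S v).drop (S C).length).reverse) := by
  have h₁ : run B (loop v fun b => ifSome C (block [pop C, push x b]) (push y b)) S =
      some (update (update (update S C ((S C).drop (S v).length)) x
        ((S v).take (S C).length).reverse) y ((S v).drop (S C).length).reverse) := by
    refine run_loop_of_invariant (fun l => update (update (update S C ((S C).drop l.length)) x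
        (l.take (S C).length).reverse) y (l.drop (S C).length).reverse) hv ?_ rfl ?_
    · funext k
      simp only [update_apply]
      split_ifs <;> simp_all
    · intro l b t hl
      rw [run_ifSome]
      have e : update (update (update S C ((S C).drop l.length)) x
        (l.take (S C).length).reverse) y (l.drop (S C).length).reverse C =
          (S C).drop l.length := by simp [hCx, hCy]
      rw [e]
      split_ifs with h
      · rw [List.drop_eq_nil_iff] at h
        simp only [run_push, Option.some.injEq]
        funext k
        simp only [update_apply]
        split_ifs
        · simp [List.drop_append, List.reverse_append, Nat.sub_eq_zero_of_le h]
        · simp [List.take_append, Nat.sub_eq_zero_of_le h]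
        · rw [List.drop_eq_nil_of_le h, List.drop_eq_nil_of_le (by simp; omega)]
        · rfl
      · rw [List.drop_eq_nil_iff, not_le] at h
        simp only [run_push, Option.some.injEq, run_block_cons, run_pop, Option.bind_some,
          run_block_nil]
        funext k
        have h1 : List.drop (S C).length l = [] := List.drop_eq_nil_of_le h.le
        have h2 : List.drop (S C).length (l ++ [b]) = [] :=
          List.drop_eq_nil_of_le (by simp; omega)
        have h3 : List.take (S C).length l = l := List.take_of_length_le h.le
        have h4 : List.take (S C).length (l ++ [b]) = l ++ [b] :=
          List.take_of_length_le (by simp; omega)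
        by_cases hk : k = y
        · subst hk
          simp [hxy.symm, hCy.symm, h1, h2]
        by_cases hk' : k = x
        · subst hk'
          simp [hxy, hCx.symm, h3, h4]
        by_cases hk'' : k = C
        · subst hk''
          simp [hCx, hCy]
        simp [hk, hk', hk'']
  rw [split, run_block_cons, h₁]
  simp only [Option.bind_some, run_block_cons]
  rw [run_clear (by simp [hCx, hCy]; omega)]
  simp only [Option.bind_some, run_block_nil, Option.some.injEq]
  funext k
  simp only [update_apply]
  split_ifs <;> simp_all

/-- Increment of a binary number of fixed length, the least significant bit first. -/
def inc : List Bool → List Bool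
  | [] => []
  | false :: l => true :: l
  | true :: l => false :: inc l

/-- Replace `w` by `inc w`, with an auxiliary variable `T` and an auxiliary flag `q`. -/
def incr (w T q : V) : LoopProg V :=
  block [push q true,
    loop w fun b => if b then ifSome q (push T false) (push T true) else
      ifSome q (block [pop q, push T true]) (push T false),
    clear q, rmove T w]

@[simp] theorem length_inc (l : List Bool) : (inc l).length = l.length := by
  induction l with
  | nil => rfl
  | cons b l ih => cases b <;> simp [inc, ih]

/-- The carry reaches the new bit exactly when all earlier bits are one; this carry is what the flag
`q` of `incr` records. -/
theorem inc_append_singleton (l : List Bool) (b : Bool) :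
    inc (l ++ [b]) = inc l ++ [xor b (l.all id)] := by
  induction l with
  | nil => cases b <;> rfl
  | cons a l ih => cases a <;> simp [inc, ih]

theorem run_incr {w T q : V} {S : V → List Bool} (hB : 1 ≤ B) (hw : (S w).length ≤ B)
    (hwT : w ≠ T) (hwq : w ≠ q) (hTq : T ≠ q) (hT : S T = []) (hq : S q = []) :
    run B (incr w T q) S = some (update S w (inc (S w))) := by
  have h₁ : run B (loop w fun b => if b then ifSome q (push T false) (push T true) else
      ifSome q (block [pop q, push T true]) (push T false)) (update S q [true]) =
        some (update (update S q (flag ((S w).all id))) T (inc (S w)).reverse) := by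
    refine run_loop_of_invariant
      (fun l => update (update S q (flag (l.all id))) T (inc l).reverse) (by simpa [hwq]) ?_
        (by simp [hwq]) ?_
    · funext k
      simp only [update_apply]
      split_ifs <;> simp_all [inc]
    · intro l b t hl
      simp only [inc_append_singleton]
      cases b <;> cases h : l.all id <;>
        simp only [run_ifSome, update_self, ne_eq, hTq.symm, not_false_eq_true, update_of_ne,
          reduceCtorEq, if_true, if_false, flag_false, flag_true, run_push, run_block_cons,
          run_pop, Option.bind_some, run_block_nil, Option.some.injEq, List.all_append, h,
          List.reverse_append, Bool.false_eq_true] <;> funext k <;>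
        simp only [update_apply] <;> split_ifs <;> simp_all
  rw [incr, run_block_cons, run_push]
  simp only [Option.bind_some, run_block_cons, hq]
  rw [h₁]
  simp only [Option.bind_some, run_block_cons]
  rw [run_clear (by simpa [hTq.symm] using (length_flag_le _).trans hB)]
  simp only [Option.bind_some, run_block_cons]
  rw [run_rmove (by simpa [hTq]) (by simpa [hwT, hwq]) hwT.symm]
  simp only [Option.bind_some, run_block_nil, Option.some.injEq]
  funext k
  simp only [update_apply]
  split_ifs <;> simp_all

/-- The sum of `R` and `c` times `w`, as vectors over `𝔽₂`, where `R` is padded with zeros. -/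
def axpyL (c : Bool) : List Bool → List Bool → List Bool
  | [], _ => []
  | a :: w, R => xor (c && a) (R.headD false) :: axpyL c w R.tail

@[simp] theorem length_axpyL (c : Bool) (w R : List Bool) :
    (axpyL c w R).length = w.length := by
  induction w generalizing R with
  | nil => rfl
  | cons a w ih => simp [axpyL, ih]

theorem axpyL_append_singleton (c : Bool) (w R : List Bool) (a : Bool) :
    axpyL c (w ++ [a]) R = axpyL c w R ++ [xor (c && a) ((R.drop w.length).headD false)] := by
  induction w generalizing R with
  | nil => rfl
  | cons a w ih => cases R <;> simp [axpyL, ih]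

/-- Replace `R` by `R + c * w`, with an auxiliary variable `T`. -/
def axpy (c : Bool) (w R T : V) : LoopProg V :=
  block [loop w fun a => ite R (push T (c && a)) (block [pop R, push T (c && a)])
    (block [pop R, push T (!(c && a))]), rmove T R]

theorem run_axpy {c : Bool} {w R T : V} {S : V → List Bool} (hw : (S w).length ≤ B)
    (hR : (S R).length ≤ B) (hRT : R ≠ T) (hT : S T = []) :
    run B (axpy c w R T) S = some (update S R (axpyL c (S w) (S R))) := by
  have h₁ : run B (loop w fun a => ite R (push T (c && a)) (block [pop R, push T (c && a)])
      (block [pop R, push T (!(c && a))])) S =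
        some (update (update S R ((S R).drop (S w).length)) T (axpyL c (S w) (S R)).reverse) := by
    refine run_loop_of_invariant (fun l => update (update S R ((S R).drop l.length)) T
      (axpyL c l (S R)).reverse) hw ?_ rfl ?_
    · funext k
      simp only [update_apply]
      split_ifs <;> simp_all [axpyL]
    · intro l b t hl
      simp only [axpyL_append_singleton]
      have e : update (update S R ((S R).drop l.length)) T
        (axpyL c l (S R)).reverse R = (S R).drop l.length := by simp [hRT]
      rcases h : (S R).drop l.length with _ | ⟨_ | _, r⟩
      · rw [run_ite_nil (by rw [← h]; exact e)]
        have : List.drop (l.length + 1) (S R) = [] := by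
          rw [List.drop_eq_nil_iff] at h ⊢; omega
        simp [this]
      all_goals
        have hr : List.drop (l.length + 1) (S R) = r := by rw [← List.tail_drop, h, List.tail_cons]
        first
        | rw [run_ite_false (by rw [← h]; exact e)]
        | rw [run_ite_true (by rw [← h]; exact e)]
        simp only [run_push, run_block_cons, run_pop, Option.bind_some, run_block_nil,
          Option.some.injEq, List.length_append, List.length_cons, List.length_nil, zero_add, hr]
        funext k
        simp only [update_apply]
        split_ifs <;> simp_all
  rw [axpy, run_block_cons, h₁]
  simp only [Option.bind_some, run_block_cons]
  rw [run_rmove (by simpa) (by simp [hRT]; omega) hRT.symm]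
  simp only [Option.bind_some, run_block_nil, Option.some.injEq]
  funext k
  simp only [update_apply]
  split_ifs <;> simp_all

/-- Set the flag `q` if the variable `w` has a nonzero entry. -/
def nonzero (w q : V) : LoopProg V := loop w fun b => if b then ifSome q skip (push q true) else skip

theorem run_nonzero {w q : V} {S : V → List Bool} (hw : (S w).length ≤ B) (hq : S q = []) :
    run B (nonzero w q) S = some (update S q (flag ((S w).any id))) := by
  refine run_loop_of_invariant (fun l => update S q (flag (l.any id))) hw ?_ rfl ?_
  · simp [hq]
  · intro l b t hl
    cases b <;> cases h : l.any id <;> simp [run_ifSome, h]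

end LoopProg

/-! ### Parities, multiplication modulo a polynomial, inner products -/

namespace LoopProg

variable {V : Type} [DecidableEq V] {B : ℕ}

open Function

/-- Push as many bits `b` onto `R` as `D` has entries. -/
def fill (D R : V) (b : Bool) : LoopProg V := loop D fun _ => push R b

theorem run_fill {D R : V} {b : Bool} {S : V → List Bool} (hD : (S D).length ≤ B) :
    run B (fill D R b) S = some (update S R (List.replicate (S D).length b ++ S R)) := by
  refine run_loop_of_invariant (fun l => update S R (List.replicate l.length b ++ S R)) hD
    (by simp) rfl ?_
  intro l a t hl
  simp [List.replicate_succ]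

/-- The sum of bits modulo two. -/
def parityL (l : List Bool) : Bool := l.foldl xor false

theorem parityL_append_singleton (l : List Bool) (b : Bool) :
    parityL (l ++ [b]) = xor (parityL l) b := by simp [parityL]

/-- Pop a bit of `A` and add it to the flag `q`. -/
def popXor (A q : V) : LoopProg V := ite A skip (pop A) (block [pop A, toggle q])

theorem run_popXor {A q : V} {S : V → List Bool} {b : Bool} (hAq : A ≠ q) (hq : S q = flag b) :
    run B (popXor A q) S =
      some (update (update S A (S A).tail) q (flag (xor b ((S A).headD false)))) := by
  rcases h : S A with _ | ⟨_ | _, l⟩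
  · rw [popXor, run_ite_nil h]
    simp only [run_skip, Option.some.injEq]
    funext k
    simp only [update_apply]
    split_ifs <;> simp_all
  · rw [popXor, run_ite_false h]
    simp only [run_pop, Option.some.injEq]
    funext k
    simp only [update_apply]
    split_ifs <;> simp_all
  · rw [popXor, run_ite_true h]
    simp only [run_block_cons, run_pop, Option.bind_some]
    rw [run_toggle (b := b) (by simpa [hAq.symm])]
    simp [h]

/-- Pop as many bits of `A` as `Q` has entries and push their parity onto `Z`. -/
def blockPar (Q A q Z : V) : LoopProg V :=
  block [loop Q fun _ => popXor A q, ifSome q (push Z true) (push Z false), clear q]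

theorem run_blockPar {Q A q Z : V} {S : V → List Bool} (hB : 1 ≤ B) (hQ : (S Q).length ≤ B)
    (hAq : A ≠ q) (hAZ : A ≠ Z) (hqZ : q ≠ Z) (hq : S q = []) :
    run B (blockPar Q A q Z) S =
      some (update (update S A ((S A).drop (S Q).length)) Z
        (parityL ((S A).take (S Q).length) :: S Z)) := by
  have h₁ : run B (loop Q fun _ => popXor A q) S =
      some (update (update S A ((S A).drop (S Q).length)) q
        (flag (parityL ((S A).take (S Q).length)))) := by
    refine run_loop_of_invariant (fun l => update (update S A ((S A).drop l.length)) q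
        (flag (parityL ((S A).take l.length)))) hQ ?_ rfl ?_
    · funext k
      simp only [update_apply]
      split_ifs <;> simp_all [parityL]
    · intro l b t hl
      rw [run_popXor hAq (update_self _ _ _)]
      have : parityL (List.take (l.length + 1) (S A)) =
          xor (parityL (List.take l.length (S A))) ((List.drop l.length (S A)).headD false) := by
        by_cases hlt : l.length < (S A).length
        · rw [List.take_succ_eq_append_getElem hlt, parityL_append_singleton,
            List.drop_eq_getElem_cons hlt]
          rfl
        · rw [List.take_of_length_le (by omega), List.take_of_length_le (by omega),
            List.drop_eq_nil_of_le (by omega)]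
          simp
      simp only [List.length_append, List.length_cons, List.length_nil, zero_add, this,
        Option.some.injEq]
      funext k
      simp only [update_apply]
      split_ifs <;> simp_all
  rw [blockPar, run_block_cons, h₁]
  simp only [Option.bind_some, run_block_cons, run_ifSome, update_self, flag_eq_nil, run_push]
  rw [← apply_ite some]
  simp only [Option.bind_some, run_block_cons]
  rw [run_clear (by
    split_ifs <;> simpa [hqZ] using (length_flag_le _).trans hB)]
  simp only [Option.bind_some, run_block_nil, Option.some.injEq]
  funext k
  cases h : parityL ((S A).take (S Q).length) <;> simp only [update_apply] <;>
    split_ifs <;> simp_all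

/-- One step of the multiplication modulo a polynomial: multiply by the indeterminate. -/
def shiftL (P : List Bool) : List Bool → List Bool
  | [] => []
  | c :: R => axpyL c P R

/-- Multiplication modulo the monic polynomial with lower coefficients `P`, the most significant
coefficient first. -/
def mulL (P u v : List Bool) : List Bool :=
  u.foldl (fun R b => axpyL b v (shiftL P R)) (List.replicate v.length false)

/-- Replace `R` by `mulL P u v`, with an auxiliary variable `T`. -/
def mul (P u v R T : V) : LoopProg V :=
  block [clear R, fill v R false, loop u fun b =>
    block [ite R skip (block [pop R, axpy false P R T]) (block [pop R, axpy true P R T]),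
      axpy b v R T]]

theorem length_mulL (P u v : List Bool) : (mulL P u v).length = v.length := by
  induction u using List.reverseRecOn with
  | nil => simp [mulL]
  | append_singleton u b _ => simp [mulL]

theorem length_shiftL_le (P R : List Bool) : (shiftL P R).length ≤ P.length := by
  cases R <;> simp [shiftL]

/-- Horner's rule over the bits of `u`: the bit popped from the accumulator `R` is its leading
coefficient and decides whether the lower coefficients `P` of the modulus are added back. -/
theorem run_mul {P u v R T : V} {S : V → List Bool} (hP : (S P).length ≤ B)
    (hu : (S u).length ≤ B) (hv : (S v).length ≤ B) (hR : (S R).length ≤ B) (hPR : P ≠ R)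
    (huR : u ≠ R) (hvR : v ≠ R) (hRT : R ≠ T) (hT : S T = []) :
    run B (mul P u v R T) S = some (update S R (mulL (S P) (S u) (S v))) := by
  have h₁ : run B (loop u fun b =>
      block [ite R skip (block [pop R, axpy false P R T]) (block [pop R, axpy true P R T]),
        axpy b v R T]) (update S R (List.replicate (S v).length false)) =
      some (update S R (mulL (S P) (S u) (S v))) := by
    refine run_loop_of_invariant (fun l => update S R (mulL (S P) l (S v))) (by simpa [huR])
      (by simp [mulL]) (by simp [huR]) ?_
    intro l b t hl
    have hlen : (mulL (S P) l (S v)).length ≤ B := by rwa [length_mulL]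
    have hshift : run B (ite R skip (block [pop R, axpy false P R T])
        (block [pop R, axpy true P R T])) (update S R (mulL (S P) l (S v))) =
          some (update S R (shiftL (S P) (mulL (S P) l (S v)))) := by
      rcases h : mulL (S P) l (S v) with _ | ⟨c, r⟩
      · rw [run_ite_nil (by simp)]
        rfl
      have hr : r.length ≤ B := by rw [h] at hlen; simp at hlen; omega
      cases c
      · rw [run_ite_false (update_self _ _ _), run_block_cons, run_pop, Option.bind_some,
          run_block_cons, run_axpy (by simpa [hPR]) (by simpa) hRT (by simpa [hRT.symm])]
        simp [shiftL, hPR]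
      · rw [run_ite_true (update_self _ _ _), run_block_cons, run_pop, Option.bind_some,
          run_block_cons, run_axpy (by simpa [hPR]) (by simpa) hRT (by simpa [hRT.symm])]
        simp [shiftL, hPR]
    rw [run_block_cons, hshift, Option.bind_some, run_block_cons,
      run_axpy (by simpa [hvR]) (by simpa using (length_shiftL_le _ _).trans hP) hRT
        (by simpa [hRT.symm])]
    simp [hvR, mulL]
  rw [mul, run_block_cons, run_clear hR, Option.bind_some, run_block_cons,
    run_fill (by simpa [hvR]), Option.bind_some, run_block_cons]
  simp [hvR, h₁]

/-- The inner product modulo two. -/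
def dotL : List Bool → List Bool → Bool
  | [], _ => false
  | b :: l, y => xor (b && y.headD false) (dotL l y.tail)

theorem dotL_append_singleton (l y : List Bool) (b : Bool) :
    dotL (l ++ [b]) y = xor (dotL l y) (b && (y.drop l.length).headD false) := by
  induction l generalizing y with
  | nil => simp [dotL]
  | cons a l ih => simp [dotL, ih]

/-- Add the inner product of `w` and `y` to the flag `q`, consuming `y`. -/
def dot (w y q : V) : LoopProg V := loop w fun b => if b then popXor y q else pop y

theorem run_dot {w y q : V} {S : V → List Bool} (hw : (S w).length ≤ B) (hyq : y ≠ q)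
    (hq : S q = []) :
    run B (dot w y q) S =
      some (update (update S y ((S y).drop (S w).length)) q (flag (dotL (S w) (S y)))) := by
  refine run_loop_of_invariant (fun l => update (update S y ((S y).drop l.length)) q
    (flag (dotL l (S y)))) hw ?_ rfl ?_
  · funext k
    simp only [update_apply]
    split_ifs <;> simp_all [dotL]
  · intro l b t hl
    cases b
    · simp only [run_pop, Bool.false_eq_true, if_false, Option.some.injEq, dotL_append_singleton]
      funext k
      simp only [update_apply]
      split_ifs <;> simp_all
    · simp only [if_true]
      rw [run_popXor hyq (update_self _ _ _)]
      simp only [Option.some.injEq, dotL_append_singleton]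
      funext k
      simp only [update_apply]
      split_ifs <;> simp_all

end LoopProg

/-! ### The program computing the hard function -/

namespace HardProgram

open LoopProg Function

/-- The variables of the program. -/
inductive Reg
  | inp | X | Aa | A | N | U | H | D | K | Q | Z | al | be | E | P | G | u | v | R | T | y | q | h | g | ok | C | out
  deriving DecidableEq

instance : Fintype Reg :=
  ⟨{.inp, .X, .Aa, .A, .N, .U, .H, .D, .K, .Q, .Z, .al, .be, .E,
    .P, .G, .u, .v, .R, .T, .y, .q, .h, .g, .ok, .C, .out}, by rintro ⟨⟩ <;> simp⟩

/-- The contents of the variables. -/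
structure Mem where
  inp : List Bool := []
  X : List Bool := []
  Aa : List Bool := []
  A : List Bool := []
  N : List Bool := []
  U : List Bool := []
  H : List Bool := []
  D : List Bool := []
  K : List Bool := []
  Q : List Bool := []
  Z : List Bool := []
  al : List Bool := []
  be : List Bool := []
  E : List Bool := []
  P : List Bool := []
  G : List Bool := []
  u : List Bool := []
  v : List Bool := []
  R : List Bool := []
  T : List Bool := []
  y : List Bool := []
  q : List Bool := []
  h : List Bool := []
  g : List Bool := []
  ok : List Bool := []
  C : List Bool := []
  out : List Bool := []

/-- The state of the program with the given contents of the variables. -/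
def Mem.toSt (m : Mem) : Reg → List Bool
  | .inp => m.inp
  | .X => m.X
  | .Aa => m.Aa
  | .A => m.A
  | .N => m.N
  | .U => m.U
  | .H => m.H
  | .D => m.D
  | .K => m.K
  | .Q => m.Q
  | .Z => m.Z
  | .al => m.al
  | .be => m.be
  | .E => m.E
  | .P => m.P
  | .G => m.G
  | .u => m.u
  | .v => m.v
  | .R => m.R
  | .T => m.T
  | .y => m.y
  | .q => m.q
  | .h => m.h
  | .g => m.g
  | .ok => m.ok
  | .C => m.C
  | .out => m.out

variable (m : Mem) (l : List Bool)

@[simp] theorem update_inp : update m.toSt .inp l = Mem.toSt { m with inp := l } := by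
  funext k; cases k <;> rfl
@[simp] theorem update_X : update m.toSt .X l = Mem.toSt { m with X := l } := by
  funext k; cases k <;> rfl
@[simp] theorem update_Aa : update m.toSt .Aa l = Mem.toSt { m with Aa := l } := by
  funext k; cases k <;> rfl
@[simp] theorem update_A : update m.toSt .A l = Mem.toSt { m with A := l } := by
  funext k; cases k <;> rfl
@[simp] theorem update_N : update m.toSt .N l = Mem.toSt { m with N := l } := by
  funext k; cases k <;> rfl
@[simp] theorem update_U : update m.toSt .U l = Mem.toSt { m with U := l } := by
  funext k; cases k <;> rfl
@[simp] theorem update_H : update m.toSt .H l = Mem.toSt { m with H := l } := by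
  funext k; cases k <;> rfl
@[simp] theorem update_D : update m.toSt .D l = Mem.toSt { m with D := l } := by
  funext k; cases k <;> rfl
@[simp] theorem update_K : update m.toSt .K l = Mem.toSt { m with K := l } := by
  funext k; cases k <;> rfl
@[simp] theorem update_Q : update m.toSt .Q l = Mem.toSt { m with Q := l } := by
  funext k; cases k <;> rfl
@[simp] theorem update_Z : update m.toSt .Z l = Mem.toSt { m with Z := l } := by
  funext k; cases k <;> rfl
@[simp] theorem update_al : update m.toSt .al l = Mem.toSt { m with al := l } := by
  funext k; cases k <;> rfl
@[simp] theorem update_be : update m.toSt .be l = Mem.toSt { m with be := l } := by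
  funext k; cases k <;> rfl
@[simp] theorem update_E : update m.toSt .E l = Mem.toSt { m with E := l } := by
  funext k; cases k <;> rfl
@[simp] theorem update_P : update m.toSt .P l = Mem.toSt { m with P := l } := by
  funext k; cases k <;> rfl
@[simp] theorem update_G : update m.toSt .G l = Mem.toSt { m with G := l } := by
  funext k; cases k <;> rfl
@[simp] theorem update_u : update m.toSt .u l = Mem.toSt { m with u := l } := by
  funext k; cases k <;> rfl
@[simp] theorem update_v : update m.toSt .v l = Mem.toSt { m with v := l } := by
  funext k; cases k <;> rfl
@[simp] theorem update_R : update m.toSt .R l = Mem.toSt { m with R := l } := by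
  funext k; cases k <;> rfl
@[simp] theorem update_T : update m.toSt .T l = Mem.toSt { m with T := l } := by
  funext k; cases k <;> rfl
@[simp] theorem update_y : update m.toSt .y l = Mem.toSt { m with y := l } := by
  funext k; cases k <;> rfl
@[simp] theorem update_q : update m.toSt .q l = Mem.toSt { m with q := l } := by
  funext k; cases k <;> rfl
@[simp] theorem update_h : update m.toSt .h l = Mem.toSt { m with h := l } := by
  funext k; cases k <;> rfl
@[simp] theorem update_g : update m.toSt .g l = Mem.toSt { m with g := l } := by
  funext k; cases k <;> rfl
@[simp] theorem update_ok : update m.toSt .ok l = Mem.toSt { m with ok := l } := by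
  funext k; cases k <;> rfl
@[simp] theorem update_C : update m.toSt .C l = Mem.toSt { m with C := l } := by
  funext k; cases k <;> rfl
@[simp] theorem update_out : update m.toSt .out l = Mem.toSt { m with out := l } := by
  funext k; cases k <;> rfl

end HardProgram

/-! ### Parsing the input: block length and block parities -/

namespace HardProgram
open LoopProg Function

/-- Read the input: its half length `n` in unary, the reversal of its first `n` bits, and the
remaining bits. -/
def readInput : LoopProg Reg :=
  block [half .inp .N .q, rcopy .N .C, split .inp .C .X .Aa, clear .inp, rmove .Aa .A]

/-- The first half stays reversed in `X`, because Horner's rule needs the coefficient of the highest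
power first. -/
theorem run_readInput {B : ℕ} (s : List Bool) (hB : 1 ≤ B) (hs : s.length ≤ B) :
    run B readInput (Mem.toSt { inp := s }) = some (Mem.toSt
      { X := (s.take (s.length / 2)).reverse, A := s.drop (s.length / 2)
        N := List.replicate (s.length / 2) true }) := by
  have h2 : s.length / 2 ≤ B := by omega
  rw [readInput, run_block_cons, run_half hB hs (by simp) rfl rfl, Option.bind_some, update_N,
    run_block_cons, run_rcopy (by simpa [Mem.toSt]), Option.bind_some, update_C,
    run_block_cons, run_split hs (by simpa [Mem.toSt]) (by simp) (by simp) (by simp) rfl rfl]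
  simp only [Option.bind_some, update_C, update_X, update_Aa, run_block_cons]
  rw [run_clear hs]
  simp only [Option.bind_some, update_inp, run_block_cons]
  rw [run_rmove (by simp [Mem.toSt]; omega) (by simp [Mem.toSt]) (by simp)]
  simp [Mem.toSt]

/-- Compute, in unary, `8 ⌈log₂ n⌉` and `16 ⌈log₂ n⌉`. -/
def computeLog : LoopProg Reg :=
  block [rcopy .N .U, pop .U,
    loop .N fun _ => ifSome .U (block [half .U .H .q, rmove .H .U,
      block (List.replicate 8 (push .D true))]) skip,
    rcopy .D .K, rcopy .D .K]

/-- The number of halvings that take `n - 1` to zero is `⌈log₂ n⌉`, since `(n - 1) / 2 ^ l = 0`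
means `n ≤ 2 ^ l`. Every halving pushes eight entries onto `D`; the loop over `N` is long enough
because `⌈log₂ n⌉ ≤ n`. -/
theorem run_computeLog {B : ℕ} (x a : List Bool) (n : ℕ) (hB : 1 ≤ B) (hn : n ≤ B)
    (hk : 8 * Nat.clog 2 n ≤ B) :
    run B computeLog (Mem.toSt { X := x, A := a, N := List.replicate n true }) = some (Mem.toSt
      { X := x, A := a, N := List.replicate n true
        D := List.replicate (8 * Nat.clog 2 n) true
        K := List.replicate (16 * Nat.clog 2 n) true }) := by
  have hlt : Nat.clog 2 n ≤ n := by
    rw [Nat.clog_le_iff_le_pow (by norm_num)]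
    exact Nat.lt_two_pow_self.le
  have hloop : run B (loop .N fun _ => ifSome .U (block [half .U .H .q, rmove .H .U,
      block (List.replicate 8 (push .D true))]) skip)
        (Mem.toSt { X := x, A := a, N := List.replicate n true, U := List.replicate (n - 1) true }) =
      some (Mem.toSt { X := x, A := a, N := List.replicate n true
                       D := List.replicate (8 * Nat.clog 2 n) true }) := by
    refine run_loop_of_invariant (fun l => Mem.toSt
      { X := x, A := a, N := List.replicate n true
        D := List.replicate (8 * min l.length (Nat.clog 2 n)) true
        U := List.replicate ((n - 1) / 2 ^ l.length) true }) (by simpa [Mem.toSt])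
      (by simp) ?_ ?_
    · have : (n - 1) / 2 ^ n = 0 := Nat.div_eq_of_lt (by have := Nat.lt_two_pow_self (n := n); omega)
      simp [Mem.toSt, this, min_eq_right hlt]
    · intro l b t hl
      have hpos : 0 < 2 ^ l.length := by positivity
      by_cases hi : Nat.clog 2 n ≤ l.length
      · have h0 : (n - 1) / 2 ^ l.length = 0 := by
          rw [Nat.clog_le_iff_le_pow (by norm_num)] at hi
          exact Nat.div_eq_of_lt (by omega)
        have h1 : (n - 1) / 2 ^ (l.length + 1) = 0 := by rw [pow_succ, ← Nat.div_div_eq_div_mul, h0]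
        rw [run_ifSome_of_nil (by simp [Mem.toSt, h0])]
        simp [h0, h1, min_eq_right hi, min_eq_right (hi.trans (Nat.le_succ _))]
      · have h0 : (n - 1) / 2 ^ l.length ≠ 0 := by
          rw [Nat.clog_le_iff_le_pow (by norm_num)] at hi
          exact (Nat.div_pos (by omega) hpos).ne'
        have hle : (n - 1) / 2 ^ l.length ≤ B := (Nat.div_le_self _ _).trans (by omega)
        rw [run_ifSome_of_ne (by simpa [Mem.toSt] using h0), run_block_cons,
          run_half hB (by simpa [Mem.toSt]) (by simp) rfl rfl, Option.bind_some, update_H,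
          run_block_cons, run_rmove (by simp [Mem.toSt]; omega) (by simpa [Mem.toSt]) (by simp)]
        have e₁ : 8 * (l.length + 1) = 8 * l.length + 1 + 1 + 1 + 1 + 1 + 1 + 1 + 1 := by ring
        have e₂ : (n - 1) / 2 ^ (l.length + 1) = (n - 1) / 2 ^ l.length / 2 := by
          rw [pow_succ, Nat.div_div_eq_div_mul]
        simp only [Mem.toSt, List.length_replicate, List.reverse_replicate, update_U, update_H,
          Option.bind_some, run_block_cons, run_block_nil, List.replicate_succ, run_push, update_D,
          List.replicate_zero, List.length_append, List.length_cons, List.length_nil, zero_add,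
          min_eq_left (not_le.1 hi).le, min_eq_left (Nat.succ_le_of_lt (not_le.1 hi)), e₁, e₂]
  rw [computeLog, run_block_cons, run_rcopy (by simpa [Mem.toSt])]
  simp only [Option.bind_some, run_block_cons, run_pop, update_U, Mem.toSt,
    List.reverse_replicate, List.append_nil, List.tail_replicate]
  rw [hloop]
  simp only [Option.bind_some, run_block_cons]
  rw [run_rcopy (by simpa [Mem.toSt])]
  simp only [Option.bind_some, run_block_cons, update_K]
  rw [run_rcopy (by simpa [Mem.toSt])]
  have e : 8 * Nat.clog 2 n + 8 * Nat.clog 2 n = 16 * Nat.clog 2 n := by ring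
  simp [Mem.toSt, e]

/-- The parities of the first `j` blocks of `b` bits. -/
def blockParities (b j : ℕ) (a : List Bool) : List Bool :=
  (List.range j).map fun i => parityL ((a.drop (b * i)).take b)

/-- Compute the two halves of the list of parities of the blocks. -/
def computeParities : LoopProg Reg :=
  block [rcopy .K .C,
    loop .N fun _ => ifSome .C (block [pop .C, ifSome .C skip (block [push .Q true, rcopy .K .C])])
      skip,
    clear .C, loop .K fun _ => blockPar .Q .A .q .Z, clear .A, rcopy .D .C, split .Z .C .al .be,
    clear .Z, clear .N, clear .K, clear .Q]

/-- The counter `C` runs down from `k` and is refilled when it is exhausted, so that `Q` gains an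
entry per completed cycle. For `k = 0` the counter is empty from the start and `Q` stays empty, in
agreement with `n / 0 = 0`. -/
theorem run_division {B : ℕ} (x a : List Bool) (n d k : ℕ) (hn : n ≤ B) (hk : k ≤ B) :
    run B (loop .N fun _ => ifSome .C (block [pop .C, ifSome .C skip
      (block [push .Q true, rcopy .K .C])]) skip)
        (Mem.toSt { X := x, A := a, N := List.replicate n true, D := List.replicate d true
                    K := List.replicate k true, C := List.replicate k true }) =
      some (Mem.toSt { X := x, A := a, N := List.replicate n true, D := List.replicate d true
                       K := List.replicate k true, C := List.replicate (k - n % k) true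
                       Q := List.replicate (n / k) true }) := by
  refine run_loop_of_invariant (fun l => Mem.toSt
    { X := x, A := a, N := List.replicate n true, D := List.replicate d true
      K := List.replicate k true, C := List.replicate (k - l.length % k) true
      Q := List.replicate (l.length / k) true }) (by simpa [Mem.toSt]) (by simp)
    (by simp [Mem.toSt]) ?_
  intro l b t hl
  rcases Nat.eq_zero_or_pos k with rfl | hpos
  · simp [run_ifSome, Mem.toSt]
  · have hlt := Nat.mod_lt l.length hpos
    obtain ⟨j, hj⟩ : ∃ j, k - l.length % k = j + 1 := ⟨k - l.length % k - 1, by omega⟩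
    have hdm := Nat.div_add_mod l.length k
    rw [hj, run_ifSome_of_ne (by simp [Mem.toSt]), run_block_cons, run_pop]
    simp only [Mem.toSt, List.replicate_succ, List.tail_cons, Option.bind_some, update_C,
      run_block_cons, List.length_append, List.length_cons, List.length_nil, zero_add]
    rcases Nat.eq_zero_or_pos j with rfl | hjp
    · have e : l.length + 1 = k * (l.length / k + 1) := by rw [mul_add]; omega
      have e₁ : (l.length + 1) % k = 0 := by rw [e, Nat.mul_mod_right]
      have e₂ : (l.length + 1) / k = l.length / k + 1 := by rw [e, Nat.mul_div_cancel_left _ hpos]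
      rw [run_ifSome_of_nil (by simp [Mem.toSt])]
      simp only [List.replicate_zero, run_block_cons, run_push, Option.bind_some, update_Q,
        Mem.toSt]
      rw [run_rcopy (by simpa [Mem.toSt])]
      simp [Mem.toSt, e₁, e₂, List.replicate_succ]
    · have e : l.length + 1 = l.length % k + 1 + k * (l.length / k) := by omega
      have e₁ : (l.length + 1) % k = l.length % k + 1 := by
        rw [e, Nat.add_mul_mod_self_left, Nat.mod_eq_of_lt (by omega)]
      have e₂ : (l.length + 1) / k = l.length / k := by
        rw [e, Nat.add_mul_div_left _ _ hpos, Nat.div_eq_of_lt (by omega), zero_add]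
      have e₃ : k - (l.length % k + 1) = j := by omega
      rw [run_ifSome_of_ne (by simpa [Mem.toSt] using hjp.ne')]
      simp [e₁, e₂, e₃]

theorem run_blockPars {B : ℕ} (x a : List Bool) (n d k b : ℕ) (hB : 1 ≤ B) (hb : b ≤ B)
    (hk : k ≤ B) :
    run B (loop .K fun _ => blockPar .Q .A .q .Z)
        (Mem.toSt { X := x, A := a, N := List.replicate n true, D := List.replicate d true
                    K := List.replicate k true, Q := List.replicate b true }) =
      some (Mem.toSt { X := x, A := a.drop (b * k), N := List.replicate n true
                       D := List.replicate d true, K := List.replicate k true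
                       Q := List.replicate b true, Z := (blockParities b k a).reverse }) := by
  refine run_loop_of_invariant (fun l => Mem.toSt
    { X := x, A := a.drop (b * l.length), N := List.replicate n true, D := List.replicate d true
      K := List.replicate k true, Q := List.replicate b true
      Z := (blockParities b l.length a).reverse }) (by simpa [Mem.toSt])
    (by simp [blockParities]) (by simp [Mem.toSt]) ?_
  intro l c t hl
  rw [run_blockPar hB (by simpa [Mem.toSt]) (by simp) (by simp) (by simp) rfl]
  simp [Mem.toSt, blockParities, List.range_succ, mul_add]

theorem run_computeParities {B : ℕ} (x a : List Bool) (n d : ℕ) (hB : 1 ≤ B) (hn : n ≤ B)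
    (hk : 2 * d ≤ B) (ha : a.length ≤ B) :
    run B computeParities (Mem.toSt { X := x, A := a, N := List.replicate n true
                                      D := List.replicate d true
                                      K := List.replicate (2 * d) true }) = some (Mem.toSt
      { X := x, D := List.replicate d true
        al := (blockParities (n / (2 * d)) (2 * d) a).drop d
        be := (blockParities (n / (2 * d)) (2 * d) a).take d }) := by
  have hb : n / (2 * d) ≤ B := (Nat.div_le_self _ _).trans hn
  generalize hkd : 2 * d = k at *
  generalize hp : blockParities (n / k) k a = p
  have hplen : p.length = k := by simp [← hp, blockParities]
  rw [computeParities, run_block_cons, run_rcopy (by simpa [Mem.toSt])]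
  simp only [Option.bind_some, run_block_cons, update_C, Mem.toSt,
    List.reverse_replicate, List.append_nil]
  rw [run_division _ _ _ _ _ hn hk]
  simp only [Option.bind_some, run_block_cons]
  rw [run_clear (by simp [Mem.toSt]; omega)]
  simp only [Option.bind_some, run_block_cons, update_C]
  rw [run_blockPars _ _ _ _ _ _ hB hb hk]
  simp only [Option.bind_some, run_block_cons]
  rw [run_clear (by simp [Mem.toSt]; omega)]
  simp only [Option.bind_some, run_block_cons, update_A]
  rw [run_rcopy (by simp [Mem.toSt]; omega)]
  simp only [Option.bind_some, run_block_cons, update_C]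
  -- The parities lie on `Z` in reverse order, so the first `d` entries taken off are the last `d`
  -- parities; they go to `al`, and pushing them restores their order.
  rw [run_split (by simpa [Mem.toSt, hp, hplen]) (by simp [Mem.toSt]; omega) (by simp) (by simp)
    (by simp) rfl rfl]
  simp only [Option.bind_some, run_block_cons, update_C, update_al, update_be]
  rw [run_clear (by simpa [Mem.toSt, hp, hplen])]
  simp only [Option.bind_some, run_block_cons, update_Z]
  rw [run_clear (by simpa [Mem.toSt])]
  simp only [Option.bind_some, run_block_cons, update_N]
  rw [run_clear (by simpa [Mem.toSt])]
  simp only [Option.bind_some, run_block_cons, update_K]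
  rw [run_clear (by simpa [Mem.toSt])]
  have e : k - d = d := by omega
  simp [Mem.toSt, List.take_reverse, List.drop_reverse, hp, hplen, e]

end HardProgram

/-! ### Exhaustive search for a modulus without zero divisors -/

namespace HardProgram

open LoopProg Function

/-- `u` and `v` are nonzero with product zero modulo the polynomial given by `P`. -/
def zeroProduct (P u v : List Bool) : Bool := !(mulL P u v).any id && (u.any id && v.any id)

/-- Clear the flag `ok` if `u` and `v` are nonzero with product zero modulo `P`. -/
def testProduct : LoopProg Reg :=
  block [mul .P .u .v .R .T, nonzero .R .q,
    ifSome .q skip (block [nonzero .u .h,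
      ifSome .h (block [nonzero .v .g, ifSome .g (clear .ok) skip, clear .g]) skip, clear .h]),
    clear .q, clear .R]

section

variable {B d N : ℕ} (x al be G : List Bool)

theorem run_testProduct (P u v : List Bool) (b : Bool) (hB : 1 ≤ B) (hP : P.length ≤ B)
    (hu : u.length ≤ B) (hv : v.length ≤ B) :
    run B testProduct (Mem.toSt
      { X := x, D := List.replicate d true, al := al, be := be, E := List.replicate N true
        P := P, G := G, u := u, v := v, ok := flag b }) = some (Mem.toSt
      { X := x, D := List.replicate d true, al := al, be := be, E := List.replicate N true
        P := P, G := G, u := u, v := v, ok := flag (b && !zeroProduct P u v) }) := by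
  have hlen : (mulL P u v).length ≤ B := by rwa [length_mulL]
  have hfl : ∀ b, (flag b).length ≤ B := fun b => (length_flag_le b).trans hB
  rw [testProduct, run_block_cons, run_mul (by exact hP) (by exact hu) (by exact hv) (by simp [Mem.toSt]) (by simp) (by simp)
    (by simp) (by simp) rfl]
  simp only [Option.bind_some, run_block_cons, update_R]
  rw [run_nonzero (by exact hlen) rfl]
  simp only [Option.bind_some, run_block_cons, update_q, Mem.toSt]
  cases hR : (mulL P u v).any id
  · rw [run_ifSome_of_nil rfl]
    simp only [run_block_cons]
    rw [run_nonzero (by exact hu) rfl]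
    simp only [Option.bind_some, run_block_cons, update_h, Mem.toSt]
    cases hu' : u.any id
    · rw [run_ifSome_of_nil rfl, run_skip]
      simp only [Option.bind_some, run_block_cons]
      rw [run_clear (by exact hfl false)]
      simp only [Option.bind_some, run_block_cons, run_block_nil, update_h]
      rw [run_clear (by exact hfl false)]
      simp only [Option.bind_some, run_block_cons, update_q]
      rw [run_clear (by exact hlen)]
      simp [zeroProduct, hu']
    · rw [run_ifSome_of_ne (by simp [Mem.toSt])]
      simp only [run_block_cons]
      rw [run_nonzero (by exact hv) rfl]
      simp only [Option.bind_some, run_block_cons, update_g, Mem.toSt]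
      cases hv' : v.any id
      · rw [run_ifSome_of_nil rfl, run_skip]
        simp only [Option.bind_some, run_block_cons]
        rw [run_clear (by exact hfl false)]
        simp only [Option.bind_some, run_block_cons, run_block_nil, update_g]
        rw [run_clear (by exact hfl true)]
        simp only [Option.bind_some, run_block_cons, run_block_nil, update_h]
        rw [run_clear (by exact hfl false)]
        simp only [Option.bind_some, run_block_cons, update_q]
        rw [run_clear (by exact hlen)]
        simp [zeroProduct, hv']
      · rw [run_ifSome_of_ne (by simp [Mem.toSt]), run_clear (by exact hfl b)]
        simp only [Option.bind_some, run_block_cons, update_ok]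
        rw [run_clear (by exact hfl true)]
        simp only [Option.bind_some, run_block_cons, run_block_nil, update_g]
        rw [run_clear (by exact hfl true)]
        simp only [Option.bind_some, run_block_cons, run_block_nil, update_h]
        rw [run_clear (by exact hfl false)]
        simp only [Option.bind_some, run_block_cons, update_q]
        rw [run_clear (by exact hlen)]
        simp [zeroProduct, hv', hu', hR]
  · rw [run_ifSome_of_ne (by simp [Mem.toSt]), run_skip]
    simp only [Option.bind_some, run_block_cons]
    rw [run_clear (by exact hfl true)]
    simp only [Option.bind_some, run_block_cons, update_q]
    rw [run_clear (by exact hlen)]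
    simp [zeroProduct, hR]

/-- No vector among the first `N` successors of `v` has product zero with `u`. -/
def allNonzero (N : ℕ) (P v u : List Bool) : Bool :=
  (List.range N).all fun j => !zeroProduct P u (inc^[j + 1] v)

/-- No vectors among the first `N` successors of `u` and of `v` have product zero. -/
def isGood (N : ℕ) (P u v : List Bool) : Bool :=
  (List.range N).all fun i => allNonzero N P (inc^[N * i] v) (inc^[i + 1] u)

@[simp] theorem length_inc_iterate (j : ℕ) (l : List Bool) :
    (inc^[j] l).length = l.length := by
  induction j with
  | zero => rfl
  | succ j ih => rw [iterate_succ_apply', length_inc, ih]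

theorem run_testRow (P u v : List Bool) (b : Bool) (hB : 1 ≤ B) (hP : P.length ≤ B)
    (hu : u.length ≤ B) (hv : v.length ≤ B) (hN : N ≤ B) :
    run B (loop .E fun _ => block [incr .v .T .q, testProduct]) (Mem.toSt
      { X := x, D := List.replicate d true, al := al, be := be, E := List.replicate N true
        P := P, G := G, u := u, v := v, ok := flag b }) = some (Mem.toSt
      { X := x, D := List.replicate d true, al := al, be := be, E := List.replicate N true
        P := P, G := G, u := u, v := inc^[N] v, ok := flag (b && allNonzero N P v u) }) := by
  refine run_loop_of_invariant (fun l => Mem.toSt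
    { X := x, D := List.replicate d true, al := al, be := be, E := List.replicate N true
      P := P, G := G, u := u, v := inc^[l.length] v
      ok := flag (b && allNonzero l.length P v u) }) (by simpa [Mem.toSt])
    (by simp [allNonzero]) (by simp [Mem.toSt]) ?_
  intro l c t hl
  rw [run_block_cons, run_incr hB (by simpa [Mem.toSt]) (by simp) (by simp) (by simp) rfl rfl]
  simp only [Option.bind_some, run_block_cons, update_v, Mem.toSt]
  rw [run_testProduct _ _ _ _ _ _ _ _ hB hP hu (by simpa)]
  simp [allNonzero, List.range_succ, iterate_succ_apply', Bool.and_assoc]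

/-- The counter `v` is not reset between rows, whence the total of `N * N` increments. In the
application `N = 2 ^ d` is the period of the counter, so every row starts from the same `v`. -/
theorem run_testAll (P u v : List Bool) (b : Bool) (hB : 1 ≤ B) (hP : P.length ≤ B)
    (hu : u.length ≤ B) (hv : v.length ≤ B) (hN : N ≤ B) :
    run B (loop .E fun _ => block [incr .u .T .q,
      loop .E fun _ => block [incr .v .T .q, testProduct]]) (Mem.toSt
      { X := x, D := List.replicate d true, al := al, be := be, E := List.replicate N true
        P := P, G := G, u := u, v := v, ok := flag b }) = some (Mem.toSt
      { X := x, D := List.replicate d true, al := al, be := be, E := List.replicate N true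
        P := P, G := G, u := inc^[N] u, v := inc^[N * N] v
        ok := flag (b && isGood N P u v) }) := by
  refine run_loop_of_invariant (fun l => Mem.toSt
    { X := x, D := List.replicate d true, al := al, be := be, E := List.replicate N true
      P := P, G := G, u := inc^[l.length] u, v := inc^[N * l.length] v
      ok := flag (b && (List.range l.length).all fun i => allNonzero N P (inc^[N * i] v)
        (inc^[i + 1] u)) }) (by simpa [Mem.toSt])
    (by simp) (by simp [Mem.toSt, isGood]) ?_
  intro l c t hl
  rw [run_block_cons, run_incr hB (by simpa [Mem.toSt]) (by simp) (by simp) (by simp) rfl rfl]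
  simp only [Option.bind_some, run_block_cons, update_u, Mem.toSt]
  rw [run_testRow _ _ _ _ _ _ _ _ hB hP (by simpa) (by simpa) hN]
  simp [List.range_succ, iterate_succ_apply', Bool.and_assoc, mul_add, ← iterate_add_apply,
    add_comm]

/-- Search step: go to the next polynomial, and save it if it has no zero products. -/
def searchStep : LoopProg Reg :=
  block [incr .P .T .q, push .ok true,
    loop .E fun _ => block [incr .u .T .q, loop .E fun _ => block [incr .v .T .q, testProduct]],
    ifSome .ok (block [rcopy .P .T, rmove .T .G]) skip, clear .ok]

/-- One step of the search, on the current polynomial and the saved polynomial. -/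
def searchNext (d : ℕ) (p : List Bool × List Bool) : List Bool × List Bool :=
  (inc p.1, if isGood (2 ^ d) (inc p.1) (List.replicate d false) (List.replicate d false)
    then inc p.1 else p.2)

/-- The last polynomial of degree `d`, in the order of the search, without zero products. -/
def search (d : ℕ) : List Bool :=
  ((searchNext d)^[2 ^ d] (List.replicate d false, List.replicate d false)).2

end

/-- The value of a binary number, the least significant bit first. -/
def val : List Bool → ℕ
  | [] => 0
  | b :: l => b.toNat + 2 * val l

theorem val_lt (l : List Bool) : val l < 2 ^ l.length := by
  induction l with
  | nil => simp [val]
  | cons b l ih => cases b <;> simp [val, pow_succ] <;> omega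

theorem val_injective {l l' : List Bool} (h : l.length = l'.length) (hv : val l = val l') :
    l = l' := by
  induction l generalizing l' with
  | nil => simp_all [eq_comm]
  | cons b l ih =>
    obtain _ | ⟨b', l'⟩ := l'
    · simp at h
    · cases b <;> cases b' <;> simp [val] at hv h ⊢ <;> first | omega | exact ih h (by omega)

theorem val_inc (l : List Bool) : val (inc l) = (val l + 1) % 2 ^ l.length := by
  induction l with
  | nil => rfl
  | cons b l ih =>
    have h1 := val_lt l
    cases b
    · rw [Nat.mod_eq_of_lt]
      · simp [inc, val]; omega
      · simp [val, pow_succ]; omega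
    · have e : val (true :: l) + 1 = 2 * (val l + 1) := by simp [val]; ring
      rw [e, List.length_cons, pow_succ', Nat.mul_mod_mul_left, ← ih]
      simp [inc, val]

theorem val_inc_iterate (j : ℕ) (l : List Bool) :
    val (inc^[j] l) = (val l + j) % 2 ^ l.length := by
  induction j with
  | zero => simp [Nat.mod_eq_of_lt (val_lt l)]
  | succ j ih =>
    rw [iterate_succ_apply', val_inc, ih, length_inc_iterate, Nat.mod_add_mod, add_assoc]

theorem inc_iterate_two_pow_mul (j : ℕ) (l : List Bool) : inc^[2 ^ l.length * j] l = l := by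
  refine val_injective (by simp) ?_
  rw [val_inc_iterate, Nat.add_mul_mod_self_left, Nat.mod_eq_of_lt (val_lt l)]

/-- Incrementing is addition of one modulo `2 ^ l.length`, hence a single cycle through all strings
of this length. The exponent is `j + 1` because the loops increment before they test. -/
theorem exists_inc_iterate {l w : List Bool} (h : w.length = l.length) :
    ∃ j < 2 ^ l.length, inc^[j + 1] l = w := by
  have hl := val_lt l
  have hw := val_lt w
  rw [h] at hw
  rcases lt_or_ge (val l) (val w) with hlt | hge
  · refine ⟨val w - val l - 1, by omega, val_injective (by simp [h]) ?_⟩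
    rw [val_inc_iterate, Nat.mod_eq_of_lt (by omega)]
    omega
  · refine ⟨2 ^ l.length + val w - val l - 1, by omega, val_injective (by simp [h]) ?_⟩
    rw [val_inc_iterate, show val l + (2 ^ l.length + val w - val l - 1 + 1) =
      val w + 2 ^ l.length * 1 by omega, Nat.add_mul_mod_self_left, Nat.mod_eq_of_lt hw]

/-- Both counters pass through all strings of length `d`, and the offsets `2 ^ d * i` of `v` are
full periods. -/
theorem isGood_iff (d : ℕ) (P u v : List Bool) (hu : u.length = d) (hv : v.length = d) :
    isGood (2 ^ d) P u v = true ↔ ∀ u' v' : List Bool, u'.length = d → v'.length = d →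
      zeroProduct P u' v' = false := by
  simp only [isGood, allNonzero, List.all_eq_true, List.mem_range, Bool.not_eq_true']
  constructor
  · intro h u' v' hu' hv'
    obtain ⟨i, hi, rfl⟩ := exists_inc_iterate (hu'.trans hu.symm)
    obtain ⟨j, hj, rfl⟩ := exists_inc_iterate (hv'.trans hv.symm)
    have := h i (by rwa [← hu]) j (by rwa [← hv])
    rwa [← hv, inc_iterate_two_pow_mul] at this
  · intro h i hi j hj
    exact h _ _ (by simpa) (by simpa)

theorem length_search (d : ℕ) : (search d).length = d := by
  have : ∀ j, ((searchNext d)^[j] (List.replicate d false, List.replicate d false)).1.length = d ∧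
      ((searchNext d)^[j] (List.replicate d false, List.replicate d false)).2.length = d := by
    intro j
    induction j with
    | zero => simp
    | succ j ih =>
      rw [iterate_succ_apply']
      simp only [searchNext, length_inc]
      split_ifs <;> simp [ih]
  exact (this _).2

/-- The saved polynomial is only ever replaced by one that passes the test, and the search visits
`P` at some stage; from then on the saved polynomial passes. -/
theorem search_spec {d : ℕ} {P : List Bool} (hP : P.length = d)
    (h : isGood (2 ^ d) P (List.replicate d false) (List.replicate d false) = true) :
    isGood (2 ^ d) (search d) (List.replicate d false) (List.replicate d false) = true := by
  have hfst : ∀ j, ((searchNext d)^[j] (List.replicate d false, List.replicate d false)).1 =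
      inc^[j] (List.replicate d false) := by
    intro j
    induction j with
    | zero => rfl
    | succ j ih => rw [iterate_succ_apply', iterate_succ_apply', searchNext, ih]
  obtain ⟨i, hi, hiP⟩ := exists_inc_iterate (l := List.replicate d false) (w := P) (by simpa)
  rw [List.length_replicate] at hi
  have : ∀ j, i < j → isGood (2 ^ d) ((searchNext d)^[j] (List.replicate d false,
      List.replicate d false)).2 (List.replicate d false) (List.replicate d false) = true := by
    intro j hj
    induction j with
    | zero => omega
    | succ j ih =>
      rw [iterate_succ_apply']
      simp only [searchNext, hfst]
      split_ifs with hg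
      · exact hg
      · rcases Nat.lt_succ_iff_lt_or_eq.1 hj with hlt | rfl
        · exact ih hlt
        · rw [← iterate_succ_apply' inc, hiP] at hg
          exact absurd h hg
  exact this _ hi

end HardProgram

/-! ### The search loop, the evaluation and the total running time -/

namespace HardProgram

open LoopProg Function

theorem run_searchStep {B d : ℕ} (x al be P G : List Bool) (hP : P.length = d) (hG : G.length = d)
    (hd : d ≤ B) (hB : 2 ^ d ≤ B) :
    run B searchStep (Mem.toSt
      { X := x, D := List.replicate d true, al := al, be := be, E := List.replicate (2 ^ d) true
        P := P, G := G, u := List.replicate d false, v := List.replicate d false }) =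
      some (Mem.toSt
      { X := x, D := List.replicate d true, al := al, be := be, E := List.replicate (2 ^ d) true
        P := (searchNext d (P, G)).1, G := (searchNext d (P, G)).2
        u := List.replicate d false, v := List.replicate d false }) := by
  have h1 : 1 ≤ B := Nat.one_le_two_pow.trans hB
  -- After a full scan both counters are back at zero, which makes the step an invariant of the
  -- search loop.
  have hz : ∀ j, inc^[2 ^ d * j] (List.replicate d false) = List.replicate d false := by
    intro j
    simpa using inc_iterate_two_pow_mul j (List.replicate d false)
  have hz1 : inc^[2 ^ d] (List.replicate d false) = List.replicate d false := by
    simpa using hz 1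
  rw [searchStep, run_block_cons, run_incr h1 (by simpa [Mem.toSt, hP]) (by simp) (by simp)
    (by simp) rfl rfl]
  simp only [Option.bind_some, run_block_cons, run_push, update_P, update_ok, Mem.toSt]
  rw [show ([true] : List Bool) = flag true from rfl,
    run_testAll _ _ _ _ _ _ _ _ h1 (by simpa [hP]) (by simpa) (by simpa) hB, hz, hz1]
  simp only [Option.bind_some, run_block_cons, Bool.true_and]
  cases hg : isGood (2 ^ d) (inc P) (List.replicate d false) (List.replicate d false)
  · rw [run_ifSome_of_nil rfl]
    simp only [Option.bind_some, run_block_cons, run_skip]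
    rw [run_clear (by simp [Mem.toSt])]
    simp [searchNext, hg]
  · rw [run_ifSome_of_ne (by simp [Mem.toSt])]
    simp only [run_block_cons]
    rw [run_rcopy (by simpa [Mem.toSt, hP])]
    simp only [Option.bind_some, run_block_cons, update_T]
    rw [run_rmove (by simpa [Mem.toSt, hP]) (by simpa [Mem.toSt, hG]) (by simp)]
    simp only [Option.bind_some, run_block_cons, run_block_nil, update_T, update_G]
    rw [run_clear (by simpa [Mem.toSt])]
    simp [searchNext, hg, Mem.toSt]

/-- Find a polynomial of degree `d` without zero products. -/
def findPoly : LoopProg Reg :=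
  block [push .E true, loop .D fun _ => rcopy .E .E, fill .D .P false, fill .D .G false,
    fill .D .u false, fill .D .v false, loop .E fun _ => searchStep, clear .P, clear .u, clear .v,
    clear .E]

theorem run_findPoly {B d : ℕ} (x al be : List Bool) (hd : d ≤ B) (hB : 2 ^ d ≤ B) :
    run B findPoly (Mem.toSt { X := x, D := List.replicate d true, al := al, be := be }) =
      some (Mem.toSt { X := x, D := List.replicate d true, al := al, be := be, G := search d }) := by
  have hlen : ∀ j, ((searchNext d)^[j] (List.replicate d false, List.replicate d false)).1.length =
      d ∧ ((searchNext d)^[j] (List.replicate d false, List.replicate d false)).2.length = d := by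
    intro j
    induction j with
    | zero => simp
    | succ j ih =>
      rw [iterate_succ_apply']
      simp only [searchNext, length_inc]
      split_ifs <;> simp [ih]
  -- Copying `E` onto itself doubles its length, because the loop ranges over the initial content;
  -- `d` rounds give the unary bound `2 ^ d`.
  have hdouble : run B (loop .D fun _ => rcopy .E .E) (Mem.toSt
      { X := x, D := List.replicate d true, al := al, be := be, E := [true] }) = some (Mem.toSt
      { X := x, D := List.replicate d true, al := al, be := be
        E := List.replicate (2 ^ d) true }) := by
    refine run_loop_of_invariant (fun l => Mem.toSt
      { X := x, D := List.replicate d true, al := al, be := be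
        E := List.replicate (2 ^ l.length) true }) (by simpa [Mem.toSt])
      (by simp) (by simp [Mem.toSt]) ?_
    intro l b t hl
    have hle : l.length ≤ d := by
      have := congrArg List.length hl
      simp [Mem.toSt] at this
      omega
    rw [run_rcopy (by simpa [Mem.toSt] using (Nat.pow_le_pow_right two_pos hle).trans hB)]
    simp [Mem.toSt, pow_succ, mul_two]
  have hsearch : run B (loop .E fun _ => searchStep) (Mem.toSt
      { X := x, D := List.replicate d true, al := al, be := be, E := List.replicate (2 ^ d) true
        P := List.replicate d false, G := List.replicate d false
        u := List.replicate d false, v := List.replicate d false }) = some (Mem.toSt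
      { X := x, D := List.replicate d true, al := al, be := be, E := List.replicate (2 ^ d) true
        P := ((searchNext d)^[2 ^ d] (List.replicate d false, List.replicate d false)).1
        G := search d, u := List.replicate d false, v := List.replicate d false }) := by
    refine run_loop_of_invariant (fun l => Mem.toSt
      { X := x, D := List.replicate d true, al := al, be := be, E := List.replicate (2 ^ d) true
        P := ((searchNext d)^[l.length] (List.replicate d false, List.replicate d false)).1
        G := ((searchNext d)^[l.length] (List.replicate d false, List.replicate d false)).2
        u := List.replicate d false, v := List.replicate d false }) (by simpa [Mem.toSt])
      (by simp) (by simp [Mem.toSt, search]) ?_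
    intro l b t hl
    rw [run_searchStep _ _ _ _ _ (hlen _).1 (hlen _).2 hd hB]
    simp [iterate_succ_apply']
  rw [findPoly, run_block_cons, run_push]
  simp only [Option.bind_some, run_block_cons, update_E, Mem.toSt]
  rw [hdouble]
  simp only [Option.bind_some, run_block_cons]
  rw [run_fill (by simpa [Mem.toSt])]
  simp only [Option.bind_some, run_block_cons, update_P]
  rw [run_fill (by simpa [Mem.toSt])]
  simp only [Option.bind_some, run_block_cons, update_G]
  rw [run_fill (by simpa [Mem.toSt])]
  simp only [Option.bind_some, run_block_cons, update_u]
  rw [run_fill (by simpa [Mem.toSt])]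
  simp only [Option.bind_some, run_block_cons, update_v, Mem.toSt, List.length_replicate, List.append_nil]
  rw [hsearch]
  simp only [Option.bind_some, run_block_cons]
  rw [run_clear (by simpa [Mem.toSt, hlen])]
  simp only [Option.bind_some, run_block_cons, update_P]
  rw [run_clear (by simpa [Mem.toSt])]
  simp only [Option.bind_some, run_block_cons, update_u]
  rw [run_clear (by simpa [Mem.toSt])]
  simp only [Option.bind_some, run_block_cons, update_v]
  rw [run_clear (by simpa [Mem.toSt])]
  simp

/-- Horner's rule: the sum of `dd * al ^ j`, over the `j` with a one at position `j` of `l`, where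
the last entry has position `0`. -/
def hornerL (P al dd l : List Bool) : List Bool :=
  l.foldl (fun y b => axpyL b dd (mulL P y al)) (List.replicate dd.length false)

theorem length_hornerL (P al dd l : List Bool) : (hornerL P al dd l).length = dd.length := by
  induction l using List.reverseRecOn with
  | nil => simp [hornerL]
  | append_singleton l b _ => simp [hornerL]

/-- Evaluate a polynomial by Horner's rule and output an inner product. -/
def evaluate : LoopProg Reg :=
  block [fill .D .y false, loop .X fun b => block [mul .G .y .al .R .T, rcopy .R .T, rmove .T .y,
    clear .R, axpy b .D .y .T],
    dot .be .y .q, ifSome .q (push .out true) (push .out false), clear .q, clear .y, clear .al,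
    clear .be, clear .G, clear .X, clear .D]

theorem run_evaluate {B d : ℕ} (x al be G : List Bool) (h1 : 1 ≤ B) (hd : d ≤ B)
    (hx : x.length ≤ B) (hal : al.length ≤ B) (hbe : be.length ≤ B) (hG : G.length ≤ B) :
    run B evaluate (Mem.toSt { X := x, D := List.replicate d true, al := al, be := be, G := G }) =
      some (Mem.toSt { out := [dotL be (hornerL G al (List.replicate d true) x)] }) := by
  have hy : ∀ l, (hornerL G al (List.replicate d true) l).length ≤ B := by
    simpa [length_hornerL]
  have hloop : run B (loop .X fun b => block [mul .G .y .al .R .T, rcopy .R .T, rmove .T .y,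
      clear .R, axpy b .D .y .T]) (Mem.toSt
      { X := x, D := List.replicate d true, al := al, be := be, G := G
        y := List.replicate d false }) = some (Mem.toSt
      { X := x, D := List.replicate d true, al := al, be := be, G := G
        y := hornerL G al (List.replicate d true) x }) := by
    refine run_loop_of_invariant (fun l => Mem.toSt
      { X := x, D := List.replicate d true, al := al, be := be, G := G
        y := hornerL G al (List.replicate d true) l }) (by simpa [Mem.toSt])
      (by simp [hornerL]) (by simp [Mem.toSt]) ?_
    intro l b t hl
    have hm : (mulL G (hornerL G al (List.replicate d true) l) al).length ≤ B := by
      rwa [length_mulL]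
    rw [run_block_cons, run_mul (by exact hG) (by exact hy l) (by exact hal) (by simp [Mem.toSt])
      (by simp) (by simp) (by simp) (by simp) rfl]
    simp only [Option.bind_some, run_block_cons, update_R, Mem.toSt]
    rw [run_rcopy (by exact hm)]
    simp only [Option.bind_some, run_block_cons, update_T, Mem.toSt, List.append_nil]
    rw [run_rmove (by simpa [Mem.toSt]) (by exact hy l) (by simp)]
    simp only [Option.bind_some, run_block_cons, update_T, update_y, Mem.toSt, List.reverse_reverse]
    rw [run_clear (by exact hm)]
    simp only [Option.bind_some, run_block_cons, update_R]
    rw [run_axpy (by simpa [Mem.toSt]) (by exact hm) (by simp) rfl]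
    simp [hornerL, Mem.toSt]
  rw [evaluate, run_block_cons, run_fill (by simpa [Mem.toSt])]
  simp only [Option.bind_some, run_block_cons, update_y, Mem.toSt, List.length_replicate,
    List.append_nil]
  rw [hloop]
  simp only [Option.bind_some, run_block_cons]
  rw [run_dot (by exact hbe) (by simp) rfl]
  simp only [Option.bind_some, run_block_cons, update_y, update_q, Mem.toSt]
  generalize hY : List.drop be.length (hornerL G al (List.replicate d true) x) = Y
  have hYB : Y.length ≤ B := by
    rw [← hY, List.length_drop]
    exact (Nat.sub_le _ _).trans (hy x)
  generalize hb : dotL be (hornerL G al (List.replicate d true) x) = b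
  have hout : run B (ifSome .q (push .out true) (push .out false)) (Mem.toSt
      { X := x, D := List.replicate d true, al := al, be := be, G := G, y := Y, q := flag b }) =
        some (Mem.toSt { X := x, D := List.replicate d true, al := al, be := be, G := G, y := Y
                         q := flag b, out := [b] }) := by
    rw [run_ifSome]
    cases b <;> simp [Mem.toSt]
  rw [hout]
  -- All working variables are emptied, since `polyTime_of_run` asks for a final memory whose only
  -- content is the output.
  simp only [Option.bind_some, run_block_cons]
  rw [run_clear (by exact (length_flag_le b).trans h1)]
  simp only [Option.bind_some, run_block_cons, update_q]
  rw [run_clear (by exact hYB)]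
  simp only [Option.bind_some, run_block_cons, update_y]
  rw [run_clear (by exact hal)]
  simp only [Option.bind_some, run_block_cons, update_al]
  rw [run_clear (by exact hbe)]
  simp only [Option.bind_some, run_block_cons, update_be]
  rw [run_clear (by exact hG)]
  simp only [Option.bind_some, run_block_cons, update_G]
  rw [run_clear (by exact hx)]
  simp only [Option.bind_some, run_block_cons, update_X]
  rw [run_clear (by simpa [Mem.toSt])]
  simp

/-- The program computing the hard function. -/
def program : LoopProg Reg := block [readInput, computeLog, computeParities, findPoly, evaluate]

/-- The output bit, from the bits `x` and the parities `p`. -/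
def outputBit (d : ℕ) (x p : List Bool) : Bool :=
  dotL (p.take d) (hornerL (search d) (p.drop d) (List.replicate d true) x.reverse)

/-- The function computed by the program. -/
def output (s : List Bool) : Bool :=
  let n := s.length / 2
  let d := 8 * Nat.clog 2 n
  outputBit d (s.take n) (blockParities (n / (2 * d)) (2 * d) (s.drop n))

/-- This makes the exhaustive search affordable: for `d = 8 ⌈log₂ n⌉` the number `2 ^ d` is at most
`(2 n + 1) ^ 8`. The summand `1` is needed for `n = 0`. -/
theorem two_pow_clog_le (n : ℕ) : 2 ^ Nat.clog 2 n ≤ 2 * n + 1 := by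
  rcases Nat.lt_or_ge 1 n with h | h
  · have h1 := Nat.pow_pred_clog_lt_self (b := 2) (by norm_num) h
    have h2 : 0 < Nat.clog 2 n := Nat.clog_pos (by norm_num) h
    obtain ⟨j, hj⟩ : ∃ j, Nat.clog 2 n = j + 1 := ⟨Nat.clog 2 n - 1, by omega⟩
    rw [hj] at h1 ⊢
    rw [pow_succ]
    simp at h1
    omega
  · have : Nat.clog 2 n = 0 := Nat.clog_of_right_le_one h 2
    simp [this]

theorem polyTime_output : PolyTime output := by
  -- The longest loops have `2 ^ d ≤ (s.length + 1) ^ 8` iterations; the factor `16` covers the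
  -- unary list of length `16 ⌈log₂ n⌉`.
  refine polyTime_of_run Reg.inp Reg.out program (16 * (Polynomial.X + 1) ^ 8) output fun s => ?_
  have hempty : (fun _ => [] : Reg → List Bool) = Mem.toSt {} := by funext k; cases k <;> rfl
  simp only [hempty, update_inp, update_out, Polynomial.eval_mul, Polynomial.eval_pow,
    Polynomial.eval_add, Polynomial.eval_X, Polynomial.eval_one, Polynomial.eval_ofNat]
  set B := 16 * (s.length + 1) ^ 8 with hB
  set n := s.length / 2 with hn
  have hpow : s.length + 1 ≤ (s.length + 1) ^ 8 := Nat.le_self_pow (by norm_num) _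
  have hclog : Nat.clog 2 n ≤ n := by
    rw [Nat.clog_le_iff_le_pow (by norm_num)]
    exact Nat.lt_two_pow_self.le
  have h1 : 1 ≤ B := by omega
  have hd : 2 * (8 * Nat.clog 2 n) ≤ B := by omega
  have h2d : 2 ^ (8 * Nat.clog 2 n) ≤ B := by
    rw [mul_comm, pow_mul]
    calc (2 ^ Nat.clog 2 n) ^ 8 ≤ (s.length + 1) ^ 8 :=
          Nat.pow_le_pow_left ((two_pow_clog_le n).trans (by omega)) _
      _ ≤ B := by omega
  have hparLen : ∀ b k a, (blockParities b k a).length = k := by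
    intro b k a; simp [blockParities]
  rw [program, run_block_cons, run_readInput s h1 (by omega)]
  simp only [Option.bind_some, run_block_cons, ← hn]
  rw [run_computeLog _ _ _ h1 (by omega) (by omega)]
  simp only [Option.bind_some, run_block_cons]
  rw [show 16 * Nat.clog 2 n = 2 * (8 * Nat.clog 2 n) by ring,
    run_computeParities _ _ _ _ h1 (by omega) hd (by rw [List.length_drop]; omega)]
  simp only [Option.bind_some, run_block_cons]
  rw [run_findPoly _ _ _ (by omega) h2d]
  simp only [Option.bind_some, run_block_cons]
  rw [run_evaluate _ _ _ _ h1 (by omega) (by simp; omega)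
    (by rw [List.length_drop, hparLen]; omega) (by rw [List.length_take, hparLen]; omega)
    (by rw [length_search]; omega)]
  rfl

end HardProgram

/-! ### The list operations as arithmetic in a quotient of 𝔽₂[X] -/

namespace HardProgram

open LoopProg Function Polynomial

variable {d : ℕ}

/-- The vector of the entries of a list of bits. -/
def vec (d : ℕ) (l : List Bool) : Fin d → ZMod 2 := fun i => bitF2 (l.getD i false)

@[simp] theorem bitF2_false : bitF2 false = 0 := rfl
@[simp] theorem bitF2_true : bitF2 true = 1 := rfl

theorem bitF2_xor (a b : Bool) : bitF2 (xor a b) = bitF2 a + bitF2 b := by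
  cases a <;> cases b <;> decide

theorem bitF2_and (a b : Bool) : bitF2 (a && b) = bitF2 a * bitF2 b := by
  cases a <;> cases b <;> decide

theorem bitF2_decide (z : ZMod 2) : bitF2 (decide (z = 1)) = z := by
  revert z; decide

theorem bitF2_injective : Injective bitF2 := by decide

theorem vec_eq_zero_iff (l : List Bool) (hl : l.length = d) :
    vec d l = 0 ↔ l.any id = false := by
  subst hl
  rw [funext_iff, List.any_eq_false]
  constructor
  · intro h x hx
    obtain ⟨i, hi, rfl⟩ := List.getElem_of_mem hx
    have := h ⟨i, hi⟩
    simp only [vec, List.getD_eq_getElem _ _ hi] at this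
    intro h1
    simp only [id] at h1
    rw [h1] at this
    exact one_ne_zero this
  · intro h i
    have := h _ (List.getElem_mem i.2)
    simp only [vec, List.getD_eq_getElem _ _ i.2]
    simp at this
    simp [this]

/-- The list of bits of a vector. -/
def bits (w : Fin d → ZMod 2) : List Bool := List.ofFn fun i => decide (w i = 1)

@[simp] theorem length_bits (w : Fin d → ZMod 2) : (bits w).length = d := by simp [bits]

@[simp] theorem vec_bits (w : Fin d → ZMod 2) : vec d (bits w) = w := by
  funext i
  simp [vec, bits, bitF2_decide]

/-- The polynomial with the given coefficients, the leading coefficient first. -/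
noncomputable def poly (w : Fin d → ZMod 2) : (ZMod 2)[X] :=
  ∑ i : Fin d, C (w i) * X ^ (d - 1 - (i : ℕ))

theorem degree_poly_lt (w : Fin d → ZMod 2) : (poly w).degree < d := by
  refine mem_degreeLT.1 (Submodule.sum_mem _ fun i _ => mem_degreeLT.2 ?_)
  refine (degree_C_mul_X_pow_le _ _).trans_lt ?_
  exact_mod_cast (by omega : d - 1 - (i : ℕ) < d)

theorem coeff_poly (w : Fin d → ZMod 2) (i : Fin d) : (poly w).coeff (d - 1 - i) = w i := by
  rw [poly, finsetSum_coeff, Finset.sum_eq_single i]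
  · simp
  · intro j _ hj
    rw [coeff_C_mul_X_pow, if_neg]
    intro h
    exact hj (Fin.ext (by omega))
  · simp

theorem poly_coeff {g : (ZMod 2)[X]} (hg : g.degree < d) :
    poly (fun i : Fin d => g.coeff (d - 1 - i)) = g := by
  rw [poly, Fin.sum_univ_eq_sum_range (fun i => C (g.coeff (d - 1 - i)) * X ^ (d - 1 - i)) d,
    Finset.sum_range_reflect (fun i => C (g.coeff i) * X ^ i) d]
  rcases eq_or_ne g 0 with rfl | h
  · simp
  · exact (g.as_sum_range_C_mul_X_pow' ((natDegree_lt_iff_degree_lt h).2 hg)).symm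

/-- The monic polynomial of degree `d` with the given lower coefficients. -/
noncomputable def monicPoly (d : ℕ) (P : List Bool) : (ZMod 2)[X] := X ^ d + poly (vec d P)

theorem monic_monicPoly (P : List Bool) : (monicPoly d P).Monic :=
  monic_X_pow_add (degree_poly_lt _)

theorem degree_monicPoly (P : List Bool) : (monicPoly d P).degree = d := by
  rw [monicPoly, degree_add_eq_left_of_degree_lt] <;> simp [degree_poly_lt]

/-- The residue class with the given coefficients. -/
noncomputable def residue (P : List Bool) (w : Fin d → ZMod 2) : AdjoinRoot (monicPoly d P) :=
  AdjoinRoot.mk _ (poly w)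

theorem poly_add (w w' : Fin d → ZMod 2) : poly (w + w') = poly w + poly w' := by
  simp [poly, add_mul, Finset.sum_add_distrib]

theorem poly_smul (c : ZMod 2) (w : Fin d → ZMod 2) : poly (c • w) = C c * poly w := by
  simp [poly, mul_assoc, Finset.mul_sum]

/-- Polynomials of degree below `d` that are congruent modulo a polynomial of degree `d` are equal.
With division with remainder for surjectivity, bit strings of length `d` are unique names for the
residues. -/
theorem residue_injective (P : List Bool) :
    Injective (residue P : (Fin d → ZMod 2) → _) := by
  intro w w' h
  rw [residue, residue, AdjoinRoot.mk_eq_mk] at h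
  have hdeg : (poly w - poly w').degree < (monicPoly d P).degree := by
    rw [degree_monicPoly]
    exact (degree_sub_le _ _).trans_lt (max_lt (degree_poly_lt _) (degree_poly_lt _))
  have h0 := eq_zero_of_dvd_of_degree_lt h hdeg
  funext i
  rw [← coeff_poly w, ← coeff_poly w', sub_eq_zero.1 h0]

theorem residue_surjective (P : List Bool) :
    Surjective (residue P : (Fin d → ZMod 2) → _) := by
  intro a
  obtain ⟨g, rfl⟩ := AdjoinRoot.mk_surjective a
  have hm := monic_monicPoly (d := d) P
  have hdeg : (g %ₘ monicPoly d P).degree < d := by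
    have := degree_modByMonic_lt g hm
    rwa [degree_monicPoly] at this
  refine ⟨fun i => (g %ₘ monicPoly d P).coeff (d - 1 - i), ?_⟩
  rw [residue, poly_coeff hdeg, AdjoinRoot.mk_eq_mk]
  refine ⟨-(g /ₘ monicPoly d P), ?_⟩
  nth_rw 2 [← modByMonic_add_div g (monicPoly d P)]
  ring

/-- The value of a list of coefficients at an element of a ring, the leading coefficient first. -/
def evalL {R : Type*} [CommRing R] [Algebra (ZMod 2) R] (t : R) : List Bool → R
  | [] => 0
  | b :: l => algebraMap (ZMod 2) R (bitF2 b) * t ^ l.length + evalL t l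

section

variable {R : Type*} [CommRing R] [Algebra (ZMod 2) R] (t : R)

theorem evalL_append_singleton (l : List Bool) (b : Bool) :
    evalL t (l ++ [b]) = t * evalL t l + algebraMap (ZMod 2) R (bitF2 b) := by
  induction l with
  | nil => simp [evalL]
  | cons a l ih => simp [evalL, ih, pow_succ]; ring

theorem evalL_replicate_false (n : ℕ) : evalL t (List.replicate n false) = 0 := by
  induction n with
  | zero => rfl
  | succ n ih => simp [List.replicate_succ, evalL, ih]

/-- Coefficients are stored leading first, so padding `r` at its end by `j` zeros multiplies its
value by `t ^ j`. -/
theorem evalL_axpyL (c : Bool) (w r : List Bool) (j : ℕ) (h : r.length + j = w.length) :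
    evalL t (axpyL c w r) = t ^ j * evalL t r + algebraMap (ZMod 2) R (bitF2 c) * evalL t w := by
  induction w generalizing r j with
  | nil =>
    obtain rfl : r = [] := by simp at h; exact h.1
    simp [axpyL, evalL]
  | cons a w ih =>
    rcases r with _ | ⟨b, r⟩
    · have := ih [] w.length (by simp)
      simp only [axpyL, evalL, List.tail_nil, this, List.headD_nil, bitF2_xor, bitF2_and, map_add,
        map_mul, length_axpyL, bitF2_false]
      simp
      ring
    · have hj : r.length + j = w.length := by simp at h; omega
      have := ih r j hj
      simp only [axpyL, evalL, List.tail_cons, this, List.headD_cons, bitF2_xor, bitF2_and,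
        map_add, map_mul, length_axpyL]
      rw [← hj]
      ring

/-- The hypothesis `ht` allows the overflowing power `t ^ P.length` to be replaced by the value of
`P`. Popping the leading bit leaves `r` one entry short, and this gap supplies the factor `t`. -/
theorem evalL_shiftL (P r : List Bool) (h : r.length = P.length)
    (ht : t ^ P.length = evalL t P) : evalL t (shiftL P r) = t * evalL t r := by
  rcases r with _ | ⟨c, r⟩
  · simp [shiftL, evalL]
  · simp only [shiftL, evalL]
    rw [evalL_axpyL t c P r 1 (by simpa using h), ← ht, ← h, List.length_cons]
    ring

theorem length_shiftL (P r : List Bool) (h : r.length = P.length) :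
    (shiftL P r).length = P.length := by
  cases r <;> simp_all [shiftL]

theorem evalL_mulL (P u v : List Bool) (h : v.length = P.length) (ht : t ^ P.length = evalL t P) :
    evalL t (mulL P u v) = evalL t u * evalL t v := by
  induction u using List.reverseRecOn with
  | nil => simp [mulL, evalL_replicate_false, evalL]
  | append_singleton u b ih =>
    have hm : mulL P (u ++ [b]) v = axpyL b v (shiftL P (mulL P u v)) := by simp [mulL]
    have hl : (mulL P u v).length = P.length := by rw [length_mulL, h]
    rw [hm, evalL_axpyL t b v _ 0 (by rw [length_shiftL P _ hl, h, add_zero]),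
      evalL_shiftL t P _ hl ht, ih, evalL_append_singleton]
    ring

theorem evalL_hornerL (P al dd x : List Bool) (hal : al.length = P.length)
    (hdd : dd.length = P.length) (ht : t ^ P.length = evalL t P) :
    evalL t (hornerL P al dd x.reverse) =
      evalL t dd * ∑ j : Fin x.length, algebraMap (ZMod 2) R (bitF2 x[j]) * evalL t al ^ (j : ℕ) := by
  induction x with
  | nil => simp [hornerL, evalL_replicate_false]
  | cons b x ih =>
    have hm : hornerL P al dd (b :: x).reverse =
        axpyL b dd (mulL P (hornerL P al dd x.reverse) al) := by simp [hornerL]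
    rw [hm, evalL_axpyL t b dd _ 0 (by rw [length_mulL, hal, hdd, add_zero]),
      evalL_mulL t P _ _ hal ht, ih]
    simp only [List.length_cons, Fin.sum_univ_succ]
    simp only [Fin.getElem_fin, Fin.val_zero, List.getElem_cons_zero, Fin.val_succ,
      List.getElem_cons_succ, pow_succ, pow_zero]
    simp only [mul_add, Finset.mul_sum, Finset.sum_mul]
    rw [add_comm]
    congr 1
    · ring
    · refine Finset.sum_congr rfl fun j _ => ?_
      ring

end

theorem evalL_root (P l : List Bool) (hl : l.length = d) :
    evalL (AdjoinRoot.root (monicPoly d P)) l = residue P (vec d l) := by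
  have key : ∀ l : List Bool, evalL (AdjoinRoot.root (monicPoly d P)) l =
      AdjoinRoot.mk _ (poly (vec l.length l)) := by
    intro l
    induction l with
    | nil => simp [evalL, poly]
    | cons b l ih =>
      rw [evalL, ih, poly, poly]
      simp only [List.length_cons, Fin.sum_univ_succ, map_add]
      congr 1
      simp only [map_sum]
      refine Finset.sum_congr rfl fun i _ => ?_
      have : l.length + 1 - 1 - (i.succ : ℕ) = l.length - 1 - i := by simp; omega
      rw [this]
      simp [vec]
  subst hl
  exact key l

/-- The root is a zero of `X ^ d + P`, and the sign disappears in characteristic two. -/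
theorem root_pow (P : List Bool) (hP : P.length = d) :
    (AdjoinRoot.root (monicPoly d P)) ^ P.length =
      evalL (AdjoinRoot.root (monicPoly d P)) P := by
  rw [evalL_root P P hP, residue, ← AdjoinRoot.mk_X, ← map_pow, AdjoinRoot.mk_eq_mk, hP]
  refine ⟨1, ?_⟩
  rw [mul_one, monicPoly, sub_eq_add_neg]
  congr 1
  have : (2 : (ZMod 2)[X]) = 0 := CharP.cast_eq_zero ((ZMod 2)[X]) 2
  linear_combination (-poly (vec d P)) * this

theorem residue_zero (P : List Bool) : residue P (0 : Fin d → ZMod 2) = 0 := by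
  simp [residue, poly]

/-- Bit strings of length `d` name all residues and `mulL` multiplies them, so the finite test is
literally the absence of zero divisors. Irreducibility of the modulus is never tested. -/
theorem isGood_iff_residue (P : List Bool) (hP : P.length = d) :
    isGood (2 ^ d) P (List.replicate d false) (List.replicate d false) = true ↔
      ∀ a b : AdjoinRoot (monicPoly d P), a * b = 0 → a = 0 ∨ b = 0 := by
  have h0 : ∀ l : List Bool, l.length = d →
      (evalL (AdjoinRoot.root (monicPoly d P)) l = 0 ↔ l.any id = false) := by
    intro l hl
    rw [evalL_root P l hl, ← residue_zero P, (residue_injective P).eq_iff, vec_eq_zero_iff l hl]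
  rw [isGood_iff d P _ _ (by simp) (by simp)]
  constructor
  · intro h a b hab
    obtain ⟨u, rfl⟩ := residue_surjective P a
    obtain ⟨v, rfl⟩ := residue_surjective P b
    have hu := evalL_root P (bits u) (length_bits u)
    have hv := evalL_root P (bits v) (length_bits v)
    rw [vec_bits] at hu hv
    rw [← hu, ← hv] at hab ⊢
    have hz := h (bits u) (bits v) (length_bits u) (length_bits v)
    rw [← evalL_mulL _ P _ _ (by simp [hP]) (root_pow P hP), h0 _ (by simp [length_mulL])] at hab
    rw [h0 _ (length_bits u), h0 _ (length_bits v)]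
    rw [zeroProduct, hab, Bool.not_false, Bool.true_and] at hz
    exact Bool.and_eq_false_iff.1 hz
  · intro h u v hu hv
    have hm := evalL_mulL _ P u v (hv.trans hP.symm) (root_pow P hP)
    by_cases hz : (mulL P u v).any id = false
    · rw [(h0 _ ((length_mulL P u v).trans hv)).2 hz] at hm
      have := h _ _ hm.symm
      rw [h0 _ hu, h0 _ hv] at this
      rcases this with h | h <;> simp [zeroProduct, h]
    · rw [Bool.not_eq_false] at hz
      simp [zeroProduct, hz]

/-- The minimal polynomial of a primitive element of the field with `2 ^ d` elements has degree `d`.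
-/
theorem exists_monic_irreducible (hd : d ≠ 0) :
    ∃ g : (ZMod 2)[X], g.Monic ∧ Irreducible g ∧ g.natDegree = d := by
  obtain ⟨α, hα⟩ := Field.exists_primitive_element (ZMod 2) (GaloisField 2 d)
  have hint : IsIntegral (ZMod 2) α := Algebra.IsIntegral.isIntegral α
  refine ⟨minpoly (ZMod 2) α, minpoly.monic hint, minpoly.irreducible hint, ?_⟩
  rw [(Field.primitive_element_iff_minpoly_natDegree_eq (ZMod 2) α).1 hα, GaloisField.finrank 2 hd]

theorem exists_isGood (hd : d ≠ 0) : ∃ P : List Bool, P.length = d ∧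
    isGood (2 ^ d) P (List.replicate d false) (List.replicate d false) = true := by
  obtain ⟨g, hm, hirr, hdeg⟩ := exists_monic_irreducible hd
  have hlt : (g - X ^ d).degree < (d : WithBot ℕ) := by
    have h1 : g.degree = (d : WithBot ℕ) := by rw [degree_eq_natDegree hm.ne_zero, hdeg]
    rw [← h1]
    refine degree_sub_lt_left ?_ hm.ne_zero ?_
    · rw [h1, degree_X_pow]
    · rw [hm.leadingCoeff, (monic_X_pow d).leadingCoeff]
  set w : Fin d → ZMod 2 := fun i => (g - X ^ d).coeff (d - 1 - i) with hw
  have hg : monicPoly d (bits w) = g := by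
    rw [monicPoly, vec_bits, hw, poly_coeff hlt]
    ring
  refine ⟨bits w, length_bits w, (isGood_iff_residue _ (length_bits w)).2 ?_⟩
  have : Fact (Irreducible (monicPoly d (bits w))) := ⟨hg ▸ hirr⟩
  intro a b hab
  exact mul_eq_zero.1 hab

/-- An irreducible polynomial of degree `d` passes the test, so the search ends with a polynomial
that passes; `d ≠ 0` excludes the zero ring. -/
theorem isDomain_search (hd : d ≠ 0) : IsDomain (AdjoinRoot (monicPoly d (search d))) := by
  obtain ⟨P, hP, hg⟩ := exists_isGood hd
  have h := (isGood_iff_residue _ (length_search d)).1 (search_spec hP hg)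
  have hdeg : (monicPoly d (search d)).degree ≠ 0 := by
    rw [degree_monicPoly]
    exact_mod_cast hd
  have := AdjoinRoot.nontrivial (monicPoly d (search d)) hdeg
  have : NoZeroDivisors (AdjoinRoot (monicPoly d (search d))) := ⟨fun {a b} => h a b⟩
  exact NoZeroDivisors.to_isDomain _

end HardProgram

/-! ### Linearity and small bias of the powering construction -/

namespace HardProgram

open LoopProg Function Polynomial

variable {d : ℕ}

theorem bitF2_dotL (w y : List Bool) (hw : w.length = d) :
    bitF2 (dotL w y) = ∑ i, vec d w i * vec d y i := by
  subst hw
  induction w generalizing y with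
  | nil => simp [dotL]
  | cons b w ih =>
    rw [dotL, bitF2_xor, bitF2_and, ih, List.length_cons, Fin.sum_univ_succ]
    congr 1
    · cases y <;> simp [vec]
    · refine Finset.sum_congr rfl fun i _ => ?_
      cases y <;> simp [vec]

/-- The vector computed by Horner's rule from the bits `x` and the parities `p`. -/
def hornerVec (d : ℕ) (p x : List Bool) : Fin d → ZMod 2 :=
  vec d (hornerL (search d) (p.drop d) (List.replicate d true) x.reverse)

theorem bitF2_outputBit (x p : List Bool) (hp : p.length = d + d) :
    bitF2 (outputBit d x p) = ∑ i, vec d (p.take d) i * hornerVec d p x i :=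
  bitF2_dotL _ _ (by simp [hp])

theorem residue_hornerVec (x p : List Bool) (hp : p.length = d + d) :
    residue (search d) (hornerVec d p x) =
      residue (search d) (vec d (List.replicate d true)) *
        ∑ j : Fin x.length, algebraMap (ZMod 2) _ (bitF2 x[j]) *
          residue (search d) (vec d (p.drop d)) ^ (j : ℕ) := by
  have h1 : (p.drop d).length = (search d).length := by simp [hp, length_search]
  have h2 : (List.replicate d true).length = (search d).length := by simp [length_search]
  rw [hornerVec, ← evalL_root _ _ (by rw [length_hornerL, List.length_replicate]),
    evalL_hornerL _ _ _ _ _ h1 h2 (root_pow _ (length_search d)),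
    evalL_root _ _ (List.length_replicate ..), evalL_root _ _ (h1.trans (length_search d))]

theorem residue_sum {ι : Type*} (s : Finset ι) (P : List Bool) (c : ι → ZMod 2)
    (w : ι → Fin d → ZMod 2) :
    residue P (∑ j ∈ s, c j • w j) = ∑ j ∈ s, algebraMap (ZMod 2) _ (c j) * residue P (w j) := by
  classical
  induction s using Finset.induction_on with
  | empty => simpa using residue_zero P
  | insert a s ha ih =>
    rw [Finset.sum_insert ha, Finset.sum_insert ha, ← ih, residue, poly_add, poly_smul, map_add,
      map_mul]
    rfl

theorem residue_hornerVec_ofFn {n : ℕ} (x : Fin n → Bool) (p : List Bool)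
    (hp : p.length = d + d) :
    residue (search d) (hornerVec d p (List.ofFn x)) =
      residue (search d) (vec d (List.replicate d true)) *
        ∑ j : Fin n, algebraMap (ZMod 2) _ (bitF2 (x j)) *
          residue (search d) (vec d (p.drop d)) ^ (j : ℕ) := by
  rw [residue_hornerVec _ _ hp]
  congr 1
  refine Fintype.sum_equiv (finCongr (List.length_ofFn ..)) _ _ fun j => ?_
  simp [List.getElem_ofFn]
  rfl

/-- Horner's rule computes a fixed multiple of `∑ x j * α ^ j`, which is linear in `x`; injectivity
of `residue` carries this back to coordinates. -/
theorem hornerVec_ofFn {n : ℕ} (x : Fin n → Bool) (p : List Bool) (hp : p.length = d + d) :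
    hornerVec d p (List.ofFn x) =
      ∑ j, bitF2 (x j) • hornerVec d p (List.ofFn fun i => decide (i = j)) := by
  refine residue_injective (search d) ?_
  rw [residue_sum, residue_hornerVec_ofFn x p hp, Finset.mul_sum]
  refine Finset.sum_congr rfl fun j _ => ?_
  rw [residue_hornerVec_ofFn _ p hp, Finset.sum_eq_single j]
  · simp; ring
  · intro i _ hi
    simp [hi]
  · simp

/-- Linearity in `x` means that the outputs on unit vectors form a matrix whose product with `x` is
the output. This is why `hardMatrix` is defined by unit vectors. -/
theorem bitF2_outputBit_ofFn {n : ℕ} (x : Fin n → Bool) (p : List Bool)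
    (hp : p.length = d + d) :
    bitF2 (outputBit d (List.ofFn x) p) =
      ∑ j, bitF2 (outputBit d (List.ofFn fun i => decide (i = j)) p) * bitF2 (x j) := by
  simp only [bitF2_outputBit _ _ hp]
  rw [hornerVec_ofFn x p hp]
  simp only [Finset.sum_apply, Pi.smul_apply, smul_eq_mul, Finset.mul_sum, Finset.sum_mul]
  rw [Finset.sum_comm]
  refine Finset.sum_congr rfl fun i _ => Finset.sum_congr rfl fun j _ => ?_
  ring

/-- Flipping the bit of `β` at a coordinate where `Y` is nonzero is an involution that negates the
inner product. -/
theorem card_dotL (Y : List Bool) (h : vec d Y ≠ 0) :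
    2 * (Finset.univ.filter fun β : Fin d → Bool => dotL (List.ofFn β) Y = true).card = 2 ^ d := by
  classical
  obtain ⟨i, hi⟩ : ∃ i, vec d Y i ≠ 0 := by
    by_contra! hc
    exact h (funext hc)
  have hi1 : vec d Y i = 1 := by
    revert hi; generalize vec d Y i = z; revert z; decide
  have hvec : ∀ β : Fin d → Bool, vec d (List.ofFn β) = fun i => bitF2 (β i) := by
    intro β; funext i; simp [vec]
  have hflip : ∀ β : Fin d → Bool,
      dotL (List.ofFn (update β i (!β i))) Y = !dotL (List.ofFn β) Y := by
    intro β
    refine bitF2_injective ?_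
    have hn : ∀ b : Bool, bitF2 (!b) = bitF2 b + 1 := by decide
    rw [hn, bitF2_dotL (d := d) _ _ (by simp), bitF2_dotL (d := d) _ _ (by simp), hvec, hvec,
      ← Finset.add_sum_erase _ _ (Finset.mem_univ i),
      ← Finset.add_sum_erase Finset.univ (fun j => bitF2 (β j) * vec d Y j) (Finset.mem_univ i)]
    have : ∑ j ∈ Finset.univ.erase i, bitF2 (update β i (!β i) j) * vec d Y j =
        ∑ j ∈ Finset.univ.erase i, bitF2 (β j) * vec d Y j := by
      refine Finset.sum_congr rfl fun j hj => ?_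
      rw [update_of_ne (Finset.ne_of_mem_erase hj)]
    dsimp only
    rw [this, update_self, hn, hi1]
    ring
  have hcard : (Finset.univ.filter fun β : Fin d → Bool => dotL (List.ofFn β) Y = true).card =
      (Finset.univ.filter fun β : Fin d → Bool => ¬ dotL (List.ofFn β) Y = true).card := by
    refine Finset.card_bij' (fun β _ => update β i (!β i)) (fun β _ => update β i (!β i)) ?_ ?_ ?_ ?_
    · intro β hβ
      simp only [Finset.mem_filter, Finset.mem_univ, true_and] at hβ ⊢
      rw [hflip, hβ]
      simp
    · intro β hβ
      simp only [Finset.mem_filter, Finset.mem_univ, true_and] at hβ ⊢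
      rw [hflip]
      simpa using hβ
    · intro β _; simp
    · intro β _; simp
  have htot := Finset.card_filter_add_card_filter_not (s := (Finset.univ : Finset (Fin d → Bool)))
    (fun β => dotL (List.ofFn β) Y = true)
  rw [← hcard] at htot
  simp at htot ⊢
  omega

theorem dotL_eq_false (w Y : List Bool) (hw : w.length = d) (h : vec d Y = 0) :
    dotL w Y = false := by
  refine bitF2_injective ?_
  rw [bitF2_dotL w Y hw, h]
  simp

/-- Few parity vectors lead to the zero vector in Horner's rule. -/
theorem card_hornerVec_eq_zero (hd : d ≠ 0) {n : ℕ} (x : Fin n → Bool) (hx : ∃ j, x j = true) :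
    (Finset.univ.filter fun α : Fin d → Bool =>
      vec d (hornerL (search d) (List.ofFn α) (List.replicate d true) (List.ofFn x).reverse) =
        0).card ≤ n := by
  classical
  have := isDomain_search hd
  set R := AdjoinRoot (monicPoly d (search d))
  -- The `α` in question are roots of the nonzero polynomial with coefficient vector `x`, of degree
  -- below `n`.
  set q : R[X] := ∑ j : Fin n, C (algebraMap (ZMod 2) R (bitF2 (x j))) * X ^ (j : ℕ) with hq
  have hcoeff : ∀ j : Fin n, q.coeff j = algebraMap (ZMod 2) R (bitF2 (x j)) := by
    intro j
    rw [hq, finsetSum_coeff, Finset.sum_eq_single j]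
    · simp
    · intro i _ hi
      rw [coeff_C_mul_X_pow, if_neg]
      exact fun h => hi (Fin.ext h.symm)
    · simp
  have hq0 : q ≠ 0 := by
    obtain ⟨j, hj⟩ := hx
    intro h0
    have := hcoeff j
    rw [h0, hj] at this
    simp at this
  have hdeg : q.degree < n := by
    refine mem_degreeLT.1 (Submodule.sum_mem _ fun i _ => mem_degreeLT.2 ?_)
    refine (degree_C_mul_X_pow_le _ _).trans_lt ?_
    exact_mod_cast i.2
  have hroots : q.roots.toFinset.card ≤ n := by
    refine (Multiset.toFinset_card_le _).trans ((card_roots' q).trans ?_)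
    exact ((natDegree_lt_iff_degree_lt hq0).2 hdeg).le
  -- The initial scale of Horner's rule is the residue with all coordinates one; any nonzero factor
  -- would do, as it cancels in a domain.
  have hones : residue (search d) (vec d (List.replicate d true)) ≠ 0 := by
    rw [← residue_zero (search d), (residue_injective _).ne_iff]
    intro h
    have := congrFun h ⟨0, Nat.pos_of_ne_zero hd⟩
    simp [vec, Nat.pos_of_ne_zero hd] at this
  refine le_trans (Finset.card_le_card_of_injOn (fun α : Fin d → Bool =>
    (residue (search d) (vec d (List.ofFn α)) : R)) ?_ ?_) hroots
  · intro α hα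
    simp only [Finset.coe_filter, Finset.mem_univ, true_and, Set.mem_ofPred_eq] at hα
    simp only [Finset.mem_coe, Multiset.mem_toFinset, mem_roots hq0, IsRoot.def]
    have h1 := residue_hornerVec_ofFn x (List.replicate d false ++ List.ofFn α)
      (d := d) (by simp)
    have hdrop : (List.replicate d false ++ List.ofFn α).drop d = List.ofFn α := by
      rw [List.drop_append_of_le_length (by simp)]; simp
    rw [hornerVec, hdrop, hα, residue_zero] at h1
    have h2 := (mul_eq_zero.1 h1.symm).resolve_left hones
    rw [hq, eval_finsetSum]
    simp only [eval_mul, eval_C, eval_pow, eval_X]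
    exact h2
  · intro α _ β _ h
    have := residue_injective _ h
    funext i
    refine bitF2_injective ?_
    simpa [vec] using congrFun this i

/-- The number of parity vectors for which the output bit is one. -/
theorem card_outputBit (hd : d ≠ 0) {n : ℕ} (x : Fin n → Bool) (hx : ∃ j, x j = true) :
    ∃ m ≤ n, 2 * (Finset.univ.filter fun z : Fin (d + d) → Bool =>
      outputBit d (List.ofFn x) (List.ofFn z) = true).card + 2 ^ d * m = 2 ^ d * 2 ^ d := by
  classical
  set Y : (Fin d → Bool) → List Bool := fun α =>
    hornerL (search d) (List.ofFn α) (List.replicate d true) (List.ofFn x).reverse with hY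
  refine ⟨_, card_hornerVec_eq_zero hd x hx, ?_⟩
  have h1 : (Finset.univ.filter fun z : Fin (d + d) → Bool =>
      outputBit d (List.ofFn x) (List.ofFn z) = true).card =
        ∑ α : Fin d → Bool, (Finset.univ.filter fun β : Fin d → Bool =>
          dotL (List.ofFn β) (Y α) = true).card := by
    simp only [Finset.card_filter]
    rw [← Fintype.sum_prod_type_right', ← (Fin.appendEquiv d d).sum_comp]
    refine Finset.sum_congr rfl fun βα _ => ?_
    obtain ⟨β, α⟩ := βα
    simp only [Fin.appendEquiv, Equiv.coe_fn_mk, List.ofFn_fin_append, outputBit, hY]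
    rw [List.take_left' (by simp), List.drop_left' (by simp)]
  -- For an `α` that is no root, exactly half of the `β` give one; for a root, none do. Roots thus
  -- account for the defect `2 ^ d * m`.
  have h2 : ∀ α : Fin d → Bool, 2 * (Finset.univ.filter fun β : Fin d → Bool =>
      dotL (List.ofFn β) (Y α) = true).card + 2 ^ d * (if vec d (Y α) = 0 then 1 else 0) =
        2 ^ d := by
    intro α
    split_ifs with h
    · rw [Finset.filter_false_of_mem]
      · simp
      · intro β _
        rw [dotL_eq_false _ _ (by simp) h]
        simp
    · simpa using card_dotL (Y α) h
  rw [h1, Finset.card_filter, Finset.mul_sum, Finset.mul_sum, ← Finset.sum_add_distrib,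
    Finset.sum_congr rfl fun α _ => h2 α]
  simp

/-- The matrix of the small-biased set of the powering construction. -/
def hardMatrix (n : ℕ) : Matrix (Fin (2 ^ blockCount n)) (Fin n) (ZMod 2) := fun r j =>
  bitF2 (outputBit (8 * Nat.clog 2 n) (List.ofFn fun i : Fin n => decide (i = j))
    (List.ofFn fun i => decide (finFunctionFinEquiv.symm r i = 1)))

theorem blockCount_eq (n : ℕ) : blockCount n = 8 * Nat.clog 2 n + 8 * Nat.clog 2 n := by
  rw [blockCount]; ring

theorem hardMatrix_mulVec {n : ℕ} (x : Fin n → Bool) (r : Fin (2 ^ blockCount n)) :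
    (hardMatrix n).mulVec (fun j => bitF2 (x j)) r =
      bitF2 (outputBit (8 * Nat.clog 2 n) (List.ofFn x)
        (List.ofFn fun i => decide (finFunctionFinEquiv.symm r i = 1))) := by
  rw [bitF2_outputBit_ofFn x _ (by simp [blockCount_eq])]
  rfl

/-- Positions correspond to their binary representations. -/
def positionEquiv (k : ℕ) : Fin (2 ^ k) ≃ (Fin k → Bool) :=
  finFunctionFinEquiv.symm.trans (Equiv.arrowCongr (Equiv.refl _) finTwoEquiv)

theorem positionEquiv_apply (k : ℕ) (r : Fin (2 ^ k)) :
    positionEquiv k r = fun i => decide (finFunctionFinEquiv.symm r i = 1) := by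
  have : ∀ b : Fin 2, finTwoEquiv b = decide (b = 1) := by decide
  funext i
  simp [positionEquiv, this]

theorem card_mulVec_ne_zero {n : ℕ} (x : Fin n → Bool) :
    (Finset.univ.filter fun r => (hardMatrix n).mulVec (fun j => bitF2 (x j)) r ≠ 0).card =
      (Finset.univ.filter fun z : Fin (8 * Nat.clog 2 n + 8 * Nat.clog 2 n) → Bool =>
        outputBit (8 * Nat.clog 2 n) (List.ofFn x) (List.ofFn z) = true).card := by
  -- The equality of `blockCount n` and `d + d` is only propositional, so the index `k` is
  -- generalized before it is substituted.
  have h : ∀ k, k = 8 * Nat.clog 2 n + 8 * Nat.clog 2 n →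
      (Finset.univ.filter fun r : Fin (2 ^ k) => outputBit (8 * Nat.clog 2 n) (List.ofFn x)
        (List.ofFn fun i => decide (finFunctionFinEquiv.symm r i = 1)) = true).card =
      (Finset.univ.filter fun z : Fin (8 * Nat.clog 2 n + 8 * Nat.clog 2 n) → Bool =>
        outputBit (8 * Nat.clog 2 n) (List.ofFn x) (List.ofFn z) = true).card := by
    rintro _ rfl
    rw [Finset.card_filter, Finset.card_filter, ← (positionEquiv _).sum_comp]
    simp [positionEquiv_apply]
  have hb : ∀ b : Bool, bitF2 b ≠ 0 ↔ b = true := by decide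
  rw [← h _ (blockCount_eq n)]
  simp only [hardMatrix_mulVec, hb]

/-- With `m ≤ n` roots the fraction of ones is `1 / 2 - m / (2 * 2 ^ d)`, and `2 ^ d` is the square
root of the number of rows. -/
theorem smallBiased_hardMatrix (n : ℕ) : SmallBiased (hardMatrix n) (biasBound 1 n) := by
  intro v hv
  set x : Fin n → Bool := fun j => decide (v j = 1)
  have hvx : v = fun j => bitF2 (x j) := by funext j; simp [x, bitF2_decide]
  obtain ⟨j, hj⟩ : ∃ j, v j ≠ 0 := by
    by_contra! h
    exact hv (funext h)
  have hj1 : x j = true := by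
    have : ∀ z : ZMod 2, z ≠ 0 → decide (z = 1) = true := by decide
    exact this _ hj
  have hn : 1 ≤ n := (Nat.zero_le _).trans_lt j.2
  set d := 8 * Nat.clog 2 n with hd
  have hsq : √((2 : ℝ) ^ blockCount n) = 2 ^ d := by
    rw [blockCount_eq, pow_add, Real.sqrt_mul_self (by positivity)]
  rw [biasBound, hsq, hvx, card_mulVec_ne_zero x, one_mul, ← hd]
  push_cast
  rw [blockCount_eq, ← hd, pow_add]
  have hpos : (0 : ℝ) < 2 ^ d := by positivity
  -- For `d = 0` there is a single row and no field, but then the allowed deviation is `n ≥ 1`.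
  rcases Nat.eq_zero_or_pos d with h0 | hdpos
  · have hc : ((Finset.univ.filter fun z : Fin (d + d) → Bool =>
        outputBit d (List.ofFn x) (List.ofFn z) = true).card : ℝ) ≤ 1 := by
      have := Finset.card_le_univ (Finset.univ.filter fun z : Fin (d + d) → Bool =>
        outputBit d (List.ofFn x) (List.ofFn z) = true)
      simp only [Fintype.card_fun, Fintype.card_bool, Fintype.card_fin] at this
      have e : 2 ^ (d + d) = 1 := by simp [h0]
      rw [e] at this
      exact_mod_cast this
    have hn' : (1 : ℝ) ≤ n := by exact_mod_cast hn
    have h00 : ((2 : ℝ) ^ d) = 1 := by rw [h0, pow_zero]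
    rw [h00, mul_one, div_one, div_one, abs_le]
    constructor <;> linarith [Nat.cast_nonneg (α := ℝ)
      (Finset.univ.filter fun z : Fin (d + d) → Bool =>
        outputBit d (List.ofFn x) (List.ofFn z) = true).card]
  · obtain ⟨m, hm, hc⟩ := card_outputBit hdpos.ne' x ⟨j, hj1⟩
    generalize (Finset.univ.filter fun z : Fin (d + d) → Bool =>
        outputBit d (List.ofFn x) (List.ofFn z) = true).card = c at hc
    have hc' : (2 : ℝ) * c + 2 ^ d * m = 2 ^ d * 2 ^ d := by exact_mod_cast hc
    have hm' : (m : ℝ) ≤ n := by exact_mod_cast hm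
    have e : (c : ℝ) / (2 ^ d * 2 ^ d) - 1 / 2 = -(m / 2 / 2 ^ d) := by
      field_simp
      linarith
    rw [e, abs_neg, abs_of_nonneg (by positivity)]
    gcongr
    linarith [Nat.cast_nonneg (α := ℝ) m]

theorem parityL_cons (b : Bool) (l : List Bool) : parityL (b :: l) = xor b (parityL l) := by
  induction l using List.reverseRecOn with
  | nil => simp [parityL]
  | append_singleton l c ih =>
    rw [← List.cons_append, parityL_append_singleton, ih, parityL_append_singleton, Bool.xor_assoc]

theorem bitF2_parityL_take_drop : ∀ {n : ℕ} (a : Fin n → Bool) (lo c : ℕ),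
    bitF2 (parityL (((List.ofFn a).drop lo).take c)) =
      ∑ j : Fin n, if lo ≤ (j : ℕ) ∧ (j : ℕ) < lo + c then bitF2 (a j) else 0
  | 0, a, lo, c => by simp [parityL, bitF2]
  | n + 1, a, 0, 0 => by simp [parityL, bitF2]
  | n + 1, a, 0, c + 1 => by
    have := bitF2_parityL_take_drop (fun j => a j.succ) 0 c
    rw [List.ofFn_succ, Fin.sum_univ_succ]
    simp only [List.drop_zero, zero_add, Nat.zero_le, true_and] at this
    simp [parityL_cons, bitF2_xor, this]
  | n + 1, a, lo + 1, c => by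
    have := bitF2_parityL_take_drop (fun j => a j.succ) lo c
    rw [List.ofFn_succ, Fin.sum_univ_succ]
    simp [this, add_right_comm]

theorem blockParities_eq {n : ℕ} (b k : ℕ) (a : Fin n → Bool) :
    blockParities b k (List.ofFn a) = List.ofFn fun i : Fin k => blockParity b a i := by
  refine List.ext_getElem (by simp [blockParities]) fun i h1 h2 => ?_
  simp only [blockParities, List.getElem_map, List.getElem_range, List.getElem_ofFn, blockParity]
  refine bitF2_injective ?_
  rw [bitF2_parityL_take_drop, bitF2_decide, Finset.sum_filter]
  simp only [mul_add, mul_one]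

theorem output_eq_hardB {n : ℕ} (x a : Fin n → Bool) :
    output (List.ofFn x ++ List.ofFn a) = hardB (hardMatrix n) x a := by
  have hlen : (List.ofFn x ++ List.ofFn a).length / 2 = n := by simp; omega
  have hb : ∀ b : Bool, decide (bitF2 b = 1) = b := by decide
  rw [output, hlen, List.take_left' (by simp), List.drop_left' (by simp), hardB, hardF,
    multiplexer, hardMatrix_mulVec, hb, blockParities_eq]
  congr 1
  have e : 2 * (8 * Nat.clog 2 n) = blockCount n := by rw [blockCount]; ring
  simp only [Equiv.symm_apply_apply]
  rw [e]
  congr 1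
  funext i
  cases h : blockParity (n / blockCount n) a i <;> simp

end HardProgram

/-! ### Expectations over product spaces -/

namespace ProductSpace

open Finset
open scoped BigOperators

variable {ι β : Type} [Fintype ι] [DecidableEq ι] [Fintype β]

theorem expect_prod (g : ι → β → ℝ) : 𝔼 a : ι → β, ∏ i, g i (a i) = ∏ i, 𝔼 c, g i c := by
  simp only [Fintype.expect_eq_sum_div_card, Finset.prod_div_distrib, Fintype.prod_sum]
  simp

theorem expect_mul_prod (i : ι) (u : β → ℝ) (g : ι → β → ℝ) (hg : ∀ j ≠ i, 𝔼 c, g j c = 1) :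
    𝔼 a : ι → β, u (a i) * ∏ j, g j (a j) = 𝔼 c, u c * g i c := by
  have h := expect_prod fun j c => (if j = i then u c else 1) * g j c
  simp only [Finset.prod_mul_distrib, Finset.prod_ite_eq', Finset.mem_univ, if_true] at h
  rw [h, Finset.prod_eq_single i]
  · simp
  · intro j _ hj
    simp [hj, hg j hj]
  · simp

variable [Nonempty β]

theorem expect_apply (i : ι) (u : β → ℝ) : 𝔼 a : ι → β, u (a i) = 𝔼 c, u c := by
  simpa using expect_mul_prod i u (fun _ _ => 1) (by simp)

theorem sq_expect_le {α : Type} [Fintype α] [Nonempty α] (g : α → ℝ) :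
    (𝔼 a, g a) ^ 2 ≤ 𝔼 a, g a ^ 2 := by
  simpa using expect_mul_sq_le_sq_mul_sq univ g 1

/-- Cauchy–Schwarz; `f` will be the indicator of an arbitrary gate, of which only boundedness is
used. -/
theorem expect_mul_le_sqrt {α : Type} [Fintype α] [Nonempty α] (f g : α → ℝ)
    (hf : ∀ a, |f a| ≤ 1) {B : ℝ} (hB : 𝔼 a, g a ^ 2 ≤ B) : 𝔼 a, f a * g a ≤ √B := by
  refine Real.le_sqrt_of_sq_le ((sq_expect_le _).trans (le_trans ?_ hB))
  refine expect_le_expect fun a _ => ?_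
  rw [mul_pow]
  exact mul_le_of_le_one_left (sq_nonneg _) ((sq_le_one_iff_abs_le_one _).2 (hf a))

variable {v : ι → β → ℝ} {τ : ι → ℝ}

theorem expect_mul_apply (h0 : ∀ i, 𝔼 c, v i c = 0) (h2 : ∀ i, 𝔼 c, v i c ^ 2 = τ i) (i j : ι) :
    𝔼 a : ι → β, v i (a i) * v j (a j) = if i = j then τ i else 0 := by
  split_ifs with h
  · subst h
    rw [expect_apply i fun c => v i c * v i c, ← h2]
    simp only [sq]
  · have h' := expect_prod fun l c => (if l = i then v i c else 1) * (if l = j then v j c else 1)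
    simp only [Finset.prod_mul_distrib, Finset.prod_ite_eq', Finset.mem_univ, if_true] at h'
    rw [h']
    refine Finset.prod_eq_zero (Finset.mem_univ i) ?_
    simp [h, h0]

theorem expect_sum_sq (h0 : ∀ i, 𝔼 c, v i c = 0) (h2 : ∀ i, 𝔼 c, v i c ^ 2 = τ i) (s : ι → ℝ) :
    𝔼 a : ι → β, (∑ i, s i * v i (a i)) ^ 2 = ∑ i, s i ^ 2 * τ i := by
  simp only [sq, Finset.sum_mul_sum, expect_sum_comm]
  refine Finset.sum_congr rfl fun i _ => ?_
  have : ∀ j, 𝔼 a : ι → β, s i * v i (a i) * (s j * v j (a j)) =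
      s i * s j * if i = j then τ i else 0 := by
    intro j
    rw [← expect_mul_apply h0 h2, mul_expect]
    exact expect_congr rfl fun a _ => by ring
  simp [this]

/-- The product of the factors `1 + ε v i`. -/
def tilt (v : ι → β → ℝ) (ε : ℝ) (a : ι → β) : ℝ := ∏ i, (1 + ε * v i (a i))

/-- By independence the expectation factors over coordinates, and in each factor the linear term has
mean zero. -/
theorem expect_tilt_mul_tilt (h0 : ∀ i, 𝔼 c, v i c = 0) (h2 : ∀ i, 𝔼 c, v i c ^ 2 = τ i)
    (ε η : ℝ) : 𝔼 a, tilt v ε a * tilt v η a = ∏ i, (1 + ε * η * τ i) := by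
  simp only [tilt, ← Finset.prod_mul_distrib]
  rw [expect_prod fun i c => (1 + ε * v i c) * (1 + η * v i c)]
  refine Finset.prod_congr rfl fun i _ => ?_
  have : ∀ c, (1 + ε * v i c) * (1 + η * v i c) = 1 + (ε + η) * v i c + ε * η * v i c ^ 2 :=
    fun c => by ring
  simp only [this, expect_add_distrib, ← mul_expect, h0, h2]
  simp

theorem expect_mul_tilt (h0 : ∀ i, 𝔼 c, v i c = 0) (h2 : ∀ i, 𝔼 c, v i c ^ 2 = τ i)
    (ε : ℝ) (i : ι) : 𝔼 a, v i (a i) * tilt v ε a = ε * τ i := by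
  simp only [tilt]
  rw [expect_mul_prod i (v i) fun j c => 1 + ε * v j c]
  · have : ∀ c, v i c * (1 + ε * v i c) = v i c + ε * v i c ^ 2 := fun c => by ring
    simp only [this, expect_add_distrib, ← mul_expect, h0, h2]
    simp
  · intro j _
    simp only [expect_add_distrib, ← mul_expect, h0]
    simp

theorem one_sub_sum_le_prod {κ : Type} (s : Finset κ) (u : κ → ℝ) (hu : ∀ i ∈ s, 0 ≤ u i)
    (hu' : ∀ i ∈ s, u i ≤ 1) : 1 - ∑ i ∈ s, u i ≤ ∏ i ∈ s, (1 - u i) := by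
  classical
  induction s using Finset.induction_on with
  | empty => simp
  | insert i s hi ih =>
    rw [Finset.sum_insert hi, Finset.prod_insert hi]
    have h := ih (fun j hj => hu j (mem_insert_of_mem hj)) fun j hj => hu' j (mem_insert_of_mem hj)
    have h1 : 0 ≤ u i := hu i (mem_insert_self _ _)
    have h2 : u i ≤ 1 := hu' i (mem_insert_self _ _)
    have h3 : 0 ≤ ∑ j ∈ s, u j := sum_nonneg fun j hj => hu j (mem_insert_of_mem hj)
    nlinarith [mul_le_mul_of_nonneg_left h (sub_nonneg.2 h2), mul_nonneg h1 h3]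

theorem prod_one_add_le {κ : Type} (s : Finset κ) (u : κ → ℝ) (hu : ∀ i ∈ s, 0 ≤ u i)
    (hs : ∑ i ∈ s, u i ≤ 1) :
    ∏ i ∈ s, (1 + u i) ≤ 1 + ∑ i ∈ s, u i + (∑ i ∈ s, u i) ^ 2 := by
  have h1 : ∏ i ∈ s, (1 + u i) ≤ Real.exp (∑ i ∈ s, u i) := by
    rw [Real.exp_sum]
    refine prod_le_prod (fun i hi => by linarith [hu i hi]) fun i hi => ?_
    linarith [Real.add_one_le_exp (u i)]
  have h0 : 0 ≤ ∑ i ∈ s, u i := sum_nonneg hu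
  have := Real.abs_exp_sub_one_sub_id_le (x := ∑ i ∈ s, u i) (by rwa [abs_of_nonneg h0])
  linarith [le_abs_self (Real.exp (∑ i ∈ s, u i) - 1 - ∑ i ∈ s, u i)]

/-- The second moment of the difference of the two tilted densities. -/
theorem expect_tilt_sub_sq (h0 : ∀ i, 𝔼 c, v i c = 0) (h2 : ∀ i, 𝔼 c, v i c ^ 2 = τ i)
    (hτ : ∑ i, τ i ≤ 1) :
    𝔼 a, (tilt v 1 a - tilt v (-1) a) ^ 2 ≤ 4 * ∑ i, τ i + 2 * (∑ i, τ i) ^ 2 := by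
  have hτ0 : ∀ i, 0 ≤ τ i := fun i => h2 i ▸ expect_nonneg fun c _ => sq_nonneg _
  have hτ1 : ∀ i, τ i ≤ 1 := fun i => (single_le_sum (fun j _ => hτ0 j) (mem_univ i)).trans hτ
  have e : ∀ a, (tilt v 1 a - tilt v (-1) a) ^ 2 = tilt v 1 a * tilt v 1 a -
      2 * (tilt v 1 a * tilt v (-1) a) + tilt v (-1) a * tilt v (-1) a := fun a => by ring
  -- With `T = ∑ i, τ i`, the second moment is `2 * ∏ (1 + τ i) - 2 * ∏ (1 - τ i)`, at most `2 * (1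
  -- + T + T ^ 2) - 2 * (1 - T)`.
  simp only [e, expect_add_distrib, expect_sub_distrib, ← mul_expect, expect_tilt_mul_tilt h0 h2]
  have h3 := prod_one_add_le univ τ (fun i _ => hτ0 i) hτ
  have h4 := one_sub_sum_le_prod univ τ (fun i _ => hτ0 i) fun i _ => hτ1 i
  simp only [one_mul, mul_neg, mul_one, neg_neg, neg_mul, ← sub_eq_add_neg]
  linarith

/-- The sum `2 * ∑ v i` is the orthogonal projection of the difference of tilts to the span of the
`v i`. Subtracting it removes exactly `4 * ∑ τ i` from the second moment, which leaves the quadratic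
term. -/
theorem expect_tilt_sub_sub_sq (h0 : ∀ i, 𝔼 c, v i c = 0) (h2 : ∀ i, 𝔼 c, v i c ^ 2 = τ i)
    (hτ : ∑ i, τ i ≤ 1) :
    𝔼 a, (tilt v 1 a - tilt v (-1) a - 2 * ∑ i, v i (a i)) ^ 2 ≤ 2 * (∑ i, τ i) ^ 2 := by
  have e : ∀ a, (tilt v 1 a - tilt v (-1) a - 2 * ∑ i, v i (a i)) ^ 2 =
      (tilt v 1 a - tilt v (-1) a) ^ 2 - 4 * ∑ i, (v i (a i) * tilt v 1 a) +
        4 * ∑ i, (v i (a i) * tilt v (-1) a) + 4 * (∑ i, 1 * v i (a i)) ^ 2 := by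
    intro a
    simp only [← Finset.sum_mul, one_mul]
    ring
  simp only [e, expect_add_distrib, expect_sub_distrib, ← mul_expect, expect_sum_comm,
    expect_mul_tilt h0 h2, expect_sum_sq h0 h2]
  have := expect_tilt_sub_sq h0 h2 hτ
  simp only [one_mul, one_pow, neg_mul, sum_neg_distrib]
  linarith

theorem expect_mul_tilt_sub_le (h0 : ∀ i, 𝔼 c, v i c = 0) (h2 : ∀ i, 𝔼 c, v i c ^ 2 = τ i)
    (hτ : ∑ i, τ i ≤ 1) (f : (ι → β) → ℝ) (hf : ∀ a, |f a| ≤ 1) :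
    𝔼 a, f a * (tilt v 1 a - tilt v (-1) a) ≤ 3 * √(∑ i, τ i) := by
  have hτ0 : 0 ≤ ∑ i, τ i := sum_nonneg fun i _ => h2 i ▸ expect_nonneg fun c _ => sq_nonneg _
  refine (expect_mul_le_sqrt f _ hf (B := 3 ^ 2 * ∑ i, τ i) ?_).trans_eq ?_
  · refine (expect_tilt_sub_sq h0 h2 hτ).trans ?_
    nlinarith
  · rw [Real.sqrt_mul (by norm_num), Real.sqrt_sq (by norm_num)]

/-- The coefficients `s i` are replaced by `1`, the case just treated; the resulting error is linear
in the `v i` and is controlled by orthogonality. -/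
theorem expect_mul_tilt_sub_sub_le (h0 : ∀ i, 𝔼 c, v i c = 0) (h2 : ∀ i, 𝔼 c, v i c ^ 2 = τ i)
    (hτ : ∑ i, τ i ≤ 1) (s : ι → ℝ) {U : ℝ} (hs : ∀ i, |1 - s i| ≤ U)
    (f : (ι → β) → ℝ) (hf : ∀ a, |f a| ≤ 1) :
    𝔼 a, f a * (tilt v 1 a - tilt v (-1) a - 2 * ∑ i, s i * v i (a i)) ≤
      2 * ∑ i, τ i + 2 * U * √(∑ i, τ i) := by
  have hτi : ∀ i, 0 ≤ τ i := fun i => h2 i ▸ expect_nonneg fun c _ => sq_nonneg _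
  have hτ0 : 0 ≤ ∑ i, τ i := sum_nonneg fun i _ => hτi i
  rcases isEmpty_or_nonempty ι with hι | ⟨⟨i₀⟩⟩
  · simp [tilt]
  have hU : 0 ≤ U := (abs_nonneg _).trans (hs i₀)
  have e : ∀ a, f a * (tilt v 1 a - tilt v (-1) a - 2 * ∑ i, s i * v i (a i)) =
      f a * (tilt v 1 a - tilt v (-1) a - 2 * ∑ i, v i (a i)) +
        2 * (f a * ∑ i, (1 - s i) * v i (a i)) := by
    intro a
    simp only [sub_mul, one_mul, sum_sub_distrib]
    ring
  simp only [e, expect_add_distrib, ← mul_expect]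
  have h3 := expect_mul_le_sqrt f _ hf (expect_tilt_sub_sub_sq h0 h2 hτ)
  have h4 := expect_mul_le_sqrt f _ hf (expect_sum_sq h0 h2 fun i => 1 - s i).le
  have h5 : √(2 * (∑ i, τ i) ^ 2) ≤ 2 * ∑ i, τ i := by
    refine Real.sqrt_le_iff.2 ⟨by positivity, ?_⟩
    nlinarith [sq_nonneg (∑ i, τ i)]
  have h6 : √(∑ i, (1 - s i) ^ 2 * τ i) ≤ U * √(∑ i, τ i) := by
    rw [← Real.sqrt_sq hU, ← Real.sqrt_mul (sq_nonneg _), Finset.mul_sum]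
    refine Real.sqrt_le_sqrt (sum_le_sum fun i _ => mul_le_mul_of_nonneg_right ?_ (hτi i))
    rw [sq_le_sq, abs_of_nonneg hU]
    exact hs i
  linarith

end ProductSpace

/-! ### Random restrictions of unate functions -/

namespace Restriction

open Finset ProductSpace
open scoped BigOperators

/-- A bit as a sign. -/
def sgn (c : Bool) : ℝ := if c then 1 else -1

@[simp] theorem sgn_true : sgn true = 1 := rfl
@[simp] theorem sgn_false : sgn false = -1 := rfl

theorem sgn_mul_self (c : Bool) : sgn c * sgn c = 1 := by cases c <;> simp

theorem expect_bool (g : Bool → ℝ) : 𝔼 c, g c = (g true + g false) / 2 := by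
  rw [Fintype.expect_eq_sum_div_card, Fintype.sum_bool]
  simp

variable {ι J : Type}

/-- Overwrite the bit at position `p i` of block `i` by `z i`. -/
def plant [DecidableEq J] (p : ι → J) (a : ι → J → Bool) (z : ι → Bool) : ι → J → Bool := fun i =>
  Function.update (a i) (p i) (z i)

variable [Fintype ι] [DecidableEq ι] [Fintype J] [DecidableEq J]

theorem plant_plant (p : ι → J) (a : ι → J → Bool) (z : ι → Bool) :
    plant p (plant p a z) (fun i => a i (p i)) = a := by
  funext i
  simp [plant]

/-- Exchanging the planted bits with the overwritten ones. -/
def exchange (p : ι → J) : (ι → J → Bool) × (ι → Bool) ≃ (ι → J → Bool) × (ι → Bool) where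
  toFun x := (plant p x.1 x.2, fun i => x.1 i (p i))
  invFun x := (plant p x.1 x.2, fun i => x.1 i (p i))
  left_inv x := by
    refine Prod.ext (plant_plant p x.1 x.2) ?_
    funext i
    simp [plant]
  right_inv x := by
    refine Prod.ext (plant_plant p x.1 x.2) ?_
    funext i
    simp [plant]

/-- Overwriting positions of a uniform string by uniform bits gives a uniform string: exchanging the
old bits with the new ones is a bijection. -/
theorem expect_plant (p : ι → J) (H : (ι → J → Bool) → ℝ) :
    𝔼 a, 𝔼 z, H (plant p a z) = 𝔼 a, H a := by
  have h1 := expect_product (univ : Finset (ι → J → Bool)) (univ : Finset (ι → Bool))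
    fun x => H (plant p x.1 x.2)
  have h2 := expect_product (univ : Finset (ι → J → Bool)) (univ : Finset (ι → Bool))
    fun x => H x.1
  simp only [Fintype.expect_const, univ_product_univ] at h1 h2
  rw [← h1, ← h2]
  exact Fintype.expect_equiv (exchange p) _ _ fun _ => rfl

/-- The indicator of `f a = 1`. -/
def ind (c : Bool) : ℝ := if c then 1 else 0

@[simp] theorem ind_true : ind true = 1 := rfl
@[simp] theorem ind_false : ind false = 0 := rfl

theorem abs_ind_le (c : Bool) : |ind c| ≤ 1 := by cases c <;> simp

/-- `f` is unate, with orientation `σ`. -/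
def Unate (σ : ι → J → ℝ) (f : (ι → J → Bool) → Bool) : Prop :=
  (∀ i j, σ i j = 0 ∨ σ i j = 1 ∨ σ i j = -1) ∧
  ∀ a a', (∀ i j, σ i j * sgn (a i j) ≤ σ i j * sgn (a' i j)) → f a = true → f a' = true

/-- The planted bits pushing a function with orientation `σ` up (`ε = 1`) or down (`ε = -1`). -/
noncomputable def corner (σ : ι → J → ℝ) (ε : ℝ) (p : ι → J) : ι → Bool := fun i =>
  decide (0 < ε * σ i (p i))

variable {σ : ι → J → ℝ} {f : (ι → J → Bool) → Bool}

theorem Unate.congr (h : Unate σ f) {a a' : ι → J → Bool} (ha : ∀ i j, σ i j = 0 ∨ a i j = a' i j) :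
    f a = f a' := by
  have h1 : ∀ i j, σ i j * sgn (a i j) = σ i j * sgn (a' i j) := by
    intro i j
    rcases ha i j with h0 | h0 <;> simp [h0]
  rw [Bool.eq_iff_iff]
  exact ⟨h.2 a a' fun i j => (h1 i j).le, h.2 a' a fun i j => (h1 i j).ge⟩

theorem plant_apply_eq {p : ι → J} {a : ι → J → Bool} {z z' : ι → Bool} {P : ι → J → Prop}
    (h : ∀ i, P i (p i) ∨ z i = z' i) (i : ι) (j : J) :
    P i j ∨ plant p a z i j = plant p a z' i j := by
  by_cases hj : j = p i
  · subst hj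
    simpa [plant] using h i
  · simp [plant, hj]

/-- The product is a probability density in `z`. It vanishes unless `z` agrees with the corner in
every block whose planted position is wired, and in the other blocks `f` ignores the planted bit. -/
theorem expect_ind_mul_prod (h : Unate σ f) {ε : ℝ} (hε : ε = 1 ∨ ε = -1) (p : ι → J)
    (a : ι → J → Bool) :
    𝔼 z, ind (f (plant p a z)) * ∏ i, (1 + ε * (σ i (p i) * sgn (z i))) =
      ind (f (plant p a (corner σ ε p))) := by
  have h1 : ∀ z : ι → Bool, ind (f (plant p a z)) * ∏ i, (1 + ε * (σ i (p i) * sgn (z i))) =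
      ind (f (plant p a (corner σ ε p))) * ∏ i, (1 + ε * (σ i (p i) * sgn (z i))) := by
    intro z
    by_cases hz : ∀ i, σ i (p i) = 0 ∨ z i = corner σ ε p i
    · rw [h.congr (plant_apply_eq (P := fun i j => σ i j = 0) hz)]
    · push Not at hz
      obtain ⟨i, hi, hi'⟩ := hz
      have : ∏ i, (1 + ε * (σ i (p i) * sgn (z i))) = 0 := by
        refine Finset.prod_eq_zero (mem_univ i) ?_
        rcases (h.1 i (p i)).resolve_left hi with hs | hs <;> rcases hε with rfl | rfl <;>
          cases hzi : z i <;> simp_all [corner]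
      rw [this, mul_zero, mul_zero]
  simp only [h1, ← mul_expect]
  rw [expect_prod fun i c => 1 + ε * (σ i (p i) * sgn c), Finset.prod_eq_one, mul_one]
  intro i _
  rw [expect_bool, sgn_true, sgn_false]
  ring

/-- Change of measure: a string with a planted corner is a uniform string reweighted by the product
density. Exchanging the expectations moves the average over positions onto the density alone,
independently of `f`. -/
theorem expect_ind_corner [Nonempty J] (h : Unate σ f) {ε : ℝ} (hε : ε = 1 ∨ ε = -1)
    (r : (ι → J) → ℝ) :
    𝔼 p, 𝔼 a, r p * ind (f (plant p a (corner σ ε p))) =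
      𝔼 a, ind (f a) * 𝔼 p, r p * ∏ i, (1 + ε * (σ i (p i) * sgn (a i (p i)))) := by
  simp only [mul_expect]
  rw [expect_comm univ univ (fun a p => ind (f a) *
    (r p * ∏ i, (1 + ε * (σ i (p i) * sgn (a i (p i))))))]
  refine expect_congr rfl fun p _ => ?_
  rw [← expect_plant p fun a => ind (f a) *
    (r p * ∏ i, (1 + ε * (σ i (p i) * sgn (a i (p i)))))]
  refine expect_congr rfl fun a _ => ?_
  rw [← expect_ind_mul_prod h hε, mul_expect]
  refine expect_congr rfl fun z _ => ?_
  simp only [plant, Function.update_self]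
  ring

/-- The number of blocks in which the planted position matters. -/
noncomputable def live (σ : ι → J → ℝ) (p : ι → J) : ℕ := (univ.filter fun i => σ i (p i) ≠ 0).card

/-- At least two planted bits are wired to `f`, and the restricted function is not constant. -/
def Bad (σ : ι → J → ℝ) (f : (ι → J → Bool) → Bool) (p : ι → J) (a : ι → J → Bool) : Prop :=
  2 ≤ live σ p ∧ ∃ z z', f (plant p a z) ≠ f (plant p a z')

theorem Unate.corner_le (h : Unate σ f) (p : ι → J) (a : ι → J → Bool) (z : ι → Bool) :
    (f (plant p a z) = true → f (plant p a (corner σ 1 p)) = true) ∧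
      (f (plant p a (corner σ (-1) p)) = true → f (plant p a z) = true) := by
  constructor <;> refine h.2 _ _ fun i j => ?_ <;> by_cases hj : j = p i
  · subst hj
    rcases h.1 i (p i) with hs | hs | hs <;> simp only [plant, corner, hs, Function.update_self] <;> cases z i <;>
      norm_num
  · simp [plant, hj]
  · subst hj
    rcases h.1 i (p i) with hs | hs | hs <;> simp only [plant, corner, hs, Function.update_self] <;> cases z i <;>
      norm_num
  · simp [plant, hj]

-- By unateness all restricted values lie between those at the two corners, so a nonconstant
-- restriction has value one at the upper corner and zero at the lower corner.
open Classical in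
theorem Unate.bad_le (h : Unate σ f) (p : ι → J) (a : ι → J → Bool) :
    (if Bad σ f p a then 1 else 0 : ℝ) ≤ (if 2 ≤ live σ p then 1 else 0) *
      ind (f (plant p a (corner σ 1 p))) -
        (if 2 ≤ live σ p then 1 else 0) * ind (f (plant p a (corner σ (-1) p))) := by
  have h1 := h.corner_le p a
  by_cases hl : 2 ≤ live σ p
  · by_cases hb : ∃ z z', f (plant p a z) ≠ f (plant p a z')
    · rw [if_pos ⟨hl, hb⟩, if_pos hl]
      obtain ⟨z, z', hz⟩ := hb
      have e1 : f (plant p a (corner σ 1 p)) = true := by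
        cases hz1 : f (plant p a z)
        · cases hz2 : f (plant p a z')
          · simp [hz1, hz2] at hz
          · exact (h1 z').1 hz2
        · exact (h1 z).1 hz1
      have e2 : f (plant p a (corner σ (-1) p)) = false := by
        by_contra hc
        rw [Bool.not_eq_false] at hc
        exact hz (((h1 z).2 hc).trans ((h1 z').2 hc).symm)
      simp [e1, e2]
    · have hc : ¬ Bad σ f p a := fun hc => hb hc.2
      push Not at hb
      rw [if_neg hc, hb (corner σ 1 p) (corner σ (-1) p), sub_self]
  · have hc : ¬ Bad σ f p a := fun hc => hl hc.1
    simp [hc, hl]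

/-- Discarding the configurations with at most one live block is the same as subtracting those with
exactly one: without live blocks the difference is zero, and with only block `i` live it is `2 * s
i`. The factors `1 - s j ^ 2` say that the other blocks are not live. -/
theorem prod_sub_prod_of_live {s : ι → ℝ} (hs : ∀ i, s i = 0 ∨ s i = 1 ∨ s i = -1) :
    (if 2 ≤ (univ.filter fun i => s i ≠ 0).card then 1 else 0 : ℝ) * ∏ i, (1 + 1 * s i) -
      (if 2 ≤ (univ.filter fun i => s i ≠ 0).card then 1 else 0 : ℝ) * ∏ i, (1 + (-1) * s i) =
    ∏ i, (1 + 1 * s i) - ∏ i, (1 + (-1) * s i) -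
      2 * ∑ i, ∏ j, (if j = i then s j else 1 - s j ^ 2) := by
  by_cases h0 : ∀ i, s i = 0
  · have : ∀ i : ι, (∏ j, if j = i then (0 : ℝ) else 1 - 0 ^ 2) = 0 := fun i =>
      Finset.prod_eq_zero (mem_univ i) (by simp)
    simp [h0]
  push Not at h0
  obtain ⟨i, hi⟩ := h0
  by_cases h1 : ∀ j ≠ i, s j = 0
  · have hcard : (univ.filter fun i => s i ≠ 0).card = 1 := by
      rw [Finset.card_eq_one]
      refine ⟨i, ?_⟩
      ext j
      simp only [mem_filter, mem_univ, true_and, mem_singleton]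
      exact ⟨fun hj => by_contra fun hc => hj (h1 j hc), fun hj => hj ▸ hi⟩
    have hprod : ∀ ε : ℝ, ∏ j, (1 + ε * s j) = 1 + ε * s i := fun ε =>
      Finset.prod_eq_single i (fun j _ hj => by simp [h1 j hj]) (by simp)
    have hsum : ∑ l, ∏ j, (if j = l then s j else 1 - s j ^ 2) = s i := by
      rw [Finset.sum_eq_single i, Finset.prod_eq_single i]
      · simp
      · intro j _ hj
        simp [hj, h1 j hj]
      · simp
      · intro l _ hl
        exact Finset.prod_eq_zero (mem_univ l) (by simp [h1 l hl])
      · simp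
    rw [hcard, hprod, hprod, hsum]
    norm_num
    ring
  · push Not at h1
    obtain ⟨j, hj, hj'⟩ := h1
    have hcard : 2 ≤ (univ.filter fun i => s i ≠ 0).card := by
      rw [← Finset.card_pair hj]
      refine card_le_card fun l hl => ?_
      simp only [mem_insert, mem_singleton] at hl
      rcases hl with rfl | rfl <;> simpa
    have hsq : ∀ l, s l ≠ 0 → 1 - s l ^ 2 = 0 := by
      intro l hl
      rcases (hs l).resolve_left hl with h | h <;> simp [h]
    have hsum : ∑ l, ∏ j, (if j = l then s j else 1 - s j ^ 2) = 0 := by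
      refine Finset.sum_eq_zero fun l _ => ?_
      by_cases hl : i = l
      · refine Finset.prod_eq_zero (mem_univ j) ?_
        rw [if_neg (by rwa [← hl]), hsq j hj']
      · refine Finset.prod_eq_zero (mem_univ i) ?_
        rw [if_neg hl, hsq i hi]
    rw [if_pos hcard, hsum]
    ring

/-- The weight of a block: the number of its positions wired to `f`, as a fraction. -/
noncomputable def blockDensity (σ : ι → J → ℝ) (i : ι) : ℝ := 𝔼 j, σ i j ^ 2

/-- The normalized sum of the oriented bits of a block. -/
noncomputable def blockMean (σ : ι → J → ℝ) (i : ι) (c : J → Bool) : ℝ := 𝔼 j, σ i j * sgn (c j)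

theorem expect_blockMean (i : ι) : 𝔼 c, blockMean σ i c = 0 := by
  simp only [blockMean]
  rw [expect_comm]
  refine expect_eq_zero fun j _ => ?_
  rw [expect_apply j fun c => σ i j * sgn c, expect_bool]
  simp

/-- Averaging independent signs over a block gains the factor `1 / card J` in the variance; summed
over blocks, this gives the wiring divided by `card J ^ 2`. -/
theorem expect_blockMean_sq [Nonempty J] (i : ι) :
    𝔼 c, blockMean σ i c ^ 2 = blockDensity σ i / Fintype.card J := by
  have h := expect_sum_sq (ι := J) (β := Bool) (v := fun _ c => sgn c) (τ := fun _ => 1)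
    (fun _ => by rw [expect_bool, sgn_true, sgn_false]; ring)
    (fun _ => by rw [expect_bool, sgn_true, sgn_false]; ring) (σ i)
  have e : ∀ c, blockMean σ i c = (∑ j, σ i j * sgn (c j)) / Fintype.card J := fun c =>
    Fintype.expect_eq_sum_div_card _
  simp only [e, div_pow, ← expect_div, h, blockDensity, mul_one]
  rw [Fintype.expect_eq_sum_div_card, sq, div_div]

/-- The positions in different blocks are chosen independently, so the average of the product is the
product of the averages. -/
theorem expect_prod_eq_tilt [Nonempty J] (ε : ℝ) (a : ι → J → Bool) :
    𝔼 p : ι → J, ∏ i, (1 + ε * (σ i (p i) * sgn (a i (p i)))) = tilt (blockMean σ) ε a := by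
  rw [expect_prod fun i j => 1 + ε * (σ i j * sgn (a i j)), tilt]
  refine Finset.prod_congr rfl fun i _ => ?_
  rw [expect_add_distrib, ← mul_expect, Fintype.expect_const, blockMean]

/-- The coefficient of `blockMean σ i` is the probability that no block other than `i` is live; it
arises from averaging the correction term of `prod_sub_prod_of_live` over the positions. -/
theorem expect_bad_eq [Nonempty J] (h : Unate σ f) :
    𝔼 p, 𝔼 a, ((if 2 ≤ live σ p then 1 else 0 : ℝ) * ind (f (plant p a (corner σ 1 p))) -
        (if 2 ≤ live σ p then 1 else 0) * ind (f (plant p a (corner σ (-1) p)))) =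
      𝔼 a, ind (f a) * (tilt (blockMean σ) 1 a - tilt (blockMean σ) (-1) a -
        2 * ∑ i, (∏ j ∈ univ.erase i, (1 - blockDensity σ j)) * blockMean σ i (a i)) := by
  simp only [expect_sub_distrib]
  rw [expect_ind_corner h (Or.inl rfl) fun p => if 2 ≤ live σ p then 1 else 0,
    expect_ind_corner h (Or.inr rfl) fun p => if 2 ≤ live σ p then 1 else 0, ← expect_sub_distrib]
  refine expect_congr rfl fun a _ => ?_
  rw [← mul_sub, ← expect_sub_distrib]
  congr 1
  have hlive : ∀ p : ι → J, live σ p =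
      (univ.filter fun i => σ i (p i) * sgn (a i (p i)) ≠ 0).card := by
    intro p
    rw [live]
    congr 1
    ext i
    have : sgn (a i (p i)) ≠ 0 := by cases a i (p i) <;> simp
    simp [this]
  have hs : ∀ (p : ι → J) i, σ i (p i) * sgn (a i (p i)) = 0 ∨ σ i (p i) * sgn (a i (p i)) = 1 ∨
      σ i (p i) * sgn (a i (p i)) = -1 := by
    intro p i
    rcases h.1 i (p i) with hs | hs | hs <;> cases a i (p i) <;> simp [hs]
  simp only [hlive]
  rw [expect_congr rfl fun p _ => prod_sub_prod_of_live (hs p)]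
  simp only [expect_sub_distrib, expect_prod_eq_tilt, ← mul_expect, expect_sum_comm]
  congr 2
  refine Finset.sum_congr rfl fun i _ => ?_
  rw [expect_prod fun l j => if l = i then σ l j * sgn (a l j) else 1 - (σ l j * sgn (a l j)) ^ 2,
    ← Finset.mul_prod_erase _ _ (mem_univ i), mul_comm]
  congr 1
  · refine Finset.prod_congr rfl fun l hl => ?_
    simp only [Finset.ne_of_mem_erase hl, if_false]
    rw [expect_sub_distrib, Fintype.expect_const, blockDensity]
    congr 1
    refine expect_congr rfl fun j _ => ?_
    rw [mul_pow, sq (sgn _), sgn_mul_self, mul_one]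
  · simp [blockMean]

theorem ite_live_mem (p : ι → J) : 0 ≤ (if 2 ≤ live σ p then 1 else 0 : ℝ) ∧
    (if 2 ≤ live σ p then 1 else 0 : ℝ) ≤ 1 := by
  split_ifs <;> simp

theorem Unate.corner_sub_nonneg (h : Unate σ f) (p : ι → J) (a : ι → J → Bool) :
    0 ≤ ind (f (plant p a (corner σ 1 p))) - ind (f (plant p a (corner σ (-1) p))) := by
  have := (h.corner_le p a (corner σ (-1) p)).1
  cases h1 : f (plant p a (corner σ (-1) p)) <;> cases h2 : f (plant p a (corner σ 1 p)) <;>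
    simp_all

theorem expect_corner_eq [Nonempty J] (h : Unate σ f) :
    𝔼 p, 𝔼 a, (ind (f (plant p a (corner σ 1 p))) - ind (f (plant p a (corner σ (-1) p)))) =
      𝔼 a, ind (f a) * (tilt (blockMean σ) 1 a - tilt (blockMean σ) (-1) a) := by
  have h1 := expect_ind_corner h (Or.inl rfl) fun _ => 1
  have h2 := expect_ind_corner h (Or.inr rfl) fun _ => 1
  have e : ∀ g : (ι → J) → ℝ, 𝔼 p, 1 * g p = 𝔼 p, g p := by simp
  simp only [e, expect_prod_eq_tilt] at h1 h2
  simp only [one_mul] at h1 h2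
  simp only [expect_sub_distrib, h1, h2, mul_sub]

/-- The number of positions wired to a function with orientation `σ`. -/
def wiring (σ : ι → J → ℝ) : ℝ := ∑ i, ∑ j, σ i j ^ 2

theorem wiring_nonneg : 0 ≤ wiring σ := sum_nonneg fun _ _ => sum_nonneg fun _ _ => sq_nonneg _

theorem sum_blockDensity : ∑ i, blockDensity σ i = wiring σ / Fintype.card J := by
  simp only [blockDensity, wiring, Fintype.expect_eq_sum_div_card, Finset.sum_div]

theorem Unate.blockDensity_le_one [Nonempty J] (h : Unate σ f) (i : ι) : blockDensity σ i ≤ 1 :=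
  expect_le univ_nonempty fun j _ => by rcases h.1 i j with hs | hs | hs <;> simp [hs]

theorem blockDensity_nonneg (i : ι) : 0 ≤ blockDensity σ i := expect_nonneg fun _ _ => sq_nonneg _

open Classical in
theorem expect_bad_le_one (σ : ι → J → ℝ) (f : (ι → J → Bool) → Bool) [Nonempty J] :
    𝔼 p, 𝔼 a, (if Bad σ f p a then 1 else 0 : ℝ) ≤ 1 :=
  expect_le univ_nonempty fun p _ => expect_le univ_nonempty fun a _ => by split_ifs <;> simp

-- The total variance of the block means is `wiring σ / card J ^ 2`, and Cauchy–Schwarz applies when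
-- it is at most one. Otherwise the claimed bound exceeds one. The requirement of two live blocks is
-- not used here.
open Classical in
theorem Unate.expect_bad_le_sqrt [Nonempty J] (h : Unate σ f) :
    𝔼 p, 𝔼 a, (if Bad σ f p a then 1 else 0 : ℝ) ≤ 3 * √(wiring σ) / Fintype.card J := by
  have hJ : (0 : ℝ) < Fintype.card J := by exact_mod_cast Fintype.card_pos
  have hτ : ∑ i, blockDensity σ i / Fintype.card J = wiring σ / (Fintype.card J : ℝ) ^ 2 := by
    rw [← Finset.sum_div, sum_blockDensity, div_div, sq]
  rcases le_total (wiring σ) ((Fintype.card J : ℝ) ^ 2) with hw | hw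
  · have h1 := expect_mul_tilt_sub_le (v := blockMean σ) expect_blockMean expect_blockMean_sq
      (by rw [hτ]; exact div_le_one_of_le₀ hw (by positivity)) (fun a => ind (f a))
      fun a => abs_ind_le _
    rw [← expect_corner_eq h, hτ, Real.sqrt_div wiring_nonneg, Real.sqrt_sq hJ.le,
      ← mul_div_assoc] at h1
    refine le_trans (expect_le_expect fun p _ => expect_le_expect fun a _ => ?_) h1
    refine (h.bad_le p a).trans ?_
    rw [← mul_sub]
    exact mul_le_of_le_one_left (h.corner_sub_nonneg p a) (ite_live_mem p).2
  · refine (expect_bad_le_one σ f).trans ?_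
    rw [le_div_iff₀ hJ, one_mul]
    have := Real.sqrt_le_sqrt hw
    rw [Real.sqrt_sq hJ.le] at this
    linarith

-- Requiring two live blocks removes the linear term of the tilts, up to coefficients within `U = w
-- / b` of one. The remainder `2 * w / b ^ 2 + 2 * (w / b) * (√w / b)` is at most the claim if `w ≤
-- b`, and for `w ≥ b` the square root bound is already good enough.
open Classical in
theorem Unate.expect_bad_le [Nonempty J] (h : Unate σ f) :
    𝔼 p, 𝔼 a, (if Bad σ f p a then 1 else 0 : ℝ) ≤
      4 * wiring σ / (Fintype.card J * √(Fintype.card J)) := by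
  have hJ1 : (1 : ℝ) ≤ Fintype.card J := by exact_mod_cast Fintype.card_pos
  set b := (Fintype.card J : ℝ) with hb
  have hJ : 0 < b := by linarith
  have hsb : 0 < √b := Real.sqrt_pos.2 hJ
  have hss : √b * √b = b := Real.mul_self_sqrt hJ.le
  set w := wiring σ with hw'
  have hw0 : 0 ≤ w := wiring_nonneg
  have hww : √w * √w = w := Real.mul_self_sqrt hw0
  have hsw : 0 ≤ √w := Real.sqrt_nonneg _
  rcases le_total w b with hw | hw
  · have hτ : ∑ i, blockDensity σ i / b = w / b ^ 2 := by
      rw [← Finset.sum_div, sum_blockDensity, div_div, sq]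
    have hwb : w ≤ b ^ 2 := by nlinarith
    have h1 := expect_mul_tilt_sub_sub_le (v := blockMean σ) expect_blockMean expect_blockMean_sq
      (by rw [hτ]; exact div_le_one_of_le₀ hwb (by positivity))
      (fun i => ∏ j ∈ univ.erase i, (1 - blockDensity σ j)) (U := w / b) (fun i => ?_)
      (fun a => ind (f a)) fun a => abs_ind_le _
    · rw [← expect_bad_eq h, hτ, Real.sqrt_div hw0, Real.sqrt_sq hJ.le] at h1
      refine le_trans (expect_le_expect fun p _ => expect_le_expect fun a _ => h.bad_le p a)
        (h1.trans ?_)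
      have hswb : √w ≤ √b := Real.sqrt_le_sqrt hw
      have e1 : w / b ^ 2 ≤ w / (b * √b) := by
        refine div_le_div_of_nonneg_left hw0 (by positivity) ?_
        nlinarith
      have e2 : w / b * (√w / b) ≤ w / (b * √b) := by
        rw [div_mul_div_comm, div_le_div_iff₀ (by positivity) (by positivity)]
        have := mul_le_mul_of_nonneg_left hswb (by positivity : 0 ≤ w * b * √b)
        calc w * √w * (b * √b) = w * b * √b * √w := by ring
          _ ≤ w * b * √b * √b := this
          _ = w * (b * b) := by rw [mul_assoc (w * b), hss]; ring
      have e3 : 4 * w / (b * √b) = 4 * (w / (b * √b)) := by ring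
      rw [e3]
      linarith
    · have hp := one_sub_sum_le_prod (univ.erase i) (blockDensity σ)
        (fun j _ => blockDensity_nonneg j) fun j _ => h.blockDensity_le_one j
      have hs : ∑ j ∈ univ.erase i, blockDensity σ j ≤ w / b := by
        rw [← sum_blockDensity]
        exact sum_le_sum_of_subset_of_nonneg (erase_subset _ _) fun j _ _ => blockDensity_nonneg j
      have hp1 : ∏ j ∈ univ.erase i, (1 - blockDensity σ j) ≤ 1 :=
        prod_le_one (fun j _ => sub_nonneg.2 (h.blockDensity_le_one j))
          fun j _ => sub_le_self _ (blockDensity_nonneg j)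
      rw [abs_of_nonneg (by linarith)]
      linarith
  · refine h.expect_bad_le_sqrt.trans ?_
    rw [← hb, ← hw', div_le_div_iff₀ hJ (by positivity)]
    have hswb : √b ≤ √w := Real.sqrt_le_sqrt hw
    have := mul_le_mul_of_nonneg_left hswb (by positivity : 0 ≤ √w * b)
    calc 3 * √w * (b * √b) = 3 * (√w * b * √b) := by ring
      _ ≤ 3 * (√w * b * √w) := by linarith
      _ = 3 * w * b := by rw [mul_right_comm, hww]; ring
      _ ≤ 4 * w * b := by nlinarith [mul_nonneg hw0 hJ.le]

end Restriction

/-! ### Counting threshold functions -/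

namespace Threshold

open Finset

variable {Ω D : Type} [Fintype D]

/-- `g` is a linear threshold function of the real features `φ`. -/
def IsThreshold (φ : Ω → D → ℝ) (g : Ω → Bool) : Prop :=
  ∃ (α : D → ℝ) (θ : ℝ), ∀ ω, g ω = decide (θ ≤ ∑ d, α d * φ ω d)

/-- Affine dependence of more than `dim + 1` points. -/
theorem exists_affine_relation (φ : Ω → D → ℝ) (S : Finset Ω) (hS : Fintype.card D + 1 < S.card) :
    ∃ c : Ω → ℝ, ∑ ω ∈ S, c ω = 0 ∧ (∀ d, ∑ ω ∈ S, c ω * φ ω d = 0) ∧ ∃ ω ∈ S, c ω < 0 := by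
  classical
  have hdep : ¬ LinearIndependent ℝ fun ω : S => fun o : Option D => o.elim 1 (φ ω) := by
    intro h
    have := h.fintype_card_le_finrank
    simp at this
    omega
  rw [Fintype.not_linearIndependent_iff] at hdep
  obtain ⟨c, hc, ω₀, hω₀⟩ := hdep
  have hsum : ∀ u : Ω → ℝ, ∑ ω ∈ S, (if h : ω ∈ S then c ⟨ω, h⟩ else 0) * u ω =
      ∑ ω : S, c ω * u ω := by
    intro u
    rw [← Finset.sum_coe_sort]
    simp
  have h1 : ∑ ω : S, c ω * 1 = 0 := by
    have := congrFun hc none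
    simpa [Finset.sum_apply] using this
  have h2 : ∀ d, ∑ ω : S, c ω * φ ω d = 0 := by
    intro d
    have := congrFun hc (some d)
    simpa [Finset.sum_apply] using this
  refine ⟨fun ω => if h : ω ∈ S then c ⟨ω, h⟩ else 0, ?_, fun d => ?_, ?_⟩
  · have := (hsum fun _ => 1).trans h1
    simpa only [mul_one] using this
  · exact (hsum fun ω => φ ω d).trans (h2 d)
  -- Nonnegative coefficients with sum zero would all vanish.
  · by_contra! hneg
    have hnn : ∀ ω ∈ (univ : Finset S), 0 ≤ c ω := by
      intro ω _
      have := hneg ω ω.2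
      simpa using this
    simp only [mul_one] at h1
    exact hω₀ ((sum_eq_zero_iff_of_nonneg hnn).1 h1 ω₀ (mem_univ _))

theorem sum_choose_le (N d : ℕ) : ∑ i ∈ Iic d, N.choose i ≤ (N + 1) ^ d := by
  rw [add_pow, Nat.range_eq_Icc_zero_sub_one _ (by omega)]
  have : Iic d = Icc 0 (d + 1 - 1) := by ext; simp
  rw [this]
  refine sum_le_sum fun i hi => ?_
  simp only [mem_Icc] at hi
  have h1 : 1 ≤ d.choose i := Nat.choose_pos (by omega)
  calc N.choose i ≤ N ^ i := Nat.choose_le_pow _ _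
    _ ≤ N ^ i * 1 ^ (d - i) * d.choose i := by
      rw [one_pow, mul_one]
      exact Nat.le_mul_of_pos_right _ h1

open Classical in
/-- There are few linear threshold functions of a small number of features. -/
theorem card_isThreshold [Fintype Ω] [DecidableEq Ω] (φ : Ω → D → ℝ) :
    (univ.filter fun g : Ω → Bool => IsThreshold φ g).card ≤
      (Fintype.card Ω + 1) ^ (Fintype.card D + 1) := by
  set 𝒜 : Finset (Finset Ω) := (univ.filter fun g : Ω → Bool => IsThreshold φ g).image
    fun g => univ.filter fun ω => g ω = true with h𝒜
  have hcard : 𝒜.card = (univ.filter fun g : Ω → Bool => IsThreshold φ g).card := by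
    refine card_image_of_injective _ fun g g' h => ?_
    funext ω
    have := Finset.ext_iff.1 h ω
    simp only [mem_filter, mem_univ, true_and] at this
    exact Bool.eq_iff_iff.2 this
  have hvc : 𝒜.vcDim ≤ Fintype.card D + 1 := by
    refine Finset.sup_le fun S hS => ?_
    by_contra! hlt
    rw [mem_shatterer] at hS
    obtain ⟨c, hc0, hc, ω₀, hω₀, hneg⟩ := exists_affine_relation φ S hlt
    -- Shattering provides a threshold function that is one exactly where the coefficient is
    -- positive. Then every term of the affine relation is nonnegative, and the one at `ω₀` is
    -- positive because the side below the threshold is strict.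
    obtain ⟨u, hu, hSu⟩ := hS (filter_subset (fun ω => 0 < c ω) S)
    rw [h𝒜, mem_image] at hu
    obtain ⟨g, hg, rfl⟩ := hu
    obtain ⟨α, θ, hαθ⟩ := (mem_filter.1 hg).2
    have hiff : ∀ ω ∈ S, (θ ≤ ∑ d, α d * φ ω d ↔ 0 < c ω) := by
      intro ω hω
      have := Finset.ext_iff.1 hSu ω
      simpa [hω, hαθ] using this
    have hzero : ∑ ω ∈ S, c ω * ((∑ d, α d * φ ω d) - θ) = 0 := by
      simp only [mul_sub, sum_sub_distrib, ← Finset.sum_mul, hc0, Finset.mul_sum]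
      rw [Finset.sum_comm, zero_mul, sub_zero]
      refine Finset.sum_eq_zero fun d _ => ?_
      rw [← mul_zero (α d), ← hc d, Finset.mul_sum]
      exact Finset.sum_congr rfl fun ω _ => by ring
    have hpos : 0 < ∑ ω ∈ S, c ω * ((∑ d, α d * φ ω d) - θ) := by
      refine sum_pos' (fun ω hω => ?_) ⟨ω₀, hω₀, ?_⟩
      · by_cases h : 0 < c ω
        · exact mul_nonneg h.le (sub_nonneg.2 ((hiff ω hω).2 h))
        · have := mt (hiff ω hω).1 h
          exact mul_nonneg_of_nonpos_of_nonpos (not_lt.1 h) (by linarith [not_le.1 this])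
      · have := mt (hiff ω₀ hω₀).1 hneg.not_gt
        exact mul_pos_of_neg_of_neg hneg (by linarith [not_le.1 this])
    exact hpos.ne' hzero
  rw [← hcard]
  calc 𝒜.card ≤ 𝒜.shatterer.card := card_le_card_shatterer 𝒜
    _ ≤ ∑ i ∈ Iic 𝒜.vcDim, (Fintype.card Ω).choose i := card_shatterer_le_sum_vcDim
    _ ≤ (Fintype.card Ω + 1) ^ 𝒜.vcDim := sum_choose_le _ _
    _ ≤ _ := Nat.pow_le_pow_right (Nat.succ_pos _) hvc

theorem isThreshold_true (φ : Ω → D → ℝ) : IsThreshold φ fun _ => true :=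
  ⟨0, 0, by simp⟩

/-- Threshold functions of the features `φ` and of `t` threshold functions of `φ`. -/
def IsDepthTwo (φ : Ω → D → ℝ) (t : ℕ) (g : Ω → Bool) : Prop :=
  ∃ h : Fin t → Ω → Bool, (∀ l, IsThreshold φ (h l)) ∧
    IsThreshold (fun ω => Sum.elim (φ ω) fun l => if h l ω then 1 else 0) g

-- Choose the `t` inner functions, and then a threshold function of the enlarged list of features;
-- the second count depends only on the number of features, not on the choice.
open Classical in
theorem card_isDepthTwo [Fintype Ω] [DecidableEq Ω] (φ : Ω → D → ℝ) (t : ℕ) :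
    (univ.filter fun g : Ω → Bool => IsDepthTwo φ t g).card ≤
      (Fintype.card Ω + 1) ^ ((Fintype.card D + 1) * t + (Fintype.card D + t + 1)) := by
  calc (univ.filter fun g : Ω → Bool => IsDepthTwo φ t g).card
      ≤ ((Fintype.piFinset fun _ : Fin t => univ.filter fun g : Ω → Bool => IsThreshold φ g).biUnion
          fun h => univ.filter fun g : Ω → Bool =>
            IsThreshold (fun ω => Sum.elim (φ ω) fun l => if h l ω then 1 else 0) g).card := by
        refine card_le_card fun g hg => ?_
        obtain ⟨h, hh, hg⟩ := (mem_filter.1 hg).2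
        exact mem_biUnion.2 ⟨h, by simpa using hh, by simpa using hg⟩
    _ ≤ (Fintype.piFinset fun _ : Fin t => univ.filter fun g : Ω → Bool => IsThreshold φ g).card *
          (Fintype.card Ω + 1) ^ (Fintype.card D + t + 1) := by
        refine card_biUnion_le_card_mul _ _ _ fun h _ => (card_isThreshold _).trans ?_
        simp
    _ ≤ _ := by
        rw [pow_add _ ((Fintype.card D + 1) * t), pow_mul, Fintype.card_piFinset_const]
        gcongr
        exact card_isThreshold φ

/-- A threshold function of the features and of few threshold functions has depth two. -/
theorem isDepthTwo_of_sum (φ : Ω → D → ℝ) {L : Type} [Fintype L] (t : ℕ) (hL : Fintype.card L ≤ t)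
    (h : L → Ω → Bool) (hh : ∀ l, IsThreshold φ (h l)) (g : Ω → Bool) (α : D → ℝ) (β : L → ℝ)
    (θ : ℝ) (hg : ∀ ω, g ω =
      decide (θ ≤ ∑ d, α d * φ ω d + ∑ l, β l * if h l ω then 1 else 0)) :
    IsDepthTwo φ t g := by
  classical
  obtain ⟨e⟩ := Function.Embedding.nonempty_of_card_le (α := L) (β := Fin t) (by simpa using hL)
  -- Unused slots receive the constant function `true` with weight zero.
  refine ⟨Function.extend e h fun _ _ => true, fun l => ?_,
    Sum.elim α (Function.extend e β 0), θ, fun ω => ?_⟩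
  · by_cases hl : ∃ l', e l' = l
    · obtain ⟨l', rfl⟩ := hl
      rw [e.injective.extend_apply]
      exact hh l'
    · rw [Function.extend_apply' _ _ _ hl]
      exact isThreshold_true φ
  · rw [hg, Fintype.sum_sum_type]
    simp only [Sum.elim_inl, Sum.elim_inr]
    congr 3
    refine Fintype.sum_of_injective e e.injective _ _ (fun l hl => ?_) fun l => ?_
    · rw [Function.extend_apply' _ _ _ (by simpa using hl)]
      simp
    · rw [e.injective.extend_apply, e.injective.extend_apply]

theorem IsThreshold.isDepthTwo {φ : Ω → D → ℝ} {g : Ω → Bool} (hg : IsThreshold φ g) (t : ℕ) :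
    IsDepthTwo φ t g := by
  obtain ⟨α, θ, hg⟩ := hg
  exact isDepthTwo_of_sum φ (L := Empty) t (by simp) (fun l => l.elim) (fun l => l.elim) g α
    (fun l => l.elim) θ (by simpa using hg)

/-- Few almost orthogonal sign vectors correlate with a given sign vector. -/
theorem card_mul_sq_le_two [Fintype Ω] {X : Type} (S : Finset X) (F : X → Ω → ℝ) (g : Ω → ℝ)
    {γ η : ℝ} (hγ : 0 < γ) (hη : η ≤ γ ^ 2 / 2) (hη0 : 0 ≤ η) (hm : 0 < Fintype.card Ω)
    (hF : ∀ x ω, F x ω ^ 2 = 1) (hg : ∀ ω, g ω ^ 2 = 1)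
    (horth : ∀ x ∈ S, ∀ y ∈ S, x ≠ y → ∑ ω, F x ω * F y ω ≤ η * Fintype.card Ω)
    (hcorr : ∀ x ∈ S, γ * Fintype.card Ω ≤ ∑ ω, g ω * F x ω) : S.card * γ ^ 2 ≤ 2 := by
  classical
  set m : ℝ := (Fintype.card Ω : ℝ) with hm'
  have hm0 : 0 < m := Nat.cast_pos.2 hm
  set s : ℝ := (S.card : ℝ) with hs
  have hs0 : 0 ≤ s := Nat.cast_nonneg _
  -- The sum of the correlations is at least `s * γ * m`. By Cauchy–Schwarz and almost orthogonality
  -- its square is at most `m * (s * m + s ^ 2 * η * m)`, and `η ≤ γ ^ 2 / 2` lets the last term be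
  -- absorbed.
  have h1 : s * (γ * m) ≤ ∑ ω, g ω * ∑ x ∈ S, F x ω := by
    simp only [Finset.mul_sum]
    rw [Finset.sum_comm, hs, ← nsmul_eq_mul]
    exact card_nsmul_le_sum _ _ _ hcorr
  have h2 : (∑ ω, g ω * ∑ x ∈ S, F x ω) ^ 2 ≤ m * ∑ ω, (∑ x ∈ S, F x ω) ^ 2 := by
    refine (sum_mul_sq_le_sq_mul_sq _ _ _).trans_eq ?_
    simp [hg, hm']
  have h3 : ∑ ω, (∑ x ∈ S, F x ω) ^ 2 ≤ s * m + s ^ 2 * (η * m) := by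
    simp only [sq, Finset.sum_mul_sum]
    rw [Finset.sum_comm]
    calc ∑ x ∈ S, ∑ ω, ∑ y ∈ S, F x ω * F y ω ≤ ∑ x ∈ S, (m + s * (η * m)) := by
          refine sum_le_sum fun x hx => ?_
          rw [Finset.sum_comm, ← Finset.add_sum_erase _ _ hx]
          have e1 : ∑ ω, F x ω * F x ω = m := by
            simp only [← sq, hF]
            simp [hm']
          have e2 : ∑ y ∈ S.erase x, ∑ ω, F x ω * F y ω ≤ s * (η * m) := by
            calc _ ≤ ∑ y ∈ S.erase x, η * m := sum_le_sum fun y hy =>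
                  horth x hx y (mem_of_mem_erase hy) (ne_of_mem_erase hy).symm
              _ ≤ ∑ y ∈ S, η * m := sum_le_sum_of_subset_of_nonneg (erase_subset _ _)
                  fun _ _ _ => by positivity
              _ = s * (η * m) := by simp [hs]
          linarith
      _ = s * m + s * s * (η * m) := by
          rw [sum_const, nsmul_eq_mul]
          ring
  have h4 : (s * (γ * m)) ^ 2 ≤ m * (s * m + s ^ 2 * (η * m)) :=
    (pow_le_pow_left₀ (by positivity) h1 2).trans (h2.trans (mul_le_mul_of_nonneg_left h3 hm0.le))
  have h5 : s ^ 2 * γ ^ 2 ≤ s + s ^ 2 * η := by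
    have e : (s ^ 2 * γ ^ 2) * m ^ 2 ≤ (s + s ^ 2 * η) * m ^ 2 := by nlinarith
    exact le_of_mul_le_mul_right e (by positivity)
  have h6 : s ^ 2 * η ≤ s ^ 2 * (γ ^ 2 / 2) := mul_le_mul_of_nonneg_left hη (sq_nonneg _)
  rcases hs0.eq_or_lt with h0 | hpos
  · rw [← h0]; norm_num
  · refine le_of_mul_le_mul_left ?_ hpos
    nlinarith

end Threshold

/-! ### Majorities of few depth-two functions do not compute a small-biased family -/

namespace Correlation

open Finset Threshold Restriction HardProgram

variable {n k : ℕ}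

/-- The bits of the codeword of `x`, with positions read through `e`. -/
def codeBit (A : Matrix (Fin (2 ^ k)) (Fin n) (ZMod 2)) (e : (Fin k → Bool) ≃ Fin (2 ^ k))
    (x : Fin n → Bool) (z : Fin k → Bool) : Bool :=
  decide (A.mulVec (fun j => bitF2 (x j)) (e z) = 1)

variable {A : Matrix (Fin (2 ^ k)) (Fin n) (ZMod 2)} {δ : ℝ}

theorem SmallBiased.le_card (hA : SmallBiased A δ) (v : Fin n → ZMod 2) (hv : v ≠ 0) :
    (1 / 2 - δ) * 2 ^ k ≤ ((univ.filter fun r => A.mulVec v r ≠ 0).card : ℝ) := by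
  have := (abs_le.1 (hA v hv)).1
  push_cast at this
  rw [← le_div_iff₀ (by positivity)]
  linarith

theorem card_codeBit_ne (e : (Fin k → Bool) ≃ Fin (2 ^ k)) (x y : Fin n → Bool) :
    (univ.filter fun z => codeBit A e x z ≠ codeBit A e y z).card =
      (univ.filter fun r => A.mulVec (fun j => bitF2 (x j) - bitF2 (y j)) r ≠ 0).card := by
  have h : ∀ u v : ZMod 2, decide (u = 1) ≠ decide (v = 1) ↔ u - v ≠ 0 := by decide
  refine card_equiv e fun z => ?_
  have hsub : A.mulVec (fun j => bitF2 (x j) - bitF2 (y j)) =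
      A.mulVec (fun j => bitF2 (x j)) - A.mulVec (fun j => bitF2 (y j)) := A.mulVec_sub _ _
  simp only [codeBit, mem_filter, mem_univ, true_and, hsub, Pi.sub_apply, h]

/-- The difference of two codewords is the codeword of a nonzero vector, so they disagree on almost
half of the positions. -/
theorem sum_codeBit_mul_le (hA : SmallBiased A δ) (e : (Fin k → Bool) ≃ Fin (2 ^ k))
    {x y : Fin n → Bool} (hxy : x ≠ y) :
    ∑ z, sgn (codeBit A e x z) * sgn (codeBit A e y z) ≤ 2 * δ * 2 ^ k := by
  have hv : (fun j => bitF2 (x j) - bitF2 (y j)) ≠ 0 := fun h => hxy <| funext fun j =>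
    bitF2_injective (sub_eq_zero.1 (congrFun h j))
  have h1 := SmallBiased.le_card hA _ hv
  rw [← card_codeBit_ne e] at h1
  have h2 : ∀ c d : Bool, sgn c * sgn d = 1 - 2 * (if c ≠ d then 1 else 0) := by
    intro c d
    cases c <;> cases d <;> norm_num
  simp only [h2, sum_sub_distrib, ← Finset.mul_sum, ← Finset.natCast_card_filter]
  simp only [sum_const, card_univ, Fintype.card_fun, Fintype.card_bool, Fintype.card_fin, nsmul_eq_mul]
  push_cast
  linarith

theorem le_card_codeBit_eq_false (hA : SmallBiased A δ) (hδ : δ ≤ 1 / 4)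
    (e : (Fin k → Bool) ≃ Fin (2 ^ k)) {x : Fin n → Bool} (hx : x ≠ fun _ => false) :
    (2 ^ k / 4 : ℝ) ≤ ((univ.filter fun z => codeBit A e x z = false).card : ℝ) := by
  have hv : (fun j => bitF2 (x j)) ≠ 0 := fun h => hx <| funext fun j =>
    bitF2_injective (congrFun h j)
  have h1 := (abs_le.1 (hA _ hv)).2
  have h2 : (univ.filter fun z => ¬ codeBit A e x z = false).card =
      (univ.filter fun r => A.mulVec (fun j => bitF2 (x j)) r ≠ 0).card := by
    have h := card_codeBit_ne (A := A) e x fun _ => false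
    have h0 : ∀ z, codeBit A e (fun _ => false) z = false := by
      intro z
      have : (fun j : Fin n => bitF2 false) = 0 := rfl
      rw [codeBit, this, Matrix.mulVec_zero]
      simp
    simpa [h0] using h
  rw [← h2] at h1
  have h3 := card_filter_add_card_filter_not (s := (univ : Finset (Fin k → Bool)))
    fun z => codeBit A e x z = false
  have h4 : ((univ.filter fun z => codeBit A e x z = false).card : ℝ) +
      (univ.filter fun z => ¬ codeBit A e x z = false).card = 2 ^ k := by
    rw [← Nat.cast_add, h3]
    simp
  push_cast at h1
  have h5 : ((univ.filter fun z => ¬ codeBit A e x z = false).card : ℝ) ≤ 3 / 4 * 2 ^ k := by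
    rw [← div_le_iff₀ (by positivity)]
    linarith
  linarith

/-- A tie counts as one, so the inputs agree with the output by a strict margin only where the
output is zero. This is why the zeros of codewords have to be counted. -/
theorem majority_mul_sgn {κ : Type} (T : Finset κ) (y : κ → Bool) :
    (if majority T y = false then 1 else 0 : ℝ) ≤ ∑ i ∈ T, sgn (y i) * sgn (majority T y) := by
  have h1 : ∑ i ∈ T, sgn (y i) = 2 * ((T.filter fun i => y i = true).card : ℝ) - T.card := by
    have : ∀ c : Bool, sgn c = 2 * (if c = true then 1 else 0) - 1 := by
      intro c
      cases c <;> norm_num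
    simp only [this, sum_sub_distrib, ← Finset.mul_sum, ← Finset.natCast_card_filter]
    simp
  rw [← Finset.sum_mul, h1]
  cases h : majority T y
  · have h2 : ¬ T.card ≤ 2 * (T.filter fun i => y i = true).card := by simpa [majority] using h
    have h3 : (2 * ((T.filter fun i => y i = true).card : ℝ)) + 1 ≤ T.card := by
      exact_mod_cast not_le.1 h2
    simp only [if_true, sgn_false]
    linarith
  · have h2 : T.card ≤ 2 * (T.filter fun i => y i = true).card := by simpa [majority] using h
    have h3 : (T.card : ℝ) ≤ 2 * ((T.filter fun i => y i = true).card : ℝ) := by exact_mod_cast h2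
    simp only [sgn_true, Bool.true_eq_false, if_false]
    linarith

/-- If a majority of few functions computes a codeword, one of them correlates with it. -/
theorem exists_correlated (hA : SmallBiased A δ) (hδ : δ ≤ 1 / 4)
    (e : (Fin k → Bool) ≃ Fin (2 ^ k)) {x : Fin n → Bool} (hx : x ≠ fun _ => false)
    {κ : Type} (T : Finset κ) {M : ℕ} (hT : T.card ≤ M) (hM : 0 < M)
    (G : κ → (Fin k → Bool) → Bool)
    (hG : ∀ z, majority T (fun i => G i z) = codeBit A e x z) :
    ∃ i ∈ T, 1 / (4 * M : ℝ) * 2 ^ k ≤ ∑ z, sgn (G i z) * sgn (codeBit A e x z) := by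
  -- A quarter of the positions are zeros, each with a margin of at least one, and no position
  -- contributes negatively; averaging over the at most `M` inputs gives `1 / (4 * M)`.
  have h1 : (2 ^ k / 4 : ℝ) ≤ ∑ i ∈ T, ∑ z, sgn (G i z) * sgn (codeBit A e x z) := by
    refine (le_card_codeBit_eq_false hA hδ e hx).trans ?_
    rw [Finset.sum_comm, Finset.natCast_card_filter]
    refine sum_le_sum fun z _ => ?_
    have := majority_mul_sgn T fun i => G i z
    rwa [hG z] at this
  have hM' : (0 : ℝ) < M := Nat.cast_pos.2 hM
  by_contra! hlt
  rcases T.eq_empty_or_nonempty with rfl | hne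
  · rw [sum_empty] at h1
    have : (0 : ℝ) < 2 ^ k / 4 := by positivity
    linarith
  · have h2 := sum_lt_sum_of_nonempty hne hlt
    rw [sum_const, nsmul_eq_mul] at h2
    have h3 : (T.card : ℝ) * (1 / (4 * M) * 2 ^ k) ≤ M * (1 / (4 * M) * 2 ^ k) := by
      gcongr
    have h4 : (M : ℝ) * (1 / (4 * M) * 2 ^ k) = 2 ^ k / 4 := by
      field_simp
    linarith

/-- The bits of `z` as real features. -/
def bitFeatures (z : Fin k → Bool) (i : Fin k) : ℝ := ind (z i)

/-- Only few codewords are computed by majorities of few depth-two threshold functions. -/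
theorem card_le_of_majority (hA : SmallBiased A δ) (hδ0 : 0 ≤ δ) (e : (Fin k → Bool) ≃ Fin (2 ^ k))
    {κ : Type} (T : Finset κ) {M : ℕ} (hT : T.card ≤ M) (hM : 0 < M)
    (hδM : 64 * M ^ 2 * δ ≤ 1) (t : ℕ) (S : Finset (Fin n → Bool))
    (hS : ∀ x ∈ S, x ≠ fun _ => false) (G : (Fin n → Bool) → κ → (Fin k → Bool) → Bool)
    (hG : ∀ x ∈ S, ∀ z, majority T (fun i => G x i z) = codeBit A e x z)
    (hGt : ∀ x ∈ S, ∀ i, IsDepthTwo bitFeatures t (G x i)) :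
    S.card ≤ (2 ^ k + 1) ^ ((k + 1) * t + (k + t + 1)) * (32 * M ^ 2) := by
  classical
  have hM1 : (1 : ℝ) ≤ M := Nat.one_le_cast.2 hM
  have hδ : δ ≤ 1 / 4 := by nlinarith
  calc S.card ≤ ((univ.filter fun g : (Fin k → Bool) → Bool =>
        IsDepthTwo bitFeatures t g).biUnion fun g => S.filter fun x =>
          1 / (4 * M : ℝ) * 2 ^ k ≤ ∑ z, sgn (g z) * sgn (codeBit A e x z)).card := by
        refine card_le_card fun x hx => ?_
        obtain ⟨i, _, hi⟩ := exists_correlated hA hδ e (hS x hx) T hT hM (G x) (hG x hx)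
        exact mem_biUnion.2 ⟨G x i, by simpa using hGt x hx i, mem_filter.2 ⟨hx, hi⟩⟩
    _ ≤ (univ.filter fun g : (Fin k → Bool) → Bool => IsDepthTwo bitFeatures t g).card *
          (32 * M ^ 2) := by
        refine card_biUnion_le_card_mul _ _ _ fun g _ => ?_
        have hcard : (Fintype.card (Fin k → Bool) : ℝ) = 2 ^ k := by simp
        have hsq : ∀ c : Bool, sgn c ^ 2 = 1 := fun c => by rw [sq, sgn_mul_self]
        -- Correlation `γ = 1 / (4 * M)` and inner products at most `2 * δ`, whence at most `2 / γ ^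
        -- 2 = 32 * M ^ 2` codewords per function.
        have h := card_mul_sq_le_two (S.filter fun x =>
          1 / (4 * M : ℝ) * 2 ^ k ≤ ∑ z, sgn (g z) * sgn (codeBit A e x z))
          (fun x z => sgn (codeBit A e x z)) (fun z => sgn (g z)) (γ := 1 / (4 * M))
          (η := 2 * δ) (by positivity) ?_ (by positivity) Fintype.card_pos
          (fun _ _ => hsq _) (fun _ => hsq _) ?_ ?_
        · have h' : ((S.filter fun x => 1 / (4 * M : ℝ) * 2 ^ k ≤
              ∑ z, sgn (g z) * sgn (codeBit A e x z)).card : ℝ) ≤ 32 * M ^ 2 := by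
            rw [div_pow, mul_div_assoc', div_le_iff₀ (by positivity)] at h
            nlinarith
          exact_mod_cast h'
        · rw [div_pow, div_div, le_div_iff₀ (by positivity)]
          nlinarith
        · intro x _ y _ hxy
          rw [hcard]
          exact sum_codeBit_mul_le hA e hxy
        · intro x hx
          rw [hcard]
          exact (mem_filter.1 hx).2
    _ ≤ _ := by
        refine Nat.mul_le_mul_right _ ?_
        have h := card_isDepthTwo (bitFeatures (k := k)) t
        rwa [Fintype.card_fun, Fintype.card_bool, Fintype.card_fin] at h

end Correlation

/-! ### Restricting a circuit -/

namespace CircuitRestriction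

open Finset Threshold Restriction HardProgram Correlation

section Affine

variable {ι : Type} [Fintype ι]

/-- Real functions of `z` that are affine in the bits of `z`. -/
def IsAffine (g : (ι → Bool) → ℝ) : Prop :=
  ∃ (α : ι → ℝ) (β : ℝ), ∀ z, g z = β + ∑ i, α i * ind (z i)

theorem isAffine_const (c : ℝ) : IsAffine fun _ : ι → Bool => c := ⟨0, c, by simp⟩

theorem isAffine_ind (i : ι) : IsAffine fun z : ι → Bool => ind (z i) := by
  classical
  exact ⟨Pi.single i 1, 0, fun z => by simp [Pi.single_apply]⟩

theorem IsAffine.add {g g' : (ι → Bool) → ℝ} (h : IsAffine g) (h' : IsAffine g') :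
    IsAffine fun z => g z + g' z := by
  obtain ⟨α, β, h⟩ := h
  obtain ⟨α', β', h'⟩ := h'
  refine ⟨α + α', β + β', fun z => ?_⟩
  simp only [h, h', Pi.add_apply, add_mul, sum_add_distrib]
  ring

theorem IsAffine.const_mul {g : (ι → Bool) → ℝ} (c : ℝ) (h : IsAffine g) :
    IsAffine fun z => c * g z := by
  obtain ⟨α, β, h⟩ := h
  refine ⟨fun i => c * α i, c * β, fun z => ?_⟩
  simp only [h, mul_add, Finset.mul_sum, mul_assoc]

theorem IsAffine.sum {κ : Type} (s : Finset κ) {g : κ → (ι → Bool) → ℝ}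
    (h : ∀ l ∈ s, IsAffine (g l)) : IsAffine fun z => ∑ l ∈ s, g l z := by
  classical
  induction s using Finset.induction_on with
  | empty => simpa using isAffine_const 0
  | insert l s hl ih =>
    simp only [Finset.sum_insert hl]
    exact (h l (mem_insert_self _ _)).add (ih fun j hj => h j (mem_insert_of_mem hj))

end Affine

variable {k : ℕ}

theorem isThreshold_of_isAffine {g : (Fin k → Bool) → ℝ} (h : IsAffine g) (θ : ℝ) :
    IsThreshold bitFeatures fun z => decide (θ ≤ g z) := by
  obtain ⟨α, β, h⟩ := h
  refine ⟨α, θ - β, fun z => ?_⟩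
  simp only [h, decide_eq_decide, sub_le_iff_le_add']
  rfl

theorem isDepthTwo_of_isAffine {g : (Fin k → Bool) → ℝ} (h : IsAffine g) (θ : ℝ) {L : Type}
    (s : Finset L) {t : ℕ} (hs : s.card ≤ t) (β : L → ℝ) (y : L → (Fin k → Bool) → Bool)
    (hy : ∀ l, IsThreshold bitFeatures (y l)) :
    IsDepthTwo bitFeatures t fun z => decide (θ ≤ g z + ∑ l ∈ s, β l * ind (y l z)) := by
  obtain ⟨α, γ, h⟩ := h
  refine isDepthTwo_of_sum bitFeatures (L := s) t (by simpa using hs) (fun l => y l)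
    (fun l => hy l) _ α (fun l => β l) (θ - γ) fun z => ?_
  rw [h, decide_eq_decide, sub_le_iff_le_add', ← Finset.sum_coe_sort s, add_assoc]
  rfl

section Embedding

variable {n b : ℕ} (h : k * b ≤ n)

/-- The `j`-th position of the `i`-th block. -/
def position (ij : Fin k × Fin b) : Fin n := Fin.castLE h (finProdFinEquiv ij)

theorem position_injective : Function.Injective (position h) :=
  (Fin.castLE_injective h).comp finProdFinEquiv.injective

theorem position_val (i : Fin k) (j : Fin b) : (position h (i, j) : ℕ) = j + b * i := rfl

/-- The string with the given blocks, padded by zeros. -/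
noncomputable def embed (c : Fin k → Fin b → Bool) : Fin n → Bool :=
  Function.extend (position h) (fun ij => c ij.1 ij.2) fun _ => false

theorem embed_position (c : Fin k → Fin b → Bool) (ij : Fin k × Fin b) :
    embed h c (position h ij) = c ij.1 ij.2 :=
  (position_injective h).extend_apply _ _ _

theorem embed_of_notMem_range (c : Fin k → Fin b → Bool) {m : Fin n}
    (hm : m ∉ Set.range (position h)) : embed h c m = false :=
  Function.extend_apply' _ _ _ (by simpa using hm)

theorem blockParity_embed (c : Fin k → Fin b → Bool) (i : Fin k) :
    blockParity b (embed h c) i = decide (∑ j, bitF2 (c i j) = 1) := by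
  rw [blockParity]
  congr 2
  symm
  refine Finset.sum_bij (fun j _ => position h (i, j)) ?_ ?_ ?_ ?_
  · intro j _
    simp only [mem_filter, mem_univ, true_and, position_val, mul_add, mul_one]
    have := j.2
    omega
  · intro j _ j' _ hj
    simpa using position_injective h hj
  · intro m hm
    simp only [mem_filter, mem_univ, true_and, mul_add, mul_one] at hm
    refine ⟨⟨m - b * i, by omega⟩, mem_univ _, Fin.ext ?_⟩
    rw [position_val]
    simp only
    omega
  · intro j _
    rw [embed_position]

/-- The parities of the blocks, apart from the planted bits. -/
def restParity (p : Fin k → Fin b) (a : Fin k → Fin b → Bool) (i : Fin k) : Bool :=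
  decide (∑ j ∈ univ.erase (p i), bitF2 (a i j) = 1)

/-- One free bit in every block suffices to control all address bits, up to a flip that the
restriction fixes. -/
theorem blockParity_embed_plant (p : Fin k → Fin b) (a : Fin k → Fin b → Bool) (z : Fin k → Bool)
    (i : Fin k) : blockParity b (embed h (plant p a z)) i = xor (z i) (restParity p a i) := by
  have hx : ∀ (c : Bool) (u : ZMod 2), decide (bitF2 c + u = 1) = xor c (decide (u = 1)) := by
    decide
  rw [blockParity_embed, ← Finset.add_sum_erase _ _ (mem_univ (p i)), restParity, ← hx]
  congr 3
  · simp [plant]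
  · refine Finset.sum_congr rfl fun j hj => ?_
    simp [plant, ne_of_mem_erase hj]

theorem isAffine_ind_plant (p : Fin k → Fin b) (a : Fin k → Fin b → Bool) (i : Fin k) (j : Fin b) :
    IsAffine fun z => ind (plant p a z i j) := by
  by_cases hj : j = p i
  · subst hj
    simpa [plant] using isAffine_ind i
  · simpa [plant, hj] using isAffine_const (ind (a i j))

theorem isAffine_ind_embed (p : Fin k → Fin b) (a : Fin k → Fin b → Bool) (m : Fin n) :
    IsAffine fun z => ind (embed h (plant p a z) m) := by
  by_cases hm : m ∈ Set.range (position h)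
  · obtain ⟨ij, rfl⟩ := hm
    simp only [embed_position]
    exact isAffine_ind_plant p a _ _
  · simp only [embed_of_notMem_range h _ hm]
    exact isAffine_const _

theorem isAffine_ind_input (x : Fin n → Bool) (p : Fin k → Fin b) (a : Fin k → Fin b → Bool)
    (m : Fin n ⊕ Fin n) : IsAffine fun z => ind (Sum.elim x (embed h (plant p a z)) m) := by
  rcases m with m | m
  · exact isAffine_const (ind (x m))
  · exact isAffine_ind_embed h p a m

variable (g : LTFGate (Fin n ⊕ Fin n))

/-- The orientation of a gate in the bits of the blocks. -/
noncomputable def orientation (i : Fin k) (j : Fin b) : ℝ :=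
  (SignType.sign (g.weight (Sum.inr (position h (i, j)))) : ℝ)

/-- The gate as a function of the bits of the blocks. -/
noncomputable def blockGate (x : Fin n → Bool) (c : Fin k → Fin b → Bool) : Bool :=
  g.eval (Sum.elim x (embed h c))

theorem sum_embed (w : Fin n → ℝ) (c : Fin k → Fin b → Bool) :
    ∑ m, w m * ind (embed h c m) = ∑ ij : Fin k × Fin b, w (position h ij) * ind (c ij.1 ij.2) := by
  symm
  refine Fintype.sum_of_injective _ (position_injective h) _ _ (fun m hm => ?_) fun ij => ?_
  · simp [embed_of_notMem_range h c hm]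
  · rw [embed_position]

theorem blockGate_eq (x : Fin n → Bool) (c : Fin k → Fin b → Bool) :
    blockGate h g x c = decide (g.threshold ≤ ∑ m, g.weight (Sum.inl m) * ind (x m) +
      ∑ ij : Fin k × Fin b, g.weight (Sum.inr (position h ij)) * ind (c ij.1 ij.2)) := by
  rw [← sum_embed h fun m => g.weight (Sum.inr m), blockGate, LTFGate.eval, Fintype.sum_sum_type]
  rfl

/-- Moving bits in the direction of the signs of their weights can only increase the linear form. -/
theorem unate_blockGate (x : Fin n → Bool) : Unate (orientation h g) (blockGate h g x) := by
  constructor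
  · intro i j
    rcases lt_trichotomy (g.weight (Sum.inr (position h (i, j)))) 0 with hw | hw | hw <;>
      simp [orientation, hw]
  · intro a a' haa
    rw [blockGate_eq, blockGate_eq, decide_eq_true_iff, decide_eq_true_iff]
    refine fun hle => hle.trans (add_le_add le_rfl (sum_le_sum fun ij _ => ?_))
    have := haa ij.1 ij.2
    rcases lt_trichotomy (g.weight (Sum.inr (position h ij))) 0 with hw | hw | hw
    · cases ha : a ij.1 ij.2 <;> cases ha' : a' ij.1 ij.2 <;>
        simp [orientation, hw, ha, ha', hw.le] at this ⊢
      norm_num at this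
    · simp [hw]
    · cases ha : a ij.1 ij.2 <;> cases ha' : a' ij.1 ij.2 <;>
        simp [orientation, hw, ha, ha', hw.le] at this ⊢
      norm_num at this

theorem wiring_eq : wiring (orientation h g) =
    ((univ.filter fun ij : Fin k × Fin b => g.weight (Sum.inr (position h ij)) ≠ 0).card : ℝ) := by
  rw [wiring, ← Fintype.sum_prod_type', natCast_card_filter]
  refine sum_congr rfl fun ij _ => ?_
  rcases lt_trichotomy (g.weight (Sum.inr (position h ij))) 0 with hw | hw | hw <;>
    simp [orientation, hw, ne_of_lt, ne_of_gt]

theorem wiring_le_wires : wiring (orientation h g) ≤ g.wires := by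
  rw [wiring_eq, LTFGate.wires, Nat.cast_le]
  refine card_le_card_of_injOn (fun ij => Sum.inr (position h ij)) (fun ij hij => ?_)
    (Sum.inr_injective.comp (position_injective h)).injOn
  simpa using hij

theorem wiring_le : wiring (orientation h g) ≤ n := by
  rw [wiring_eq, Nat.cast_le]
  refine (card_le_univ _).trans ?_
  simpa using h

theorem isThreshold_blockGate (x : Fin n → Bool) (p : Fin k → Fin b) (a : Fin k → Fin b → Bool) :
    IsThreshold bitFeatures fun z => blockGate h g x (plant p a z) :=
  isThreshold_of_isAffine (IsAffine.sum univ fun m _ =>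
    (isAffine_ind_input h x p a m).const_mul (g.weight m)) g.threshold

end Embedding

/-- Either the restriction is constant, or a single planted bit is wired and the gate is a function
of this bit alone. Both are affine in `z` as real functions, so a middle gate can absorb them into
its linear form. -/
theorem isAffine_of_not_bad {b : ℕ} {σ : Fin k → Fin b → ℝ} {f : (Fin k → Fin b → Bool) → Bool}
    (hf : Unate σ f) {p : Fin k → Fin b} {a : Fin k → Fin b → Bool} (hb : ¬ Bad σ f p a) :
    IsAffine fun z => ind (f (plant p a z)) := by
  by_cases hc : ∃ z z', f (plant p a z) ≠ f (plant p a z')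
  · have hl : live σ p ≤ 1 := by
      by_contra hl
      exact hb ⟨by omega, hc⟩
    obtain ⟨z₀, z₁, hz⟩ := hc
    obtain ⟨i, hi⟩ : ∃ i, σ i (p i) ≠ 0 := by
      by_contra! hi
      exact hz (hf.congr (plant_apply_eq (P := fun i j => σ i j = 0) fun i => Or.inl (hi i)))
    have huniq : ∀ j, σ j (p j) = 0 ∨ j = i := by
      intro j
      by_contra! hj
      exact hj.2 (Finset.card_le_one.1 hl j (by simpa using hj.1) i (by simpa using hi))
    have hval : ∀ z, f (plant p a z) = f (plant p a fun _ => z i) := fun z =>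
      hf.congr (plant_apply_eq (P := fun i j => σ i j = 0) fun j => (huniq j).imp_right fun h => by
        rw [h])
    have hform : (fun z => ind (f (plant p a z))) = fun z => ind (f (plant p a fun _ => false)) +
        (ind (f (plant p a fun _ => true)) - ind (f (plant p a fun _ => false))) * ind (z i) := by
      funext z
      rw [hval z]
      cases z i <;> simp
    rw [hform]
    exact (isAffine_const _).add ((isAffine_ind i).const_mul _)
  · push Not at hc
    have : (fun z => ind (f (plant p a z))) = fun _ => ind (f (plant p a fun _ => false)) := by
      funext z
      rw [hc z]
    rw [this]
    exact isAffine_const _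

section Circuit

variable {n b : ℕ} (h : k * b ≤ n) (C : MajLtfLtf (Fin n ⊕ Fin n))

open Classical in
/-- The bottom gates that are still complicated after the restriction. -/
noncomputable def badGates (x : Fin n → Bool) (p : Fin k → Fin b) (a : Fin k → Fin b → Bool) :
    Finset (Fin C.numBottom) :=
  univ.filter fun l => Bad (orientation h (C.bottom l)) (blockGate h (C.bottom l) x) p a

/-- After the restriction every source of the output gate is a threshold function of the bits and
of few threshold functions. -/
theorem isDepthTwo_middleVal {x : Fin n → Bool} {p : Fin k → Fin b} {a : Fin k → Fin b → Bool}
    {t : ℕ} (ht : (badGates h C x p a).card ≤ t) (s : ((Fin n ⊕ Fin n) ⊕ Fin C.numBottom) ⊕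
      Fin C.numMiddle) :
    IsDepthTwo bitFeatures t fun z => C.middleVal (Sum.elim x (embed h (plant p a z))) s := by
  rcases s with (m | l) | i
  · have hd : (fun z => C.middleVal (Sum.elim x (embed h (plant p a z))) (Sum.inl (Sum.inl m))) =
        fun z => decide (1 ≤ ind (Sum.elim x (embed h (plant p a z)) m)) := by
      funext z
      have : ∀ c, c = decide (1 ≤ ind c) := by
        intro c
        cases c <;> norm_num
      exact this _
    rw [hd]
    exact (isThreshold_of_isAffine (isAffine_ind_input h x p a m) 1).isDepthTwo t
  · exact (isThreshold_blockGate h (C.bottom l) x p a).isDepthTwo t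
  · set g := C.middle i with hg
    have hsum : (fun z => C.middleVal (Sum.elim x (embed h (plant p a z))) (Sum.inr i)) = fun z =>
        decide (g.threshold ≤ (∑ m, g.weight (Sum.inl m) *
          ind (Sum.elim x (embed h (plant p a z)) m) +
          ∑ l ∈ univ \ badGates h C x p a, g.weight (Sum.inr l) *
            ind (blockGate h (C.bottom l) x (plant p a z))) +
          ∑ l ∈ badGates h C x p a, g.weight (Sum.inr l) *
            ind (blockGate h (C.bottom l) x (plant p a z))) := by
      funext z
      rw [add_assoc, Finset.sum_sdiff (subset_univ _)]
      change g.eval _ = _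
      rw [LTFGate.eval, Fintype.sum_sum_type]
      rfl
    rw [hsum]
    refine isDepthTwo_of_isAffine (IsAffine.add ?_ ?_) _ _ ht _ _ fun l =>
      isThreshold_blockGate h (C.bottom l) x p a
    · exact IsAffine.sum _ fun m _ => (isAffine_ind_input h x p a m).const_mul _
    · refine IsAffine.sum _ fun l hl => IsAffine.const_mul _ ?_
      refine isAffine_of_not_bad (unate_blockGate h (C.bottom l) x) ?_
      simpa [badGates] using hl

end Circuit

end CircuitRestriction

/-! ### The lower bound -/

namespace LowerBound

open Finset Threshold Restriction HardProgram Correlation CircuitRestriction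
open scoped BigOperators

theorem positionEquiv_symm_apply {k : ℕ} (z : Fin k → Bool) :
    (positionEquiv k).symm z = finFunctionFinEquiv fun i => if z i then 1 else 0 := by
  rw [Equiv.symm_apply_eq, positionEquiv_apply]
  funext i
  rw [Equiv.symm_apply_apply]
  cases z i <;> simp

/-- Positions read through the restricted block parities. -/
def shiftedPosition {k : ℕ} (q : Fin k → Bool) : (Fin k → Bool) ≃ Fin (2 ^ k) :=
  (Function.Involutive.toPerm (fun z i => xor (z i) (q i)) fun z => by funext i; simp).trans
    (positionEquiv k).symm

/-- The restricted parities are `z` shifted by a fixed vector. The shift permutes the positions of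
the codeword, and small bias does not depend on their order. -/
theorem hardB_embed_plant {n k : ℕ} (h : k * (n / k) ≤ n)
    (A : Matrix (Fin (2 ^ k)) (Fin n) (ZMod 2)) (x : Fin n → Bool) (p : Fin k → Fin (n / k))
    (a : Fin k → Fin (n / k) → Bool) (z : Fin k → Bool) :
    hardB A x (embed h (plant p a z)) = codeBit A (shiftedPosition (restParity p a)) x z := by
  simp only [hardB, hardF, multiplexer, codeBit, shiftedPosition, Equiv.trans_apply,
    positionEquiv_symm_apply, blockParity_embed_plant]
  rfl

variable {n : ℕ}

theorem card_few_bad {A : Matrix (Fin (2 ^ blockCount n)) (Fin n) (ZMod 2)} {δ : ℝ}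
    (hA : SmallBiased A δ) (hδ : 0 ≤ δ) {C : MajLtfLtf (Fin n ⊕ Fin n)} (hC : ComputesB A C) {M : ℕ}
    (hT : C.top.card ≤ M) (hM : 0 < M) (hδM : 64 * M ^ 2 * δ ≤ 1)
    (h : blockCount n * (n / blockCount n) ≤ n) (t : ℕ) (p : Fin (blockCount n) → Fin (n / blockCount n))
    (a : Fin (blockCount n) → Fin (n / blockCount n) → Bool) :
    (univ.filter fun x : Fin n → Bool => (badGates h C x p a).card ≤ t).card ≤
      (2 ^ blockCount n + 1) ^ ((blockCount n + 1) * t + (blockCount n + t + 1)) *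
        (32 * M ^ 2) + 1 := by
  classical
  set S := univ.filter fun x : Fin n → Bool => (badGates h C x p a).card ≤ t with hS
  -- The zero input is set aside, as its codeword has no small bias; it accounts for the summand
  -- `1`.
  have h1 := card_le_of_majority hA hδ (shiftedPosition (restParity p a)) C.top hT hM hδM t
    (S.erase fun _ => false) (fun x hx => ne_of_mem_erase hx)
    (fun x i z => C.middleVal (Sum.elim x (embed h (plant p a z))) i) (fun x _ z => ?_)
    fun x hx i => isDepthTwo_middleVal h C (mem_filter.1 (mem_of_mem_erase hx)).2 i
  · have := pred_card_le_card_erase (s := S) (a := fun _ => false)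
    omega
  · rw [← hardB_embed_plant h]
    exact hC x _

/-- If restrictions leave few complicated gates on average, some restriction does so for most
inputs. -/
theorem exists_restriction {k b : ℕ} [Nonempty (Fin b)] (h : k * b ≤ n)
    (C : MajLtfLtf (Fin n ⊕ Fin n)) (t : ℕ)
    (havg : 𝔼 x, 𝔼 p, 𝔼 a, ((badGates h C x p a).card : ℝ) ≤ t / 2) :
    ∃ p a, 2 ^ n ≤ 2 * (univ.filter fun x => (badGates h C x p a).card ≤ t).card := by
  rw [expect_comm] at havg
  obtain ⟨p, -, hp⟩ := exists_le_of_expect_le univ_nonempty havg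
  rw [expect_comm] at hp
  obtain ⟨a, -, ha⟩ := exists_le_of_expect_le univ_nonempty hp
  refine ⟨p, a, ?_⟩
  have hcompl := card_filter_add_card_filter_not (s := (univ : Finset (Fin n → Bool)))
    fun x => (badGates h C x p a).card ≤ t
  set N := (univ.filter fun x => ¬ (badGates h C x p a).card ≤ t).card with hN
  rw [Fintype.expect_eq_sum_div_card, div_le_iff₀ (Nat.cast_pos.2 Fintype.card_pos)] at ha
  -- Markov's inequality: every exceptional input contributes at least `t + 1`, while the average is
  -- at most `t / 2`.
  have h1 : N * (t + 1) ≤ ∑ x, (badGates h C x p a).card := by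
    rw [hN, ← smul_eq_mul]
    refine (card_nsmul_le_sum _ (fun x => (badGates h C x p a).card) _ fun x hx => ?_).trans
      (sum_le_sum_of_subset (filter_subset _ _))
    have := (mem_filter.1 hx).2
    omega
  simp only [card_univ, Fintype.card_fun, Fintype.card_bool, Fintype.card_fin] at ha hcompl
  have h2 : (N : ℝ) * (t + 1) ≤ t / 2 * 2 ^ n := by
    refine le_trans ?_ (ha.trans_eq (by push_cast; ring))
    exact_mod_cast h1
  have h3 : N * (t + 1) * 2 ≤ t * 2 ^ n := by
    have : (N : ℝ) * (t + 1) * 2 ≤ t * 2 ^ n := by linarith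
    exact_mod_cast this
  have h4 : N * 2 ≤ 2 ^ n := by
    by_contra! hlt
    have : t * 2 ^ n ≤ t * (N * 2) := Nat.mul_le_mul_left _ hlt.le
    nlinarith
  omega

theorem expect_card_badGates {k b : ℕ} (h : k * b ≤ n) (C : MajLtfLtf (Fin n ⊕ Fin n))
    (B : Fin C.numBottom → ℝ)
    (hB : ∀ l x, (open Classical in 𝔼 p, 𝔼 a,
      (if Bad (orientation h (C.bottom l)) (blockGate h (C.bottom l) x) p a then 1 else 0 : ℝ)) ≤
        B l) : 𝔼 x, 𝔼 p, 𝔼 a, ((badGates h C x p a).card : ℝ) ≤ ∑ l, B l := by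
  classical
  simp only [badGates, natCast_card_filter, expect_sum_comm]
  exact sum_le_sum fun l _ => expect_le univ_nonempty fun x _ => by convert hB l x

/-- The final numerical contradiction, with `2 ^ E` bounding the number of restricted functions and
`M = n ^ 3` the fan-in of the majority. -/
theorem eventually_pow_lt : ∀ᶠ n : ℕ in Filter.atTop, ∀ E : ℕ, 4 * E ≤ n →
    2 * (2 ^ E * (32 * (n ^ 3) ^ 2) + 1) < 2 ^ n := by
  have h1 : ∀ᶠ m : ℕ in Filter.atTop, (64 * 8 ^ 6 : ℝ) * (m : ℝ) ^ 6 ≤ 2 ^ m := by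
    have := (isLittleO_pow_const_const_pow_of_one_lt (R := ℝ) 6 one_lt_two).bound
      (c := (64 * 8 ^ 6)⁻¹) (by positivity)
    filter_upwards [this] with m hm
    rw [Real.norm_of_nonneg (by positivity), Real.norm_of_nonneg (by positivity)] at hm
    rwa [inv_mul_eq_div, le_div_iff₀' (by positivity)] at hm
  have h4 : Filter.Tendsto (fun n : ℕ => n / 4) Filter.atTop Filter.atTop :=
    Nat.tendsto_div_const_atTop (by norm_num)
  filter_upwards [h4.eventually h1, Filter.eventually_ge_atTop 8] with n hn hn8 E hE
  have hm : (64 * 8 ^ 6) * (n / 4) ^ 6 ≤ 2 ^ (n / 4) := by exact_mod_cast hn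
  set m := n / 4 with hm'
  have hnm : n ≤ 8 * m := by omega
  have hEm : E ≤ m := by omega
  have hm2 : 2 ≤ m := by omega
  have e1 : 2 ^ E ≤ 2 ^ m := Nat.pow_le_pow_right two_pos hEm
  have e2 : (n ^ 3) ^ 2 ≤ 8 ^ 6 * m ^ 6 := by
    rw [← pow_mul, ← mul_pow]
    exact Nat.pow_le_pow_left hnm _
  have e3 : 2 ^ (4 * m) ≤ 2 ^ n := Nat.pow_le_pow_right two_pos (by omega)
  have e4 : 2 ^ (4 * m) = 2 ^ m * 2 ^ m * (2 ^ m * 2 ^ m) := by ring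
  have e5 : 4 ≤ 2 ^ m := (Nat.pow_le_pow_right two_pos hm2 : 2 ^ 2 ≤ 2 ^ m)
  calc 2 * (2 ^ E * (32 * (n ^ 3) ^ 2) + 1) ≤ 2 * (2 ^ m * (32 * (8 ^ 6 * m ^ 6)) + 1) := by gcongr
    _ = 2 ^ m * ((64 * 8 ^ 6) * m ^ 6) + 2 := by ring
    _ ≤ 2 ^ m * 2 ^ m + 2 := by gcongr
    _ < 2 ^ m * 2 ^ m * (2 ^ m * 2 ^ m) := by
      have e6 : 4 * 4 ≤ 2 ^ m * 2 ^ m := Nat.mul_le_mul e5 e5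
      nlinarith
    _ ≤ 2 ^ n := e4 ▸ e3

theorem blockCount_le_log (hn : 3 ≤ n) : (blockCount n : ℝ) ≤ 40 * Real.log n := by
  have hn' : (3 : ℝ) ≤ n := by exact_mod_cast hn
  have hlog : 1 ≤ Real.log n := by
    rw [Real.le_log_iff_exp_le (by linarith)]
    linarith [Real.exp_one_lt_d9]
  have h1 : (Nat.clog 2 n : ℝ) ≤ Real.logb 2 n + 1 := by
    have := Real.natCeil_logb_natCast 2 n
    rw [← this]
    exact (Nat.ceil_lt_add_one (Real.logb_nonneg one_lt_two (by linarith))).le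
  have h2 : Real.logb 2 n ≤ 3 / 2 * Real.log n := by
    rw [Real.logb, div_le_iff₀ (Real.log_pos one_lt_two)]
    nlinarith [Real.log_two_gt_d9]
  rw [blockCount]
  push_cast
  linarith

/-- The factor `16` in `blockCount` is chosen for this: the bias is at most `|K| / n ^ 7`, small
compared with `1 / M ^ 2` for `M = n ^ 3`. -/
theorem pow_eight_le (n : ℕ) : (n : ℝ) ^ 8 ≤ √((2 : ℝ) ^ blockCount n) := by
  refine Real.le_sqrt_of_sq_le ?_
  have h : n ≤ 2 ^ Nat.clog 2 n := Nat.le_pow_clog one_lt_two n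
  have h' : (n : ℝ) ≤ 2 ^ Nat.clog 2 n := by exact_mod_cast h
  rw [blockCount, mul_comm 16, pow_mul 2, ← pow_mul (n : ℝ)]
  exact pow_le_pow_left₀ (Nat.cast_nonneg _) h' 16

theorem eventually_blockCount_sq : ∀ᶠ n : ℕ in Filter.atTop, 80 * blockCount n ^ 2 ≤ n := by
  have h := (Real.isLittleO_pow_log_id_atTop (n := 2)).bound (c := (80 * 40 ^ 2)⁻¹) (by positivity)
  filter_upwards [tendsto_natCast_atTop_atTop.eventually h, Filter.eventually_ge_atTop 3]
    with n hn hn3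
  have hk := blockCount_le_log hn3
  rw [Real.norm_of_nonneg (by positivity), id, Real.norm_of_nonneg (by positivity),
    inv_mul_eq_div, le_div_iff₀' (by positivity)] at hn
  have : (80 : ℝ) * blockCount n ^ 2 ≤ n := by
    have := pow_le_pow_left₀ (Nat.cast_nonneg _) hk 2
    nlinarith
  exact_mod_cast this

/-- Circuits with few sources of the output gate and few complicated gates under restrictions do
not compute `B_n`. -/
theorem eventually_not_computes (K : ℝ) : ∀ᶠ n : ℕ in Filter.atTop,
    ∀ A : Matrix (Fin (2 ^ blockCount n)) (Fin n) (ZMod 2), SmallBiased A (biasBound K n) →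
    ∀ C : MajLtfLtf (Fin n ⊕ Fin n), ComputesB A C → C.top.card ≤ n ^ 3 →
    (n / (96 * blockCount n ^ 2) : ℝ) < 𝔼 x, 𝔼 p, 𝔼 a,
      ((badGates (Nat.mul_div_le n (blockCount n)) C x p a).card : ℝ) := by
  filter_upwards [eventually_pow_lt, eventually_blockCount_sq, Filter.eventually_ge_atTop 3,
    Filter.eventually_ge_atTop ⌈64 * |K|⌉₊] with n hpow hk hn3 hK A hA C hC hT
  by_contra! havg
  set k := blockCount n with hk'
  have hn0 : 0 < n := by omega
  have hk16 : 16 ≤ k := by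
    have : 0 < Nat.clog 2 n := Nat.clog_pos one_lt_two (by omega)
    rw [hk', blockCount]
    omega
  have hkn : k ≤ n := by nlinarith
  have : Nonempty (Fin (n / k)) := Fin.pos_iff_nonempty.1 (Nat.div_pos hkn (by omega))
  -- Twice the assumed average, as Markov requires, and small enough that `k ^ 2 * t` stays well
  -- below `n`.
  set t := ⌈(n / (48 * k ^ 2) : ℝ)⌉₊ with ht
  have ht1 : (n / (48 * k ^ 2) : ℝ) ≤ t := Nat.le_ceil _
  have ht2 : (t : ℝ) < n / (48 * k ^ 2) + 1 := Nat.ceil_lt_add_one (by positivity)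
  have hkpos : (0 : ℝ) < k := Nat.cast_pos.2 (by omega)
  obtain ⟨p, a, hpa⟩ := exists_restriction (Nat.mul_div_le n k) C t (havg.trans (by
    rw [le_div_iff₀ two_pos]
    refine le_trans (le_of_eq ?_) ht1
    field_simp
    norm_num))
  have hnpos : (0 : ℝ) < n := Nat.cast_pos.2 hn0
  have hKn : 64 * |K| ≤ n := Nat.ceil_le.1 hK
  have hbias : biasBound K n ≤ |K| * n / n ^ 8 := by
    rw [biasBound]
    have := pow_eight_le n
    gcongr
    exact le_abs_self K
  have hcard : (univ.filter fun x : Fin n → Bool =>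
      (badGates (Nat.mul_div_le n k) C x p a).card ≤ t).card ≤
        (2 ^ k + 1) ^ ((k + 1) * t + (k + t + 1)) * (32 * (n ^ 3) ^ 2) + 1 := card_few_bad (fun v hv => (hA v hv).trans hbias) (by positivity) hC hT
    (by positivity) (by
      push_cast
      rw [mul_div_assoc', div_le_one (by positivity)]
      calc 64 * ((n : ℝ) ^ 3) ^ 2 * (|K| * n) = 64 * |K| * n ^ 7 := by ring
        _ ≤ (n : ℝ) * n ^ 7 := by gcongr
        _ = (n : ℝ) ^ 8 := by ring) (Nat.mul_div_le n k) t p a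
  -- Since `2 ^ k + 1 ≤ 2 ^ (k + 1)`, the number of depth-two functions is at most `2 ^ E`. Here `E
  -- ≤ 2 * k ^ 2 * t + 2 * k ^ 2`, so `4 * E ≤ n / 6 + 16 * k ^ 2`, which is at most `n` as `80 * k
  -- ^ 2 ≤ n`.
  set E := (k + 1) * ((k + 1) * t + (k + t + 1)) with hE
  have hE4 : 4 * E ≤ n := by
    have h1 : (48 * k ^ 2 : ℝ) * t ≤ n + 48 * k ^ 2 := by
      have := mul_le_mul_of_nonneg_left ht2.le (by positivity : (0 : ℝ) ≤ 48 * k ^ 2)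
      rw [mul_add, mul_div_cancel₀ _ (by positivity)] at this
      linarith
    have h2 : 48 * k ^ 2 * t ≤ n + 48 * k ^ 2 := by exact_mod_cast h1
    have h3 : E ≤ 2 * k ^ 2 * t + 2 * k ^ 2 := by
      have e1 : k * 16 ≤ k * k := Nat.mul_le_mul_left k hk16
      have e2 : k * t * 16 ≤ k * t * k := Nat.mul_le_mul_left _ hk16
      have e3 : t * 256 ≤ t * (k * k) := Nat.mul_le_mul_left _ (by nlinarith)
      have e4 : E = k * t * k + 3 * (k * t) + 2 * t + k * k + 2 * k + 1 := by rw [hE]; ring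
      rw [e4]
      nlinarith
    nlinarith
  have hfin := hpow E hE4
  have hle : (2 ^ k + 1) ^ ((k + 1) * t + (k + t + 1)) ≤ 2 ^ E := by
    rw [hE, pow_mul]
    refine Nat.pow_le_pow_left ?_ _
    have := Nat.one_le_two_pow (n := k)
    rw [pow_succ]
    omega
  have := Nat.mul_le_mul_right (32 * (n ^ 3) ^ 2) hle
  omega

theorem card_top_le_wires (C : MajLtfLtf (Fin n ⊕ Fin n)) : C.top.card ≤ C.wires :=
  Nat.le_add_left _ _

theorem card_top_le_gates (C : MajLtfLtf (Fin n ⊕ Fin n)) : C.top.card ≤ 2 * n + C.gates := by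
  refine (card_le_univ _).trans ?_
  simp [MajLtfLtf.gates]
  omega

theorem rpow_three_halves {x : ℝ} (hx : 0 < x) : x ^ (3 / 2 : ℝ) = x * √x := by
  rw [show (3 / 2 : ℝ) = 1 + 1 / 2 by norm_num, Real.rpow_add hx, Real.rpow_one,
    Real.sqrt_eq_rpow]

theorem rpow_five_halves {x : ℝ} (hx : 0 < x) : x ^ (5 / 2 : ℝ) = x ^ 2 * √x := by
  rw [show (5 / 2 : ℝ) = (2 : ℕ) + 1 / 2 by norm_num, Real.rpow_add hx, Real.rpow_natCast,
    Real.sqrt_eq_rpow]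

theorem rpow_seven_halves {x : ℝ} (hx : 0 < x) : x ^ (7 / 2 : ℝ) = x ^ 3 * √x := by
  rw [show (7 / 2 : ℝ) = (3 : ℕ) + 1 / 2 by norm_num, Real.rpow_add hx, Real.rpow_natCast,
    Real.sqrt_eq_rpow]

/-- The length of the blocks is proportional to `n / k`. -/
theorem le_blockLength {k : ℕ} (hk : 0 < k) (hkn : 2 * k ≤ n) :
    (n / (2 * k) : ℝ) ≤ ((n / k : ℕ) : ℝ) := by
  have h1 : n < k * (n / k + 1) := Nat.lt_mul_div_succ n hk
  have h2 : 2 ≤ n / k := (Nat.le_div_iff_mul_le hk).2 hkn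
  have h3 : n ≤ (n / k) * (2 * k) := by nlinarith
  have hk' : (0 : ℝ) < k := Nat.cast_pos.2 hk
  rw [div_le_iff₀ (by positivity)]
  exact_mod_cast h3

/-- At most `n` bits of `a` are wired to any gate, so the square root bound is uniform over gates.
-/
theorem expect_bad_gates_le {k b : ℕ} (hb : 0 < b) (h : k * b ≤ n)
    (C : MajLtfLtf (Fin n ⊕ Fin n)) :
    𝔼 x, 𝔼 p, 𝔼 a, ((badGates h C x p a).card : ℝ) ≤ C.gates * (3 * √n / b) := by
  have : Nonempty (Fin b) := Fin.pos_iff_nonempty.1 hb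
  refine (expect_card_badGates h C (fun _ => 3 * √n / b) fun l x => ?_).trans ?_
  · refine (unate_blockGate h (C.bottom l) x).expect_bad_le_sqrt.trans ?_
    rw [Fintype.card_fin]
    gcongr
    exact wiring_le h _
  · rw [sum_const, card_univ, Fintype.card_fin, nsmul_eq_mul]
    gcongr
    rw [MajLtfLtf.gates]
    omega

/-- The bound linear in the wiring adds up to the total number of wires. -/
theorem expect_bad_wires_le {k b : ℕ} (hb : 0 < b) (h : k * b ≤ n)
    (C : MajLtfLtf (Fin n ⊕ Fin n)) :
    𝔼 x, 𝔼 p, 𝔼 a, ((badGates h C x p a).card : ℝ) ≤ C.wires * (4 / (b * √b)) := by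
  have : Nonempty (Fin b) := Fin.pos_iff_nonempty.1 hb
  refine (expect_card_badGates h C (fun l => (C.bottom l).wires * (4 / (b * √b)))
    fun l x => ?_).trans ?_
  · refine (unate_blockGate h (C.bottom l) x).expect_bad_le.trans ?_
    rw [Fintype.card_fin, mul_comm 4, mul_div_assoc]
    gcongr
    exact wiring_le_wires h _
  · rw [← Finset.sum_mul, ← Nat.cast_sum]
    gcongr
    rw [MajLtfLtf.wires]
    omega

/-- With block length `b ≥ n / (2 * k)`, comparing the two bounds on the average gives about `n ^
(3/2) / (576 * k ^ 3)` gates and `n ^ (5/2) / (1536 * k ^ (7/2))` wires. Since `k ≤ 40 * log n`, the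
constant `1 / 10 ^ 10` leaves ample room. -/
theorem eventually_lower_bounds (K : ℝ) : ∀ᶠ n : ℕ in Filter.atTop,
    ∀ A : Matrix (Fin (2 ^ blockCount n)) (Fin n) (ZMod 2), SmallBiased A (biasBound K n) →
    ∀ C : MajLtfLtf (Fin n ⊕ Fin n), ComputesB A C →
      1 / 10 ^ 10 * ((n : ℝ) ^ (3 / 2 : ℝ) / Real.log n ^ 3) ≤ C.gates ∧
      1 / 10 ^ 10 * ((n : ℝ) ^ (5 / 2 : ℝ) / Real.log n ^ (7 / 2 : ℝ)) ≤ C.wires := by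
  filter_upwards [eventually_not_computes K, eventually_blockCount_sq,
    Filter.eventually_ge_atTop 3] with n hn hk hn3 A hA C hC
  have hmain := hn A hA C hC
  have hlogk := blockCount_le_log hn3
  set k := blockCount n with hk'
  have hk16 : 16 ≤ k := by
    have : 0 < Nat.clog 2 n := Nat.clog_pos one_lt_two (by omega)
    rw [hk', blockCount]
    omega
  have hkn : 2 * k ≤ n := by nlinarith
  have hb : 0 < n / k := Nat.div_pos (by omega) (by omega)
  have hbn := le_blockLength (by omega) hkn
  have hg := expect_bad_gates_le hb (Nat.mul_div_le n k) C
  have hw := expect_bad_wires_le hb (Nat.mul_div_le n k) C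
  have hn1 : (3 : ℝ) ≤ n := by exact_mod_cast hn3
  have hnpos : (0 : ℝ) < n := by linarith
  have hkpos : (0 : ℝ) < k := Nat.cast_pos.2 (by omega)
  have hlog : 1 ≤ Real.log n := by
    rw [Real.le_log_iff_exp_le hnpos]
    linarith [Real.exp_one_lt_d9]
  set ℓ := Real.log n with hℓ
  have hℓ0 : 0 < ℓ := by linarith
  set b := ((n / k : ℕ) : ℝ) with hb'
  have hbpos : 0 < b := Nat.cast_pos.2 hb
  have hsn : √(n : ℝ) ≤ n := Real.sqrt_le_iff.2 ⟨hnpos.le, by nlinarith⟩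
  have hsn0 : 0 < √(n : ℝ) := Real.sqrt_pos.2 hnpos
  have hss : √(n : ℝ) * √n = n := Real.mul_self_sqrt hnpos.le
  rw [rpow_three_halves hnpos, rpow_five_halves hnpos, rpow_seven_halves hℓ0]
  have hk3 : (k : ℝ) ^ 3 ≤ (40 * ℓ) ^ 3 := pow_le_pow_left₀ hkpos.le hlogk 3
  constructor
  · by_contra! hlt
    -- A circuit violating the bound also has a small majority: its inputs are distinct gates and
    -- input bits, so `n ^ 3` is a safe fan-in.
    have hT : C.top.card ≤ n ^ 3 := by
      have h1 : (C.gates : ℝ) ≤ n ^ 2 := by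
        refine hlt.le.trans ?_
        have h2 : n * √(n : ℝ) / ℓ ^ 3 ≤ n * √(n : ℝ) :=
          div_le_self (by positivity) (one_le_pow₀ hlog)
        have h3 : 0 ≤ n * √(n : ℝ) / ℓ ^ 3 := by positivity
        nlinarith
      have h2 : C.gates ≤ n ^ 2 := by exact_mod_cast h1
      have h3 := card_top_le_gates C
      have h4 : n ^ 3 = n * n ^ 2 := by ring
      nlinarith
    have h1 := (hmain hT).trans_le hg
    have h2 : 3 * √(n : ℝ) / b ≤ 3 * √n / (n / (2 * k)) := by gcongr
    have h3 : (n / (96 * k ^ 2) : ℝ) <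
        1 / 10 ^ 10 * (n * √(n : ℝ) / ℓ ^ 3) * (3 * √n / (n / (2 * k))) :=
      h1.trans_le (mul_le_mul hlt.le h2 (by positivity) (by positivity))
    have h4 : 1 / 10 ^ 10 * (n * √(n : ℝ) / ℓ ^ 3) * (3 * √n / (n / (2 * k))) =
        6 / 10 ^ 10 * n * k / ℓ ^ 3 := by
      field_simp
      rw [sq, hss]
      ring
    rw [h4, div_lt_div_iff₀ (by positivity) (by positivity)] at h3
    have h5 : (n : ℝ) * ℓ ^ 3 < n * (576 / 10 ^ 10 * k ^ 3) := by nlinarith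
    have h6 := lt_of_mul_lt_mul_left h5 hnpos.le
    have : 0 < ℓ ^ 3 := by positivity
    nlinarith
  · by_contra! hlt
    have hT : C.top.card ≤ n ^ 3 := by
      refine (card_top_le_wires C).trans ?_
      have h1 : (C.wires : ℝ) ≤ n ^ 3 := by
        refine hlt.le.trans ?_
        have hsl : 1 ≤ √ℓ := Real.one_le_sqrt.2 hlog
        have h2 : n ^ 2 * √(n : ℝ) / (ℓ ^ 3 * √ℓ) ≤ n ^ 2 * √(n : ℝ) :=
          div_le_self (by positivity) (one_le_mul_of_one_le_of_one_le (one_le_pow₀ hlog) hsl)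
        have h3 : 0 ≤ n ^ 2 * √(n : ℝ) / (ℓ ^ 3 * √ℓ) := by positivity
        have h4 : n ^ 2 * √(n : ℝ) ≤ n ^ 2 * n := by gcongr
        nlinarith
      exact_mod_cast h1
    have h1 := (hmain hT).trans_le hw
    have hsl : 0 < √ℓ := Real.sqrt_pos.2 hℓ0
    -- Here `7` bounds `√40`.
    have hkl : k * √(k : ℝ) ≤ 40 * ℓ * (7 * √ℓ) := by
      have : √(k : ℝ) ≤ 7 * √ℓ := by
        refine (Real.sqrt_le_sqrt hlogk).trans ?_
        rw [Real.sqrt_mul (by norm_num)]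
        gcongr
        exact Real.sqrt_le_iff.2 ⟨by norm_num, by norm_num⟩
      gcongr
    have hsk : 0 < √(k : ℝ) := Real.sqrt_pos.2 hkpos
    have hsb : √(n : ℝ) / (2 * √k) ≤ √b := by
      refine le_trans ?_ (Real.sqrt_le_sqrt hbn)
      rw [Real.sqrt_div hnpos.le, Real.sqrt_mul (by norm_num)]
      gcongr
      exact Real.sqrt_le_iff.2 ⟨by norm_num, by norm_num⟩
    have h2 : 4 / (b * √b) ≤ 4 / (n / (2 * k) * (√(n : ℝ) / (2 * √k))) := by gcongr
    have h3 : (n / (96 * k ^ 2) : ℝ) < 1 / 10 ^ 10 * (n ^ 2 * √(n : ℝ) / (ℓ ^ 3 * √ℓ)) *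
        (4 / (n / (2 * k) * (√(n : ℝ) / (2 * √k)))) :=
      h1.trans_le (mul_le_mul hlt.le h2 (by positivity) (by positivity))
    have h4 : 1 / 10 ^ 10 * (n ^ 2 * √(n : ℝ) / (ℓ ^ 3 * √ℓ)) *
        (4 / (n / (2 * k) * (√(n : ℝ) / (2 * √k)))) =
          16 / 10 ^ 10 * n * (k * √k) / (ℓ ^ 3 * √ℓ) := by
      field_simp
      norm_num
    rw [h4, div_lt_div_iff₀ (by positivity) (by positivity)] at h3
    have h5 : (n : ℝ) * (ℓ ^ 3 * √ℓ) < n * (1536 / 10 ^ 10 * (k * √k * k ^ 2)) := by nlinarith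
    have h6 := lt_of_mul_lt_mul_left h5 hnpos.le
    have h7 : k * √k * k ^ 2 ≤ 40 * ℓ * (7 * √ℓ) * (40 * ℓ) ^ 2 := by gcongr
    have h8 : 40 * ℓ * (7 * √ℓ) * (40 * ℓ) ^ 2 = 448000 * (ℓ ^ 3 * √ℓ) := by ring
    have : 0 < ℓ ^ 3 * √ℓ := by positivity
    rw [h8] at h7
    linarith

end LowerBound

theorem mainTheorem4 :
    -- there are matrices of small-biased sets for which `B_n` is computable in polynomial time
    (∃ (K : ℝ) (A : (n : ℕ) → Matrix (Fin (2 ^ blockCount n)) (Fin n) (ZMod 2))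
        (f : List Bool → Bool),
      (∀ n, SmallBiased (A n) (biasBound K n)) ∧
      PolyTime f ∧
      ∀ (n : ℕ) (x a : Fin n → Bool), f (List.ofFn x ++ List.ofFn a) = hardB (A n) x a) ∧
    -- and for any matrices of small-biased sets, `B_n` has no small circuits
    (∃ c : ℝ, 0 < c ∧ ∀ K : ℝ, ∃ N : ℕ, ∀ n : ℕ, N ≤ n →
      ∀ A : Matrix (Fin (2 ^ blockCount n)) (Fin n) (ZMod 2), SmallBiased A (biasBound K n) →
      ∀ C : MajLtfLtf (Fin n ⊕ Fin n), ComputesB A C →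
        c * ((n : ℝ) ^ (3 / 2 : ℝ) / Real.log n ^ 3) ≤ C.gates ∧
        c * ((n : ℝ) ^ (5 / 2 : ℝ) / Real.log n ^ (7 / 2 : ℝ)) ≤ C.wires) := by
  refine ⟨⟨1, HardProgram.hardMatrix, HardProgram.output, HardProgram.smallBiased_hardMatrix,
    HardProgram.polyTime_output, fun n x a => HardProgram.output_eq_hardB x a⟩,
    1 / 10 ^ 10, by norm_num, fun K => ?_⟩
  exact Filter.eventually_atTop.1 (LowerBound.eventually_lower_bounds K)
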